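/- All vector spaces are real and $\mathbb{Z}/2\mathbb{Z}$-graded (super), and signs follow the Koszul rule. Let $A$ be a contractible differential graded commutative Frobenius algebra with an odd symmetric scalar product: a finite-dimensional supercommutative associative (not necessarily unital) algebra with an odd derivation $d$, $d^2=0$, with vanishing $d$-cohomology, and with an odd symmetric nondegenerate bilinear form $\langle-,-\rangle$ such that $\langle ab,c\rangle=\langle a,bc\rangle$ and $\langle da,b\rangle+(-1)^{a}\langle a,db\rangle=0$. Let $n,m\ge 0$ and let $V$ be the superspace with even coordinates $p_1,\dots,p_n,q_1,\dots,q_n$, odd coordinates $x_1,\dots,x_m$ and symplectic form $\omega=\sum dp_i\,dq_i+\frac12\sum dx_i\,dx_i$. Let $\mathfrak{g}_{2n|m}=\bigoplus_{i\ge2}S^i(V^*)$ with its Poisson bracket, $\mathfrak{osp}_{2n|m}=S^2(V^*)$ and $\tilde{\mathfrak g}_{2n|m}=\bigoplus_{i\ge3}S^i(V^*)$. The relative cohomology $H^\bullet(\mathfrak{g}_{2n|m},\mathfrak{osp}_{2n|m})$ is the cohomology of the linear dual of the complex of $\mathfrak{osp}_{2n|m}$-coinvariants of the Chevalley–Eilenberg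 complex $\Lambda(\tilde{\mathfrak g}_{2n|m})$. For $h\in S^N(V^*)$, $N\ge 2$, let $\Psi_A(h)\in S^N(A^*\otimes V^*)$ be the image of $\tilde m_{N-1}\otimes h$, where $\tilde m_{N-1}(a_1,\dots,a_N)=\langle a_1\cdots a_{N-1},a_N\rangle$. Let $\tilde\sigma\in S^2(A^*\otimes V^*)$ be the quadratic function with bilinear form $$\langle a\otimes v,b\otimes w\rangle_{\tilde d}=(-1)^{a+v b}\langle a,db\rangle\,\omega(v,w),$$ where $\omega(v,w)$ is the bilinear form on $V$ given by $\omega$. For a subspace $L\subset A$ that is maximally isotropic and satisfies $A=L\oplus d(A)$, put $$S_A^L(h_1\wedge\cdots\wedge h_l)=(-1)^{p(h)}\frac{\int_{L\otimes V}\Psi_A(h_1)\cdots\Psi_A(h_l)\,e^{-\tilde\sigma}}{\int_{L\otimes V}e^{-\tilde\sigma}},\qquad p(h)=\sum_{i<j}|h_i|,$$ for homogeneous $h_1,\dots,h_l\in\tilde{\mathfrak g}_{2n|m}$, the superintegrals being Gaussian integrals defined by Wick rotation. Then subspaces $L$ as above exist; for each of them the integrals can be computed in suitable linear coordinates on $L\otimes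 V$, the denominator is nonzero, and $S_A^L$ is, independently of these coordinates, a well-defined cocycle of the relative Chevalley–Eilenberg complex; and its cohomology class does not depend on $L$. Thus there is a unique class $S_A\in H^\bullet(\mathfrak{g}_{2n|m},\mathfrak{osp}_{2n|m})$ which is the class of $S_A^L$ for every such $L$. -/

import Mathlib

open scoped TensorProduct

noncomputable section

namespace DualConstruction

/-- The sign `(-1)^p` of a parity `p`. -/
def sgn (p : ZMod 2) : ℝ := if p = 0 then 1 else -1

/-! ### Polynomial superfunctions

A superspace with homogeneous coordinates indexed by `K` is described by the parities
`par : K → ZMod 2` of its coordinates. -/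

section SuperPoly

variable {K : Type}

/-- Indices of the even coordinates. -/
abbrev Ev (par : K → ZMod 2) : Type := {k : K // par k = 0}

/-- Indices of the odd coordinates. -/
abbrev Od (par : K → ZMod 2) : Type := {k : K // par k ≠ 0}

/-- Polynomial superfunctions, i.e. the free supercommutative algebra on the coordinates:
polynomials in the even coordinates tensored with the exterior algebra on the odd ones.
(Even elements commute with everything, so the tensor product of algebras needs no signs.) -/
abbrev SuperPoly (par : K → ZMod 2) : Type :=
  MvPolynomial (Ev par) ℝ ⊗[ℝ] ExteriorAlgebra ℝ (Od par →₀ ℝ)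

variable (par : K → ZMod 2)

/-- The coordinate function with index `k`. -/
def coord (k : K) : SuperPoly par :=
  if h : par k = 0 then MvPolynomial.X ⟨k, h⟩ ⊗ₜ[ℝ] 1
  else 1 ⊗ₜ[ℝ] ExteriorAlgebra.ι ℝ (Finsupp.single ⟨k, h⟩ 1)

/-- The product of the coordinate functions in a word. -/
def monomial (w : List K) : SuperPoly par := (w.map (coord par)).prod

/-- The partial derivative acting from the left (an odd derivation if the coordinate is odd). -/
def lderiv (k : K) : SuperPoly par →ₗ[ℝ] SuperPoly par :=
  if h : par k = 0 then
    TensorProduct.map (MvPolynomial.pderiv (R := ℝ) (⟨k, h⟩ : Ev par)).toLinearMap LinearMap.id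
  else
    TensorProduct.map LinearMap.id
      (CliffordAlgebra.contractLeft (Q := (0 : QuadraticForm ℝ (Od par →₀ ℝ)))
        (Finsupp.lapply (⟨k, h⟩ : Od par)))

/-- The partial derivative acting from the right. -/
def rderiv (k : K) : SuperPoly par →ₗ[ℝ] SuperPoly par :=
  if h : par k = 0 then
    TensorProduct.map (MvPolynomial.pderiv (R := ℝ) (⟨k, h⟩ : Ev par)).toLinearMap LinearMap.id
  else
    TensorProduct.map LinearMap.id
      ((CliffordAlgebra.contractRight (Q := (0 : QuadraticForm ℝ (Od par →₀ ℝ)))).flip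
        (Finsupp.lapply (⟨k, h⟩ : Od par)))

/-- The part of parity `q` of the superalgebra of functions. -/
def parityPart (q : ZMod 2) : Submodule ℝ (SuperPoly par) :=
  Submodule.span ℝ {f | ∃ w : List K, (w.map par).sum = q ∧ f = monomial par w}

/-- The part `S^N` of polynomial degree `N`. -/
def degreePart (N : ℕ) : Submodule ℝ (SuperPoly par) :=
  Submodule.span ℝ {f | ∃ w : List K, w.length = N ∧ f = monomial par w}

/-- The part `⨁_{i ≥ N} S^i` of order at least `N`. -/
def orderPart (N : ℕ) : Submodule ℝ (SuperPoly par) :=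
  Submodule.span ℝ {f | ∃ w : List K, N ≤ w.length ∧ f = monomial par w}

/-- Restriction of a superfunction to the body (all odd coordinates are set to `0`). -/
def body : SuperPoly par →ₗ[ℝ] MvPolynomial (Ev par) ℝ :=
  (TensorProduct.rid ℝ (MvPolynomial (Ev par) ℝ)).toLinearMap ∘ₗ
    TensorProduct.map LinearMap.id
      (ExteriorAlgebra.algebraMapInv (R := ℝ) (M := Od par →₀ ℝ)).toLinearMap

/-- For `w = k₁ ⋯ k_N` the operator `∂_{k_N} ⋯ ∂_{k_1}` (so `∂_{k_1}` is applied first). -/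
def wordDeriv : List K → (SuperPoly par →ₗ[ℝ] SuperPoly par)
  | [] => LinearMap.id
  | k :: w => wordDeriv w ∘ₗ lderiv par k

/-- The number `(∂_{k_N} ⋯ ∂_{k_1} f)(0)`.  For `f` of degree `N`, these are the coefficients
of the invariant tensor `i_N(f) = ∑_w (∂_w f)(0) x_{k_1} ⊗ ⋯ ⊗ x_{k_N}` associated to `f`. -/
def taylorCoeff (w : List K) (f : SuperPoly par) : ℝ :=
  MvPolynomial.constantCoeff (body par (wordDeriv par w f))

/-! #### Orders of products and derivatives -/

theorem monomial_cons (k : K) (w : List K) :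
    monomial par (k :: w) = coord par k * monomial par w := by
  simp [monomial]

theorem monomial_append (v w : List K) :
    monomial par (v ++ w) = monomial par v * monomial par w := by
  simp [monomial]

theorem monomial_mem {N : ℕ} {w : List K} (h : N ≤ w.length) :
    monomial par w ∈ orderPart par N :=
  Submodule.subset_span ⟨w, h, rfl⟩

theorem orderPart_anti {M N : ℕ} (h : M ≤ N) : orderPart par N ≤ orderPart par M := by
  refine Submodule.span_mono ?_
  rintro f ⟨w, hw, rfl⟩
  exact ⟨w, h.trans hw, rfl⟩

theorem degreePart_le (N : ℕ) : degreePart par N ≤ orderPart par N := by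
  refine Submodule.span_mono ?_
  rintro f ⟨w, hw, rfl⟩
  exact ⟨w, hw.ge, rfl⟩

theorem mul_mem_orderPart {M N : ℕ} {f g : SuperPoly par} (hf : f ∈ orderPart par M)
    (hg : g ∈ orderPart par N) : f * g ∈ orderPart par (M + N) := by
  have h : f * g ∈ orderPart par M * orderPart par N := Submodule.mul_mem_mul hf hg
  rw [orderPart, orderPart, Submodule.span_mul_span] at h
  refine Submodule.span_mono ?_ h
  rintro _ ⟨_, ⟨v, hv, rfl⟩, _, ⟨w, hw, rfl⟩, rfl⟩
  exact ⟨v ++ w, by simp; omega, (monomial_append par v w).symm⟩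

theorem lderiv_coord_mul (k j : K) : ∃ a b : ℝ, ∀ f : SuperPoly par,
    lderiv par k (coord par j * f) = a • f + b • (coord par j * lderiv par k f) := by
  classical
  by_cases hk : par k = 0 <;> by_cases hj : par j = 0
  · refine ⟨if k = j then 1 else 0, 1, fun f => ?_⟩
    induction f using TensorProduct.induction_on with
    | zero => simp
    | add x y hx hy => rw [mul_add, map_add, hx, hy, map_add, mul_add]; module
    | tmul x y =>
      by_cases h : k = j
      · subst h
        simp [lderiv, coord, hk, TensorProduct.add_tmul, mul_comm]
      · simp [lderiv, coord, hk, hj, h, Ne.symm h]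
  · refine ⟨0, 1, fun f => ?_⟩
    induction f using TensorProduct.induction_on with
    | zero => simp
    | add x y hx hy => rw [mul_add, map_add, hx, hy, map_add, mul_add]; module
    | tmul x y => simp [lderiv, coord, hk, hj]
  · refine ⟨0, 1, fun f => ?_⟩
    induction f using TensorProduct.induction_on with
    | zero => simp
    | add x y hx hy => rw [mul_add, map_add, hx, hy, map_add, mul_add]; module
    | tmul x y => simp [lderiv, coord, hk, hj]
  · refine ⟨if k = j then 1 else 0, -1, fun f => ?_⟩
    induction f using TensorProduct.induction_on with
    | zero => simp
    | add x y hx hy => rw [mul_add, map_add, hx, hy, map_add, mul_add]; module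
    | tmul x y =>
      have h1 := CliffordAlgebra.contractLeft_ι_mul (Q := (0 : QuadraticForm ℝ (Od par →₀ ℝ)))
        (d := Finsupp.lapply (⟨k, hk⟩ : Od par)) (Finsupp.single ⟨j, hj⟩ 1) y
      by_cases h : k = j
      · subst h
        simp [lderiv, coord, hk, ExteriorAlgebra.ι, h1, sub_eq_add_neg, TensorProduct.tmul_add,
          TensorProduct.tmul_neg]
        module
      · simp [lderiv, coord, hk, hj, h, ExteriorAlgebra.ι, h1, TensorProduct.tmul_neg]
        module

theorem rderiv_mul_coord (k j : K) : ∃ a b : ℝ, ∀ f : SuperPoly par,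
    rderiv par k (f * coord par j) = a • f + b • (rderiv par k f * coord par j) := by
  classical
  by_cases hk : par k = 0 <;> by_cases hj : par j = 0
  · refine ⟨if k = j then 1 else 0, 1, fun f => ?_⟩
    induction f using TensorProduct.induction_on with
    | zero => simp
    | add x y hx hy => rw [add_mul, map_add, hx, hy, map_add, add_mul]; module
    | tmul x y =>
      by_cases h : k = j
      · subst h
        simp [rderiv, coord, hk, TensorProduct.add_tmul, mul_comm]
      · simp [rderiv, coord, hk, hj, h, Ne.symm h, mul_comm]
  · refine ⟨0, 1, fun f => ?_⟩
    induction f using TensorProduct.induction_on with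
    | zero => simp
    | add x y hx hy => rw [add_mul, map_add, hx, hy, map_add, add_mul]; module
    | tmul x y => simp [rderiv, coord, hk, hj]
  · refine ⟨0, 1, fun f => ?_⟩
    induction f using TensorProduct.induction_on with
    | zero => simp
    | add x y hx hy => rw [add_mul, map_add, hx, hy, map_add, add_mul]; module
    | tmul x y => simp [rderiv, coord, hk, hj]
  · refine ⟨if k = j then 1 else 0, -1, fun f => ?_⟩
    induction f using TensorProduct.induction_on with
    | zero => simp
    | add x y hx hy => rw [add_mul, map_add, hx, hy, map_add, add_mul]; module
    | tmul x y =>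
      have h1 := CliffordAlgebra.contractRight_mul_ι (Q := (0 : QuadraticForm ℝ (Od par →₀ ℝ)))
        (d := Finsupp.lapply (⟨k, hk⟩ : Od par)) (Finsupp.single ⟨j, hj⟩ 1) y
      by_cases h : k = j
      · subst h
        simp [rderiv, coord, hk, ExteriorAlgebra.ι, h1, sub_eq_add_neg, TensorProduct.tmul_add,
          TensorProduct.tmul_neg]
        module
      · simp [rderiv, coord, hk, hj, h, ExteriorAlgebra.ι, h1, TensorProduct.tmul_neg]
        module

theorem coord_mem (k : K) : coord par k ∈ orderPart par 1 :=
  Submodule.subset_span ⟨[k], by simp, by simp [monomial]⟩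

theorem lderiv_monomial_mem (k : K) (w : List K) :
    lderiv par k (monomial par w) ∈ orderPart par (w.length - 1) := by
  induction w with
  | nil =>
    have h : lderiv par k (monomial par []) = 0 := by
      by_cases hk : par k = 0 <;>
        simp [lderiv, monomial, hk, Algebra.TensorProduct.one_def]
    rw [h]
    exact Submodule.zero_mem _
  | cons j w ih =>
    obtain ⟨a, b, h⟩ := lderiv_coord_mul par k j
    rw [monomial_cons, h]
    refine Submodule.add_mem _ (Submodule.smul_mem _ _ (monomial_mem par (by simp)))
      (Submodule.smul_mem _ _ ?_)
    exact orderPart_anti par (by simp; omega) (mul_mem_orderPart par (coord_mem par j) ih)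

theorem rderiv_monomial_mem (k : K) (w : List K) :
    rderiv par k (monomial par w) ∈ orderPart par (w.length - 1) := by
  induction w using List.reverseRecOn with
  | nil =>
    have h : rderiv par k (monomial par []) = 0 := by
      by_cases hk : par k = 0 <;>
        simp [rderiv, monomial, hk, Algebra.TensorProduct.one_def]
    rw [h]
    exact Submodule.zero_mem _
  | append_singleton w j ih =>
    obtain ⟨a, b, h⟩ := rderiv_mul_coord par k j
    rw [monomial_append, show monomial par [j] = coord par j by simp [monomial], h]
    refine Submodule.add_mem _ (Submodule.smul_mem _ _ (monomial_mem par (by simp)))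
      (Submodule.smul_mem _ _ ?_)
    exact orderPart_anti par (by simp; omega) (mul_mem_orderPart par ih (coord_mem par j))

theorem lderiv_mem (k : K) {N : ℕ} {f : SuperPoly par} (hf : f ∈ orderPart par (N + 1)) :
    lderiv par k f ∈ orderPart par N := by
  have h : orderPart par (N + 1) ≤ (orderPart par N).comap (lderiv par k) := by
    refine Submodule.span_le.2 ?_
    rintro _ ⟨w, hw, rfl⟩
    exact orderPart_anti par (by omega) (lderiv_monomial_mem par k w)
  exact h hf

theorem rderiv_mem (k : K) {N : ℕ} {f : SuperPoly par} (hf : f ∈ orderPart par (N + 1)) :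
    rderiv par k f ∈ orderPart par N := by
  have h : orderPart par (N + 1) ≤ (orderPart par N).comap (rderiv par k) := by
    refine Submodule.span_le.2 ?_
    rintro _ ⟨w, hw, rfl⟩
    exact orderPart_anti par (by omega) (rderiv_monomial_mem par k w)
  exact h hf

end SuperPoly

/-! ### The Lie superalgebras of Hamiltonians on the canonical symplectic superspace -/

section Hamiltonians

variable (n m : ℕ)

/-- Indices of the canonical coordinates `p_1, …, p_n; q_1, …, q_n; x_1, …, x_m`. -/
abbrev VIdx : Type := (Fin n ⊕ Fin n) ⊕ Fin m

/-- The coordinates `p_i, q_i` are even and the coordinates `x_i` are odd. -/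
def vPar : VIdx n m → ZMod 2
  | Sum.inl _ => 0
  | Sum.inr _ => 1

/-- The index of `p_i`. -/
def pIdx (i : Fin n) : VIdx n m := Sum.inl (Sum.inl i)

/-- The index of `q_i`. -/
def qIdx (i : Fin n) : VIdx n m := Sum.inl (Sum.inr i)

/-- The index of `x_i`. -/
def xIdx (i : Fin m) : VIdx n m := Sum.inr i

/-- The values `⟨v_i, v_j⟩` of the even skew-symmetric form on the canonical space `V`, i.e. the
form of `ω = ∑ dp_i dq_i + ½ ∑ dx_i dx_i`, on the basis dual to the canonical coordinates. -/
def symplecticForm : VIdx n m → VIdx n m → ℝ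
  | Sum.inl (Sum.inl i), Sum.inl (Sum.inr j) => if i = j then 1 else 0
  | Sum.inl (Sum.inr i), Sum.inl (Sum.inl j) => if i = j then -1 else 0
  | Sum.inr i, Sum.inr j => if i = j then 1 else 0
  | _, _ => 0

/-- The space `𝔥_{2n|m} = S(V^*)` of polynomial Hamiltonians. -/
abbrev Ham : Type := SuperPoly (vPar n m)

/-- The Poisson bracket `{a, b} = (-1)^a L_α(b)`, where `i_α ω = da`.  For the canonical `ω` the
field `α` has components `α(p_i) = (-1)^a ∂a/∂q_i`, `α(q_i) = -(-1)^a ∂a/∂p_i` and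
`α(x_i) = ∂a/∂x_i` (left derivative), which equals `-(-1)^a` times the right derivative. -/
def bracket (a b : Ham n m) : Ham n m :=
  (∑ i : Fin n,
    (lderiv (vPar n m) (qIdx n m i) a * lderiv (vPar n m) (pIdx n m i) b
      - lderiv (vPar n m) (pIdx n m i) a * lderiv (vPar n m) (qIdx n m i) b))
  - ∑ i : Fin m, rderiv (vPar n m) (xIdx n m i) a * lderiv (vPar n m) (xIdx n m i) b

theorem bracket_mem {M N : ℕ} {a b : Ham n m} (ha : a ∈ orderPart (vPar n m) (M + 1))
    (hb : b ∈ orderPart (vPar n m) (N + 1)) : bracket n m a b ∈ orderPart (vPar n m) (M + N) := by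
  refine Submodule.sub_mem _ (Submodule.sum_mem _ fun i _ => Submodule.sub_mem _ ?_ ?_)
    (Submodule.sum_mem _ fun i _ => ?_)
  · exact mul_mem_orderPart _ (lderiv_mem _ _ ha) (lderiv_mem _ _ hb)
  · exact mul_mem_orderPart _ (lderiv_mem _ _ ha) (lderiv_mem _ _ hb)
  · exact mul_mem_orderPart _ (rderiv_mem _ _ ha) (lderiv_mem _ _ hb)

/-- The Lie superalgebra `𝔤̃_{2n|m}` of Hamiltonians of order at least three. -/
abbrev GTilde : Type := orderPart (vPar n m) 3

/-- The Lie superalgebra `𝔬𝔰𝔭_{2n|m}` of quadratic Hamiltonians. -/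
abbrev Osp : Type := degreePart (vPar n m) 2

/-- The part of parity `q` of `𝔤̃_{2n|m}`. -/
def gTildeParity (q : ZMod 2) : Submodule ℝ (GTilde n m) :=
  (parityPart (vPar n m) q).comap (orderPart (vPar n m) 3).subtype

/-- The Lie bracket of `𝔤̃_{2n|m}`. -/
def gTildeBracket (a b : GTilde n m) : GTilde n m :=
  ⟨bracket n m a b, orderPart_anti _ (by omega) (bracket_mem n m (M := 2) (N := 2) a.2 b.2)⟩

/-- The action of `𝔬𝔰𝔭_{2n|m}` on `𝔤̃_{2n|m}` by brackets inside `𝔤_{2n|m}`. -/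
def ospBracket (η : Osp n m) (b : GTilde n m) : GTilde n m :=
  ⟨bracket n m η b,
    bracket_mem n m (M := 1) (N := 2) (degreePart_le (vPar n m) 2 η.2) b.2⟩

end Hamiltonians

/-! ### Relative Chevalley-Eilenberg cohomology -/

section ChevalleyEilenberg

/-- The relation `g ⊗ h = -(-1)^{|g||h|} h ⊗ g` for homogeneous `g, h`. -/
inductive ExteriorRel {M : Type} [AddCommMonoid M] [Module ℝ M] (gr : ZMod 2 → Submodule ℝ M) :
    TensorAlgebra ℝ M → TensorAlgebra ℝ M → Prop
  | swap {p q : ZMod 2} {g h : M} (hg : g ∈ gr p) (hh : h ∈ gr q) :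
      ExteriorRel gr (TensorAlgebra.ι ℝ g * TensorAlgebra.ι ℝ h)
        ((-sgn (p * q)) • (TensorAlgebra.ι ℝ h * TensorAlgebra.ι ℝ g))

variable (n m : ℕ)

/-- The space `Λ(𝔤̃_{2n|m})` of Chevalley-Eilenberg chains. -/
def Chains : Type := RingQuot (ExteriorRel (gTildeParity n m))

instance : Ring (Chains n m) := inferInstanceAs (Ring (RingQuot (ExteriorRel (gTildeParity n m))))

instance : Algebra ℝ (Chains n m) :=
  inferInstanceAs (Algebra ℝ (RingQuot (ExteriorRel (gTildeParity n m))))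

variable {n m}

/-- An element of `𝔤̃_{2n|m}` as a chain of degree one. -/
def generator (x : GTilde n m) : Chains n m :=
  RingQuot.mkAlgHom ℝ (ExteriorRel (gTildeParity n m)) (TensorAlgebra.ι ℝ x)

/-- The chain `g_1 ∧ ⋯ ∧ g_l`. -/
def wedge (g : List (GTilde n m)) : Chains n m :=
  (g.map generator).prod

/-- The Chevalley-Eilenberg boundary `δ(g_1 ∧ ⋯ ∧ g_l)` of elements `g_i` of parities `p_i`.
The indices are `0`-based, so the summand `i + j - 1` of the sign exponent reads `i + j + 1`. -/
def ceBoundary {l : ℕ} (g : Fin l → GTilde n m) (p : Fin l → ZMod 2) : Chains n m :=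
  ∑ i : Fin l, ∑ j : Fin l, if i < j then
    sgn (p i * (∑ k ∈ Finset.Iio i, p k) + p j * (∑ k ∈ Finset.Iio j, p k) + p i * p j
        + ((i.val + j.val + 1 : ℕ) : ZMod 2)) •
      wedge (gTildeBracket n m (g i) (g j) ::
        ((List.finRange l).filter fun k => k ≠ i ∧ k ≠ j).map g)
  else 0

/-- The adjoint action `η · (g_1 ∧ ⋯ ∧ g_l)` of a quadratic Hamiltonian `η` of parity `q` on
elements `g_i` of parities `p_i`. -/
def ospAction {l : ℕ} (η : Osp n m) (q : ZMod 2) (g : Fin l → GTilde n m) (p : Fin l → ZMod 2) :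
    Chains n m :=
  ∑ i : Fin l, sgn (q * ∑ k ∈ Finset.Iio i, p k) •
    wedge (List.ofFn (Function.update g i (ospBracket n m η (g i))))

variable (n m)

/-- The linear functionals on the space of chains. -/
def Cochains : Type := Module.Dual ℝ (Chains n m)

instance : AddCommGroup (Cochains n m) := inferInstanceAs (AddCommGroup (Module.Dual ℝ (Chains n m)))

instance : Module ℝ (Cochains n m) := inferInstanceAs (Module ℝ (Module.Dual ℝ (Chains n m)))

instance : FunLike (Cochains n m) (Chains n m) ℝ :=
  inferInstanceAs (FunLike (Module.Dual ℝ (Chains n m)) (Chains n m) ℝ)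

variable {n m} in
@[simp] theorem cochains_add_apply (φ ψ : Cochains n m) (c : Chains n m) :
    (φ + ψ) c = φ c + ψ c := rfl

variable {n m} in
@[simp] theorem cochains_zero_apply (c : Chains n m) : (0 : Cochains n m) c = 0 := rfl

variable {n m} in
@[simp] theorem cochains_smul_apply (a : ℝ) (φ : Cochains n m) (c : Chains n m) :
    (a • φ) c = a * φ c := rfl

/-- The relative cochains: the linear dual of the space of `𝔬𝔰𝔭_{2n|m}`-coinvariants of
`Λ(𝔤̃_{2n|m})`, that is, the linear functionals vanishing on all `η · c`.
(Homogeneous `η` and products of homogeneous elements span, so it is enough to use these.) -/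
def relCochains : Submodule ℝ (Cochains n m) where
  carrier := {φ | ∀ (q : ZMod 2) (η : Osp n m), (η : Ham n m) ∈ parityPart (vPar n m) q →
    ∀ (l : ℕ) (g : Fin l → GTilde n m) (p : Fin l → ZMod 2),
      (∀ i, g i ∈ gTildeParity n m (p i)) → φ (ospAction η q g p) = 0}
  add_mem' := by
    intro a b ha hb q η hη l g p hg
    simp [ha q η hη l g p hg, hb q η hη l g p hg]
  zero_mem' := by
    intro q η hη l g p hg
    simp
  smul_mem' := by
    intro c a ha q η hη l g p hg
    simp [ha q η hη l g p hg]

/-- The relative cocycles: the relative cochains `φ` with `φ ∘ δ = 0`. -/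
def relCocycles : Submodule ℝ (Cochains n m) where
  carrier := {φ | φ ∈ relCochains n m ∧
    ∀ (l : ℕ) (g : Fin l → GTilde n m) (p : Fin l → ZMod 2),
      (∀ i, g i ∈ gTildeParity n m (p i)) → φ (ceBoundary g p) = 0}
  add_mem' := by
    rintro a b ⟨ha, ha'⟩ ⟨hb, hb'⟩
    exact ⟨Submodule.add_mem _ ha hb, fun l g p hg => by simp [ha' l g p hg, hb' l g p hg]⟩
  zero_mem' := ⟨Submodule.zero_mem _, fun l g p hg => by simp⟩
  smul_mem' := by
    rintro c a ⟨ha, ha'⟩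
    exact ⟨Submodule.smul_mem _ c ha, fun l g p hg => by simp [ha' l g p hg]⟩

/-- The relative coboundaries: the functionals `ψ ∘ δ` for a relative cochain `ψ`. -/
def relCoboundaries : Submodule ℝ (Cochains n m) where
  carrier := {φ | ∃ ψ ∈ relCochains n m,
    ∀ (l : ℕ) (g : Fin l → GTilde n m) (p : Fin l → ZMod 2),
      (∀ i, g i ∈ gTildeParity n m (p i)) → φ (wedge (List.ofFn g)) = ψ (ceBoundary g p)}
  add_mem' := by
    rintro a b ⟨ψ, hψ, ha⟩ ⟨χ, hχ, hb⟩
    exact ⟨ψ + χ, Submodule.add_mem _ hψ hχ, fun l g p hg => by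
      simp [ha l g p hg, hb l g p hg]⟩
  zero_mem' := ⟨0, Submodule.zero_mem _, fun l g p hg => by simp⟩
  smul_mem' := by
    rintro c a ⟨ψ, hψ, ha⟩
    exact ⟨c • ψ, Submodule.smul_mem _ c hψ, fun l g p hg => by simp [ha l g p hg]⟩

/-- The relative cohomology `H^•(𝔤_{2n|m}, 𝔬𝔰𝔭_{2n|m})` (the total space, all degrees together):
cocycles modulo coboundaries of the linear dual of the relative Chevalley-Eilenberg complex. -/
abbrev RelCohomology : Type :=
  relCocycles n m ⧸ (relCoboundaries n m).submoduleOf (relCocycles n m)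

end ChevalleyEilenberg

/-! ### Contractible differential graded commutative Frobenius algebras -/

/-- A contractible differential `ℤ/2`-graded commutative Frobenius algebra structure with an odd
symmetric scalar product on the real associative (not necessarily unital) algebra `A`. -/
structure ContractibleDGFrobenius (A : Type*) [NonUnitalRing A] [Module ℝ A]
    [IsScalarTower ℝ A A] [SMulCommClass ℝ A A] where
  /-- the grading -/
  gr : ZMod 2 → Submodule ℝ A
  /-- the differential -/
  d : A →ₗ[ℝ] A
  /-- the scalar product -/
  form : A →ₗ[ℝ] A →ₗ[ℝ] ℝ
  isInternal : DirectSum.IsInternal gr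
  mul_mem : ∀ {p q : ZMod 2} {a b : A}, a ∈ gr p → b ∈ gr q → a * b ∈ gr (p + q)
  mul_comm : ∀ {p q : ZMod 2} {a b : A}, a ∈ gr p → b ∈ gr q → a * b = sgn (p * q) • (b * a)
  d_mem : ∀ {p : ZMod 2} {a : A}, a ∈ gr p → d a ∈ gr (p + 1)
  d_d : ∀ a : A, d (d a) = 0
  d_mul : ∀ {p : ZMod 2} {a : A} (b : A), a ∈ gr p → d (a * b) = d a * b + sgn p • (a * d b)
  form_odd : ∀ {p q : ZMod 2} {a b : A}, a ∈ gr p → b ∈ gr q → p + q = 0 → form a b = 0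
  form_symm : ∀ {p q : ZMod 2} {a b : A}, a ∈ gr p → b ∈ gr q →
    form a b = sgn (p * q) * form b a
  form_nondegenerate : Function.Bijective (form : A → Module.Dual ℝ A)
  form_mul : ∀ a b c : A, form (a * b) c = form a (b * c)
  form_d : ∀ {p : ZMod 2} {a : A} (b : A), a ∈ gr p → form (d a) b + sgn p * form a (d b) = 0
  /-- contractibility: the cohomology of `d` vanishes -/
  contractible : ∀ a : A, d a = 0 → ∃ b : A, d b = a

namespace ContractibleDGFrobenius

variable {A : Type*} [NonUnitalRing A] [Module ℝ A] [IsScalarTower ℝ A A] [SMulCommClass ℝ A A]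
variable (F : ContractibleDGFrobenius A)

/-- Isotropic (super)subspaces of `A`. -/
def IsIsotropic (L : Submodule ℝ A) : Prop :=
  L = (L ⊓ F.gr 0) ⊔ (L ⊓ F.gr 1) ∧ ∀ a ∈ L, ∀ b ∈ L, F.form a b = 0

/-- Maximally isotropic subspaces: isotropic subspaces of maximal dimension. -/
def IsMaxIsotropic (L : Submodule ℝ A) : Prop :=
  F.IsIsotropic L ∧
    ∀ L' : Submodule ℝ A, F.IsIsotropic L' → Module.finrank ℝ L' ≤ Module.finrank ℝ L

/-- The admissible gauge conditions: maximally isotropic `L` with `A = L ⊕ d(A)`. -/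
def IsGauge (L : Submodule ℝ A) : Prop :=
  F.IsMaxIsotropic L ∧ IsCompl L (LinearMap.range F.d)

/-- Auxiliary to `mTilde`: `c, (a_1, …, a_k) ↦ ⟨c a_1 ⋯ a_{k-1}, a_k⟩`. -/
def mTildeAux : A → List A → ℝ
  | _, [] => 0
  | c, [a] => F.form c a
  | c, a :: b :: w => mTildeAux (c * a) (b :: w)

/-- The tensor `m̃_k(a_1, …, a_{k+1}) = ⟨a_1 ⋯ a_k, a_{k+1}⟩`, `k ≥ 1`
(and zero on fewer than two arguments). -/
def mTilde : List A → ℝ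
  | [] => 0
  | a :: w => F.mTildeAux a w

section Subspace

/- In this section `e_1, …, e_r` is a homogeneous basis, with parities `par`, of a (super)subspace
`L` of `A`; functions on `L ⊗ V` are written in the coordinates `z_{(α, i)} = e^α ⊗ x_i`, where
`e^α` is the dual basis and `x_i` are the canonical coordinates of `V`. -/

variable {r : ℕ} (par : Fin r → ZMod 2) (e : Fin r → A) (n m : ℕ)

/-- Parities of the coordinates `z_{(α, i)}` of `L ⊗ V`. -/
def tensorPar (par : Fin r → ZMod 2) (n m : ℕ) : Fin r × VIdx n m → ZMod 2 :=
  fun k => par k.1 + vPar n m k.2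

/-- The restriction to `L ⊗ V` of the image in `S^N(A^* ⊗ V^*)` of `m̃ ⊗ x_{w_1} ⊗ ⋯ ⊗ x_{w_N}`.
Here `m̃` restricted to `L` is
`∑_α (-1)^{∑_{s<t} |α_s||α_t|} m̃(e_{α_1}, …, e_{α_N}) e^{α_1} ⊗ ⋯ ⊗ e^{α_N}`, and the identification
of `(A^*)^{⊗N} ⊗ (V^*)^{⊗N}` with `(A^* ⊗ V^*)^{⊗N}` gives the sign `(-1)^{∑_{s<t} |w_s||α_t|}`. -/
def psiWord {N : ℕ} (w : Fin N → VIdx n m) : SuperPoly (tensorPar par n m) :=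
  ∑ α : Fin N → Fin r,
    (sgn (∑ t : Fin N, ∑ s ∈ Finset.Iio t,
        (par (α s) * par (α t) + vPar n m (w s) * par (α t)))
      * F.mTilde (List.ofFn fun s => e (α s))) •
      monomial (tensorPar par n m) (List.ofFn fun s => (α s, w s))

/-- The component of degree `N` of the map `Ψ_A`, followed by restriction to `L ⊗ V`.
The degree `N` part of `h` is represented by the tensor
`(1/N!) ∑_w (∂_w h)(0) x_{w_1} ⊗ ⋯ ⊗ x_{w_N}`. -/
def psiDegree (N : ℕ) (h : Ham n m) : SuperPoly (tensorPar par n m) :=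
  (N.factorial : ℝ)⁻¹ • ∑ w : Fin N → VIdx n m,
    taylorCoeff (vPar n m) (List.ofFn w) h • F.psiWord par e n m w

/-- The function `Ψ_A(h)` on `A ⊗ V`, restricted to `L ⊗ V` (only finitely many `N` contribute). -/
def psi (h : Ham n m) : SuperPoly (tensorPar par n m) :=
  ∑ᶠ N : ℕ, F.psiDegree par e n m N h

/-- The restriction to `L ⊗ V` of the quadratic Hamiltonian `σ̃`, whose bilinear form is
`⟨a ⊗ v, b ⊗ w⟩ = (-1)^{|v||b|} ⟨a, b⟩_d ⟨v, w⟩_V` with `⟨a, b⟩_d = (-1)^a ⟨a, d b⟩_A`; again the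
sign expresses this form as a tensor in the `z_{(α, i)}`. -/
def sigma : SuperPoly (tensorPar par n m) :=
  (1 / 2 : ℝ) • ∑ α : Fin r, ∑ β : Fin r, ∑ i : VIdx n m, ∑ j : VIdx n m,
    (sgn (par α * par β + vPar n m i * vPar n m j + vPar n m i * par β)
      * (sgn (par α) * F.form (e α) (F.d (e β))) * symplecticForm n m i j) •
      (coord (tensorPar par n m) (α, i) * coord (tensorPar par n m) (β, j))

end Subspace

end ContractibleDGFrobenius

/-! ### Gaussian superintegrals and the Wick rotation -/

section Integrals

/-- The value at `t = i` of the analytic continuation to `ℂ ∖ {0}` of a function of `t > 0`. -/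
def continuationAtI (g : ℝ → ℝ) : ℂ :=
  open Classical in
  if h : ∃ G : ℂ → ℂ, DifferentiableOn ℂ G {0}ᶜ ∧ ∀ t : ℝ, 0 < t → G t = g t then
    h.choose Complex.I
  else 0

/-- The integral `∫ f(y) exp(-½ ∑_k ε_k y_k²) dy` for `ε_k = ±1`, defined by the Wick rotation. -/
def wickIntegral {ι : Type} [Fintype ι] (ε : ι → ℝ) (f : MvPolynomial ι ℝ) : ℂ :=
  continuationAtI fun t : ℝ =>
    ∫ y : ι → ℝ, MvPolynomial.eval y f *
      Real.exp (-(1 / 2) * ∑ k, if ε k = 1 then y k ^ 2 else (t * y k) ^ 2)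

variable {K : Type} [Fintype K] [DecidableEq K] (par : K → ZMod 2)

/-- The linear substitution `y_k ↦ ∑_j T_{kj} y_j` of the even coordinates. -/
def evenSubst (T : Matrix (Ev par) (Ev par) ℝ) :
    MvPolynomial (Ev par) ℝ →ₐ[ℝ] MvPolynomial (Ev par) ℝ :=
  MvPolynomial.aeval fun k => ∑ j, MvPolynomial.C (T k j) * MvPolynomial.X j

/-- The Berezin integral over the odd coordinates (iterated right derivatives, in some order). -/
def berezin (f : SuperPoly par) : MvPolynomial (Ev par) ℝ :=
  body par ((Finset.univ : Finset (Od par)).toList.foldl (fun g k => rderiv par k.1 g) f)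

/-- The factor `e^{-(σ - body σ)}` of `e^{-σ}`, for an even function `σ`; the exponent is nilpotent
and the omitted terms of the exponential series are zero. -/
def expSoul (σ : SuperPoly par) : SuperPoly par :=
  ∑ k ∈ Finset.range (Fintype.card K + 1),
    (k.factorial : ℝ)⁻¹ • (body par σ ⊗ₜ[ℝ] (1 : ExteriorAlgebra ℝ (Od par →₀ ℝ)) - σ) ^ k

/-- `(T, ε)` diagonalises the even part of the quadratic function `σ`: `T` is an invertible linear
substitution taking the body of `σ` to `½ ∑_k ε_k y_k²` with `ε_k = ±1`. -/
def Diagonalises (σ : SuperPoly par) (T : Matrix (Ev par) (Ev par) ℝ) (ε : Ev par → ℝ) : Prop :=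
  IsUnit T.det ∧ (∀ k, ε k = 1 ∨ ε k = -1) ∧
    evenSubst par T (body par σ) =
      MvPolynomial.C (1 / 2) * ∑ k, MvPolynomial.C (ε k) * MvPolynomial.X k ^ 2

/-- The superintegral `∫ f e^{-σ}`, computed in the coordinates given by `(T, ε)`. -/
def gaussianIntegral (σ : SuperPoly par) (T : Matrix (Ev par) (Ev par) ℝ) (ε : Ev par → ℝ)
    (f : SuperPoly par) : ℂ :=
  ((|T.det| : ℝ) : ℂ) * wickIntegral ε (evenSubst par T (berezin par (f * expSoul par σ)))

end Integrals

namespace ContractibleDGFrobenius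

variable {A : Type*} [NonUnitalRing A] [Module ℝ A] [IsScalarTower ℝ A A] [SMulCommClass ℝ A A]

/-- Linear coordinates on `L ⊗ V` in which the integral over `L ⊗ V` is computed: a homogeneous
basis of `L` and a linear change of the resulting even coordinates that diagonalises `σ̃`. -/
structure Coordinates (F : ContractibleDGFrobenius A) (L : Submodule ℝ A) (n m : ℕ) where
  r : ℕ
  par : Fin r → ZMod 2
  basis : Module.Basis (Fin r) ℝ L
  basis_mem : ∀ α, (basis α : A) ∈ F.gr (par α)
  T : Matrix (Ev (tensorPar par n m)) (Ev (tensorPar par n m)) ℝ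
  ε : Ev (tensorPar par n m) → ℝ
  diagonalises : Diagonalises (tensorPar par n m)
    (F.sigma par (fun α => (basis α : A)) n m) T ε

namespace Coordinates

variable {F : ContractibleDGFrobenius A} {L : Submodule ℝ A} {n m : ℕ}
  (Θ : F.Coordinates L n m)

/-- The integral `∫_{L ⊗ V} f e^{-σ̃}`. -/
def integral (f : SuperPoly (tensorPar Θ.par n m)) : ℂ :=
  gaussianIntegral (tensorPar Θ.par n m)
    (F.sigma Θ.par (fun α => (Θ.basis α : A)) n m) Θ.T Θ.ε f

/-- The vacuum expectation value `⟨f⟩_0`. -/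
def expectation (f : SuperPoly (tensorPar Θ.par n m)) : ℂ := Θ.integral f / Θ.integral 1

/-- The number `S_A^L(h_1 ∧ ⋯ ∧ h_l) = (-1)^{p(h)} ⟨Ψ_A(h_1) ⋯ Ψ_A(h_l)⟩_0` for `h_i` of parity
`p_i`.  The Koszul sign arises from moving the `j`-th odd map `Ψ_A` past `h_1, …, h_{j-1}`. -/
def sValue {l : ℕ} (h : Fin l → GTilde n m) (p : Fin l → ZMod 2) : ℂ :=
  (sgn (∑ j : Fin l, ∑ i ∈ Finset.Iio j, p i) : ℂ) *
    Θ.expectation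
      (List.ofFn fun i => F.psi Θ.par (fun α => (Θ.basis α : A)) n m (h i : Ham n m)).prod

end Coordinates

/-- The linear functional `φ` on chains is `S_A^L`: its values on products of homogeneous
elements are given by the defining formula, in whatever linear coordinates this is computed. -/
def IsFunctionalS (F : ContractibleDGFrobenius A) (L : Submodule ℝ A) {n m : ℕ}
    (φ : Cochains n m) : Prop :=
  ∀ (Θ : F.Coordinates L n m) (l : ℕ) (h : Fin l → GTilde n m) (p : Fin l → ZMod 2),
    (∀ i, h i ∈ gTildeParity n m (p i)) → (φ (wedge (List.ofFn h)) : ℂ) = Θ.sValue h p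

end ContractibleDGFrobenius

end DualConstruction

end

/-!
The proof is the Batalin-Vilkovisky argument, carried out on the algebra `Fun` of polynomial
superfunctions on `A ⊗ V`.

A gauge `L` has a contracting homotopy `s` of `d` with image in `L`
(`IsGauge.exists_homotopy`). Wick's theorem computes the Gaussian superintegral over `L ⊗ V` from
the propagator `P = laplace 1 s`, a second order operator with constant coefficients: the normalised
integral of a function on `A ⊗ V` is the value at the origin of `exp P` applied to it
(`Coordinates.expectation_restrict`). Both sides satisfy the same recursion for moving a coordinate
out of the integrand, by integration by parts on one side and by the commutator of `P` with a
coordinate on the other. In particular the integral depends on `L` only through `s`, and the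
coordinates of `L ⊗ V` play no role any more. That the quadratic form is nondegenerate on `L ⊗ V`
(so that coordinates exist, by Sylvester's law, and the denominator is nonzero) also follows from
the existence of `s`: it expresses each coordinate through the derivatives of the form
(`SubspaceBasis.exists_coord_eq_sum_lderiv_sigma`).

On `Fun` there are two odd operators: the vector field `D = differential` induced by `d`, and the
odd Laplacian `Δ = oddLaplace` of the odd scalar product and `ω`. The products
`± Ψ(h_1) ⋯ Ψ(h_l)` define a map `chainMap` from the Chevalley-Eilenberg chains to `Fun`. Each
`Ψ(h)` is killed by both operators, and the bracket generated by `Δ` satisfies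
`{Ψ(g), Ψ(h)} = ± Ψ({g, h})`; hence `D` vanishes on the image of `chainMap`, and `Δ` corresponds to
the boundary of chains (`oddLaplace_chainMap`). The identity `d s + s d = 1` gives
`D P = P D + Δ`, so that the expectation of `(D + Δ) f` vanishes for every `f`: `S_A^L` is a
cocycle. Quadratic Hamiltonians act on `Fun` by linear vector fields commuting with `P`, so the
cocycle is relative.

For a second gauge with homotopy `s'` and propagator `P'`, the operator `R = laplace 0 (s s')`
satisfies `D R + R D = P' - P`. Everything commutes up to sign, so the difference of the two
expectations is `K ∘ (D + Δ)`, where `K` is the value at the origin of the divided difference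
`(exp P' - exp P) / (P' - P)` composed with `R` (`Lowers.expFunctional_sub`). Thus the two cocycles
differ by the coboundary of `K ∘ chainMap`.
-/

noncomputable section

namespace DualConstruction

/-! ### Signs -/

@[simp] theorem sgn_zero : sgn 0 = 1 := by simp [sgn]

@[simp] theorem sgn_one : sgn 1 = -1 := by simp [sgn]

theorem zmod_two_cases (p : ZMod 2) : p = 0 ∨ p = 1 := by
  revert p; decide

theorem eq_one_of_ne_zero {p : ZMod 2} (h : p ≠ 0) : p = 1 := (zmod_two_cases p).resolve_left h

theorem sgn_add (p q : ZMod 2) : sgn (p + q) = sgn p * sgn q := by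
  rcases zmod_two_cases p with rfl | rfl <;> rcases zmod_two_cases q with rfl | rfl <;>
    simp [show (1 + 1 : ZMod 2) = 0 from rfl]

@[simp] theorem sgn_mul_self (p : ZMod 2) : sgn p * sgn p = 1 := by
  rcases zmod_two_cases p with rfl | rfl <;> simp

theorem sgn_ne_zero (p : ZMod 2) : sgn p ≠ 0 := by
  rcases zmod_two_cases p with rfl | rfl <;> simp

theorem neg_sgn (p : ZMod 2) : -sgn p = sgn (p + 1) := by
  rw [sgn_add]; simp

section SuperPolyBasics

variable {K : Type} (par : K → ZMod 2)

/-! ### Supercommutativity and the universal property of superfunctions -/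

theorem superPoly_neg_one_smul (f : SuperPoly par) : (-1 : ℝ) • f = -f := neg_one_smul ℝ f

theorem coord_even {k : K} (h : par k = 0) :
    coord par k = MvPolynomial.X (⟨k, h⟩ : Ev par) ⊗ₜ[ℝ] 1 := by simp [coord, h]

theorem coord_odd {k : K} (h : par k ≠ 0) :
    coord par k = 1 ⊗ₜ[ℝ] ExteriorAlgebra.ι ℝ (Finsupp.single (⟨k, h⟩ : Od par) (1 : ℝ)) := by
  simp [coord, h]

theorem coord_mul_coord (j k : K) :
    coord par j * coord par k = sgn (par j * par k) • (coord par k * coord par j) := by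
  by_cases hj : par j = 0
  · rw [coord_even par hj]
    by_cases hk : par k = 0
    · rw [coord_even par hk]; simp [hj, mul_comm]
    · rw [coord_odd par hk]; simp [hj]
  · rw [coord_odd par hj]
    by_cases hk : par k = 0
    · rw [coord_even par hk]; simp [hk]
    · rw [coord_odd par hk]
      simp only [Algebra.TensorProduct.tmul_mul_tmul, one_mul]
      rw [eq_one_of_ne_zero hj, eq_one_of_ne_zero hk, mul_one, sgn_one, superPoly_neg_one_smul,
        ← TensorProduct.tmul_neg, eq_neg_of_add_eq_zero_left (ExteriorAlgebra.ι_add_mul_swap _ _)]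

section Lift

variable {B : Type*} [Semiring B] [Algebra ℝ B]

open scoped IsMulCommutative in
/-- The homomorphism from polynomials given by a family of commuting elements of an algebra that
need not be commutative. -/
def commutingAeval {σ : Type*} (b : σ → B) (h : ∀ j k, b j * b k = b k * b j) :
    MvPolynomial σ ℝ →ₐ[ℝ] B :=
  haveI : IsMulCommutative (Algebra.adjoin ℝ (Set.range b)) :=
    Algebra.isMulCommutative_adjoin ℝ (by rintro _ ⟨j, rfl⟩ _ ⟨k, rfl⟩; exact h j k)
  (Algebra.adjoin ℝ (Set.range b)).val.comp
    (MvPolynomial.aeval (S₁ := Algebra.adjoin ℝ (Set.range b)) (R := ℝ)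
      fun k => (⟨b k, Algebra.subset_adjoin ⟨k, rfl⟩⟩ : Algebra.adjoin ℝ (Set.range b)))

open scoped IsMulCommutative in
theorem commutingAeval_X {σ : Type*} (b : σ → B) (h : ∀ j k, b j * b k = b k * b j) (k : σ) :
    commutingAeval b h (MvPolynomial.X k) = b k := by
  simp [commutingAeval]

variable (b : K → B) (h : ∀ j k, b j * b k = sgn (par j * par k) • (b k * b j))

include h in
theorem odd_sq_zero (v : Od par →₀ ℝ) :
    Finsupp.linearCombination ℝ (fun k : Od par => b k.1) v *
      Finsupp.linearCombination ℝ (fun k : Od par => b k.1) v = 0 := by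
  set f := Finsupp.linearCombination ℝ (fun k : Od par => b k.1)
  have anti : ∀ u v : Od par →₀ ℝ, f u * f v = (-1 : ℝ) • (f v * f u) := by
    intro u v
    induction u using Finsupp.induction_linear with
    | zero => simp
    | add x y hx hy => rw [map_add, add_mul, mul_add, hx, hy, smul_add]
    | single j a =>
      induction v using Finsupp.induction_linear with
      | zero => simp
      | add x y hx hy => rw [map_add, add_mul, mul_add, hx, hy, smul_add]
      | single k c =>
        simp only [f, Finsupp.linearCombination_single, smul_mul_smul_comm]
        rw [h, eq_one_of_ne_zero j.2, eq_one_of_ne_zero k.2, mul_one, sgn_one, smul_smul,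
          smul_smul]
        congr 1
        ring
  calc f v * f v = (1 / 2 : ℝ) • (f v * f v) + (1 / 2 : ℝ) • (f v * f v) := by
        rw [← add_smul]; norm_num
    _ = (1 / 2 : ℝ) • (f v * f v) + (1 / 2 : ℝ) • (-1 : ℝ) • (f v * f v) := by
        congr 2; exact anti v v
    _ = 0 := by rw [smul_smul, ← add_smul]; norm_num

/-- The universal property of the free supercommutative algebra: a family of supercommuting
elements of an algebra extends to a homomorphism of algebras. -/
def lift : SuperPoly par →ₐ[ℝ] B :=
  Algebra.TensorProduct.lift
    (commutingAeval (fun k : Ev par => b k.1) fun j k => by rw [h]; simp [j.2])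
    (ExteriorAlgebra.lift ℝ ⟨Finsupp.linearCombination ℝ (fun k : Od par => b k.1),
      odd_sq_zero par b h⟩)
    (by
      intro x y
      induction x using MvPolynomial.induction_on with
      | C a =>
        rw [← MvPolynomial.algebraMap_eq, AlgHom.commutes]
        exact Algebra.commute_algebraMap_left _ _
      | add p q hp hq => rw [map_add]; exact hp.add_left hq
      | mul_X p k hp =>
        rw [map_mul, commutingAeval_X]
        refine hp.mul_left ?_
        clear hp
        induction y using ExteriorAlgebra.induction with
        | algebraMap r => rw [AlgHom.commutes]; exact Algebra.commute_algebraMap_right _ _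
        | add p q hp hq => rw [map_add]; exact hp.add_right hq
        | mul p q hp hq => rw [map_mul]; exact hp.mul_right hq
        | ι v =>
          rw [ExteriorAlgebra.lift_ι_apply]
          induction v using Finsupp.induction_linear with
          | zero => simp
          | add u v hu hv => rw [map_add]; exact hu.add_right hv
          | single j a =>
            rw [Finsupp.linearCombination_single]
            refine Commute.smul_right ?_ a
            rw [Commute, SemiconjBy, h]
            simp [k.2])

@[simp] theorem lift_coord (k : K) : lift par b h (coord par k) = b k := by
  by_cases hk : par k = 0
  · rw [coord_even par hk]; simp [lift, commutingAeval_X]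
  · rw [coord_odd par hk]; simp [lift]

end Lift

/-! ### Words in the coordinates -/

@[simp] theorem monomial_nil : monomial par [] = 1 := by simp [monomial]

theorem span_monomial : Submodule.span ℝ (Set.range (monomial par)) = ⊤ := by
  set S := Submodule.span ℝ (Set.range (monomial par))
  have hmem : ∀ w, monomial par w ∈ S := fun w => Submodule.subset_span ⟨w, rfl⟩
  have hmul : ∀ f ∈ S, ∀ g ∈ S, f * g ∈ S := by
    intro f hf g hg
    have h : f * g ∈ S * S := Submodule.mul_mem_mul hf hg
    rw [Submodule.span_mul_span] at h
    refine Submodule.span_mono ?_ h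
    rintro _ ⟨_, ⟨v, rfl⟩, _, ⟨w, rfl⟩, rfl⟩
    exact ⟨v ++ w, monomial_append par v w⟩
  have hcoord : ∀ k, coord par k ∈ S := fun k => by simpa [monomial] using hmem [k]
  have hone : (1 : SuperPoly par) ∈ S := by simpa using hmem []
  have hone' : (1 : MvPolynomial (Ev par) ℝ) ⊗ₜ[ℝ] (1 : ExteriorAlgebra ℝ (Od par →₀ ℝ)) ∈ S :=
    hone
  have hev : ∀ p : MvPolynomial (Ev par) ℝ, (p ⊗ₜ[ℝ] 1 : SuperPoly par) ∈ S := by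
    intro p
    induction p using MvPolynomial.induction_on with
    | C a =>
      rw [← mul_one (MvPolynomial.C a), ← MvPolynomial.smul_eq_C_mul, ← TensorProduct.smul_tmul']
      exact S.smul_mem a hone'
    | add p q hp hq => rw [TensorProduct.add_tmul]; exact S.add_mem hp hq
    | mul_X p k hp =>
      have := hmul _ hp _ (hcoord k.1)
      rwa [coord_even par k.2, Algebra.TensorProduct.tmul_mul_tmul, mul_one] at this
  have hod : ∀ x : ExteriorAlgebra ℝ (Od par →₀ ℝ), (1 ⊗ₜ[ℝ] x : SuperPoly par) ∈ S := by
    intro x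
    induction x using ExteriorAlgebra.induction with
    | algebraMap r =>
      rw [Algebra.algebraMap_eq_smul_one, TensorProduct.tmul_smul]
      exact S.smul_mem r hone'
    | add p q hp hq => rw [TensorProduct.tmul_add]; exact S.add_mem hp hq
    | mul p q hp hq =>
      have := hmul _ hp _ hq
      rwa [Algebra.TensorProduct.tmul_mul_tmul, mul_one] at this
    | ι v =>
      induction v using Finsupp.induction_linear with
      | zero => simp
      | add u v hu hv => rw [map_add, TensorProduct.tmul_add]; exact S.add_mem hu hv
      | single j a =>
        have := S.smul_mem a (hcoord j.1)
        rwa [coord_odd par j.2, ← TensorProduct.tmul_smul, ← map_smul, Finsupp.smul_single,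
          smul_eq_mul, mul_one] at this
  refine eq_top_iff.2 fun f _ => ?_
  induction f using TensorProduct.induction_on with
  | zero => exact S.zero_mem
  | add x y hx hy => exact S.add_mem (hx trivial) (hy trivial)
  | tmul p x =>
    have := hmul _ (hev p) _ (hod x)
    rwa [Algebra.TensorProduct.tmul_mul_tmul, mul_one, one_mul] at this

variable {par} in
/-- A property of superfunctions closed under linear combinations may be checked on words. -/
theorem superPoly_induction {P : SuperPoly par → Prop} (f : SuperPoly par) (zero : P 0)
    (add : ∀ f g, P f → P g → P (f + g)) (smul : ∀ (a : ℝ) f, P f → P (a • f))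
    (word : ∀ w, P (monomial par w)) : P f := by
  have hf : f ∈ Submodule.span ℝ (Set.range (monomial par)) := by
    rw [span_monomial]; trivial
  induction hf using Submodule.span_induction with
  | mem x hx => obtain ⟨w, rfl⟩ := hx; exact word w
  | zero => exact zero
  | add x y _ _ hx hy => exact add x y hx hy
  | smul a x _ hx => exact smul a x hx

variable {par} in
theorem linearMap_ext_monomial {N : Type*} [AddCommMonoid N] [Module ℝ N]
    {f g : SuperPoly par →ₗ[ℝ] N} (h : ∀ w, f (monomial par w) = g (monomial par w)) : f = g := by
  refine LinearMap.ext fun x => ?_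
  induction x using superPoly_induction with
  | zero => simp
  | add x y hx hy => simp [hx, hy]
  | smul a x hx => simp [hx]
  | word w => exact h w

theorem lift_monomial {B : Type*} [Ring B] [Algebra ℝ B] (b : K → B)
    (h : ∀ j k, b j * b k = sgn (par j * par k) • (b k * b j)) (w : List K) :
    lift par b h (monomial par w) = (w.map b).prod := by
  simp [monomial, map_list_prod, Function.comp_def]

/-! ### Parities -/

theorem monomial_mem_parityPart (w : List K) : monomial par w ∈ parityPart par (w.map par).sum :=
  Submodule.subset_span ⟨w, rfl, rfl⟩

theorem coord_mem_parityPart (k : K) : coord par k ∈ parityPart par (par k) := by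
  simpa [monomial] using monomial_mem_parityPart par [k]

theorem one_mem_parityPart : (1 : SuperPoly par) ∈ parityPart par 0 := by
  simpa using monomial_mem_parityPart par []

variable {par}

theorem parityPart_induction {p : ZMod 2} {P : ∀ f, f ∈ parityPart par p → Prop}
    (zero : P 0 (Submodule.zero_mem _))
    (add : ∀ f g hf hg, P f hf → P g hg → P (f + g) (Submodule.add_mem _ hf hg))
    (smul : ∀ (a : ℝ) f hf, P f hf → P (a • f) (Submodule.smul_mem _ a hf))
    (word : ∀ w (hw : (w.map par).sum = p), P (monomial par w)
      (Submodule.subset_span ⟨w, hw, rfl⟩))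
    {f : SuperPoly par} (hf : f ∈ parityPart par p) : P f hf := by
  induction hf using Submodule.span_induction with
  | mem x hx => obtain ⟨w, hw, rfl⟩ := hx; exact word w hw
  | zero => exact zero
  | add x y hx' hy' hx hy => exact add x y hx' hy' hx hy
  | smul a x hx' hx => exact smul a x hx' hx

theorem mul_mem_parityPart {p q : ZMod 2} {f g : SuperPoly par} (hf : f ∈ parityPart par p)
    (hg : g ∈ parityPart par q) : f * g ∈ parityPart par (p + q) := by
  have h : f * g ∈ parityPart par p * parityPart par q := Submodule.mul_mem_mul hf hg
  rw [parityPart, parityPart, Submodule.span_mul_span] at h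
  refine Submodule.span_mono ?_ h
  rintro _ ⟨_, ⟨v, hv, rfl⟩, _, ⟨w, hw, rfl⟩, rfl⟩
  exact ⟨v ++ w, by simp [hv, hw], (monomial_append par v w).symm⟩

theorem coord_mul_of_mem (k : K) {p : ZMod 2} {f : SuperPoly par} (hf : f ∈ parityPart par p) :
    coord par k * f = sgn (par k * p) • (f * coord par k) := by
  induction hf using parityPart_induction with
  | zero => simp
  | add f g _ _ hf hg => rw [mul_add, add_mul, hf, hg, smul_add]
  | smul a f _ hf => rw [mul_smul_comm, hf, smul_mul_assoc, smul_comm]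
  | word w hw =>
    induction w generalizing p with
    | nil => simp at hw; simp [← hw]
    | cons j w ih =>
      rw [List.map_cons, List.sum_cons] at hw
      rw [monomial_cons, ← mul_assoc, coord_mul_coord, smul_mul_assoc, mul_assoc, ih rfl,
        mul_smul_comm, smul_smul, ← sgn_add, ← mul_add, hw, mul_assoc]

theorem mul_comm_of_mem {p q : ZMod 2} {f g : SuperPoly par} (hf : f ∈ parityPart par p)
    (hg : g ∈ parityPart par q) : f * g = sgn (p * q) • (g * f) := by
  induction hf using parityPart_induction with
  | zero => simp
  | add f g _ _ hf hg => rw [mul_add, add_mul, hf, hg, smul_add]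
  | smul a f _ hf => rw [mul_smul_comm, smul_mul_assoc, hf, smul_comm]
  | word w hw =>
    induction w generalizing p with
    | nil => simp at hw; simp [← hw]
    | cons j w ih =>
      rw [List.map_cons, List.sum_cons] at hw
      rw [monomial_cons, mul_assoc, ih rfl, mul_smul_comm, ← mul_assoc, coord_mul_of_mem j hg,
        smul_mul_assoc, smul_smul, ← sgn_add, ← hw, mul_assoc]
      congr 2; ring

variable (par)

/-- The parity involution of the algebra of superfunctions. -/
def parityInvolution : SuperPoly par →ₐ[ℝ] SuperPoly par :=
  lift par (fun k => sgn (par k) • coord par k) fun j k => by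
    rw [smul_mul_smul_comm, coord_mul_coord, smul_mul_smul_comm, smul_comm, mul_comm (sgn _)]

variable {par} in
theorem parityInvolution_of_mem {p : ZMod 2} {f : SuperPoly par} (hf : f ∈ parityPart par p) :
    parityInvolution par f = sgn p • f := by
  induction hf using parityPart_induction with
  | zero => simp
  | add f g _ _ hf hg => rw [map_add, hf, hg, smul_add]
  | smul a f _ hf => rw [map_smul, hf, smul_comm]
  | word w hw =>
    rw [parityInvolution, lift_monomial, ← hw]
    clear hw
    induction w with
    | nil => simp
    | cons k w ih =>
      rw [List.map_cons, List.prod_cons, ih, smul_mul_smul_comm, monomial_cons, List.map_cons,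
        List.sum_cons, sgn_add]

/-! ### Partial derivatives -/

theorem lderiv_coord_mul_eq [DecidableEq K] (k j : K) (f : SuperPoly par) :
    lderiv par k (coord par j * f) =
      (if k = j then f else 0) + sgn (par k * par j) • (coord par j * lderiv par k f) := by
  by_cases hk : par k = 0 <;> by_cases hj : par j = 0
  · induction f using TensorProduct.induction_on with
    | zero => simp
    | add x y hx hy => rw [mul_add, map_add, hx, hy, map_add, mul_add]; split_ifs <;> module
    | tmul x y =>
      by_cases h : k = j
      · subst h
        simp [lderiv, coord, hk, TensorProduct.add_tmul, mul_comm]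
      · simp [lderiv, coord, hk, hj, h, Ne.symm h]
  · have h : k ≠ j := by rintro rfl; exact hj hk
    induction f using TensorProduct.induction_on with
    | zero => simp
    | add x y hx hy => rw [mul_add, map_add, hx, hy, map_add, mul_add]; split_ifs <;> module
    | tmul x y => simp [lderiv, coord, hk, hj, h]
  · have h : k ≠ j := by rintro rfl; exact hk hj
    induction f using TensorProduct.induction_on with
    | zero => simp
    | add x y hx hy => rw [mul_add, map_add, hx, hy, map_add, mul_add]; split_ifs <;> module
    | tmul x y => simp [lderiv, coord, hk, hj, h]
  · induction f using TensorProduct.induction_on with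
    | zero => simp
    | add x y hx hy => rw [mul_add, map_add, hx, hy, map_add, mul_add]; split_ifs <;> module
    | tmul x y =>
      have h1 := CliffordAlgebra.contractLeft_ι_mul (Q := (0 : QuadraticForm ℝ (Od par →₀ ℝ)))
        (d := Finsupp.lapply (⟨k, hk⟩ : Od par)) (Finsupp.single ⟨j, hj⟩ 1) y
      rw [eq_one_of_ne_zero hk, eq_one_of_ne_zero hj]
      by_cases h : k = j
      · subst h
        simp [lderiv, coord, hk, ExteriorAlgebra.ι, h1, sub_eq_add_neg, TensorProduct.tmul_add,
          TensorProduct.tmul_neg, superPoly_neg_one_smul]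
      · have h' : ¬ j = k := fun e => h e.symm
        simp [lderiv, coord, hk, hj, h, ExteriorAlgebra.ι, h1, TensorProduct.tmul_neg,
          superPoly_neg_one_smul]

theorem rderiv_mul_coord_odd [DecidableEq K] {k : K} (hk : par k ≠ 0) (j : K)
    (f : SuperPoly par) : rderiv par k (f * coord par j) =
      (if k = j then f else 0) + sgn (par k * par j) • (rderiv par k f * coord par j) := by
  by_cases hj : par j = 0
  · have h : k ≠ j := by rintro rfl; exact hk hj
    induction f using TensorProduct.induction_on with
    | zero => simp
    | add x y hx hy => rw [add_mul, map_add, hx, hy, map_add, add_mul]; split_ifs <;> module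
    | tmul x y => simp [rderiv, coord, hk, hj, h]
  · induction f using TensorProduct.induction_on with
    | zero => simp
    | add x y hx hy => rw [add_mul, map_add, hx, hy, map_add, add_mul]; split_ifs <;> module
    | tmul x y =>
      have h1 := CliffordAlgebra.contractRight_mul_ι (Q := (0 : QuadraticForm ℝ (Od par →₀ ℝ)))
        (d := Finsupp.lapply (⟨k, hk⟩ : Od par)) (Finsupp.single ⟨j, hj⟩ 1) y
      rw [eq_one_of_ne_zero hk, eq_one_of_ne_zero hj]
      by_cases h : k = j
      · subst h
        simp [rderiv, coord, hk, ExteriorAlgebra.ι, h1, sub_eq_add_neg, TensorProduct.tmul_add,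
          TensorProduct.tmul_neg, superPoly_neg_one_smul]
      · have h' : ¬ j = k := fun e => h e.symm
        simp [rderiv, coord, hk, hj, h, ExteriorAlgebra.ι, h1, TensorProduct.tmul_neg,
          superPoly_neg_one_smul]

@[simp] theorem lderiv_one (k : K) : lderiv par k 1 = 0 := by
  by_cases hk : par k = 0 <;> simp [lderiv, hk, Algebra.TensorProduct.one_def]

@[simp] theorem rderiv_one (k : K) : rderiv par k 1 = 0 := by
  by_cases hk : par k = 0 <;> simp [rderiv, hk, Algebra.TensorProduct.one_def]

theorem lderiv_coord [DecidableEq K] (k j : K) :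
    lderiv par k (coord par j) = if k = j then 1 else 0 := by
  simpa using lderiv_coord_mul_eq par k j 1

theorem lderiv_lderiv (j k : K) (f : SuperPoly par) :
    lderiv par j (lderiv par k f) = sgn (par j * par k) • lderiv par k (lderiv par j f) := by
  classical
  have : lderiv par j ∘ₗ lderiv par k = sgn (par j * par k) • (lderiv par k ∘ₗ lderiv par j) := by
    refine linearMap_ext_monomial fun w => ?_
    simp only [LinearMap.comp_apply, LinearMap.smul_apply]
    induction w with
    | nil => simp
    | cons i w ih =>
      simp only [monomial_cons, lderiv_coord_mul_eq, map_add, map_smul, apply_ite, map_zero, ih]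
      simp only [smul_add, smul_smul, mul_smul_comm, smul_ite, smul_zero]
      rcases zmod_two_cases (par j) with ej | ej <;> rcases zmod_two_cases (par k) with ek | ek <;>
      rcases zmod_two_cases (par i) with ei | ei <;>
      by_cases hj : j = i <;> by_cases hk : k = i <;>
      first
        | (subst hj; simp [ej] at ei; done)
        | (subst hk; simp [ek] at ei; done)
        | simp [ej, ek, ei, hj, hk]
  exact LinearMap.congr_fun this f

variable {par}

/-- The super Leibniz rule. -/
theorem lderiv_mul (k : K) {p : ZMod 2} {f : SuperPoly par} (hf : f ∈ parityPart par p)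
    (g : SuperPoly par) :
    lderiv par k (f * g) = lderiv par k f * g + sgn (par k * p) • (f * lderiv par k g) := by
  classical
  induction hf using parityPart_induction with
  | zero => simp
  | add f f' _ _ hf hf' => simp only [add_mul, map_add, hf, hf']; module
  | smul a f _ hf => simp only [smul_mul_assoc, map_smul, hf]; module
  | word w hw =>
    induction w generalizing p with
    | nil => simp at hw; simp [← hw]
    | cons j w ih =>
      rw [List.map_cons, List.sum_cons] at hw
      rw [monomial_cons, mul_assoc, lderiv_coord_mul_eq, ih rfl, lderiv_coord_mul_eq, ← hw,
        mul_add (par k), sgn_add]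
      simp only [mul_add, add_mul, smul_mul_assoc, mul_smul_comm, ite_mul, zero_mul, smul_add,
        mul_assoc, smul_smul]
      abel

theorem lderiv_mem_parityPart (k : K) {p : ZMod 2} {f : SuperPoly par}
    (hf : f ∈ parityPart par p) : lderiv par k f ∈ parityPart par (par k + p) := by
  classical
  induction hf using parityPart_induction with
  | zero => simp
  | add f g _ _ hf hg => rw [map_add]; exact Submodule.add_mem _ hf hg
  | smul a f _ hf => rw [map_smul]; exact Submodule.smul_mem _ _ hf
  | word w hw =>
    induction w generalizing p with
    | nil => simp
    | cons j w ih =>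
      rw [List.map_cons, List.sum_cons] at hw
      rw [monomial_cons, lderiv_coord_mul_eq]
      refine Submodule.add_mem _ ?_ (Submodule.smul_mem _ _ ?_)
      · split_ifs with h
        · subst h
          have := monomial_mem_parityPart par w
          rwa [← hw, ← add_assoc, CharTwo.add_self_eq_zero, zero_add]
        · exact Submodule.zero_mem _
      · have := mul_mem_parityPart (coord_mem_parityPart par j) (ih rfl)
        rwa [← hw, add_left_comm]

theorem rderiv_of_mem {k : K} (hk : par k ≠ 0) {p : ZMod 2} {f : SuperPoly par}
    (hf : f ∈ parityPart par p) : rderiv par k f = -sgn p • lderiv par k f := by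
  classical
  induction hf using parityPart_induction with
  | zero => simp
  | add f g _ _ hf hg => simp only [map_add, hf, hg, smul_add]
  | smul a f _ hf => rw [map_smul, map_smul, hf, smul_comm]
  | word w hw =>
    induction w using List.reverseRecOn generalizing p with
    | nil => simp
    | append_singleton w j ih =>
      rw [List.map_append, List.sum_append] at hw
      rw [monomial_append, show monomial par [j] = coord par j by simp [monomial],
        rderiv_mul_coord_odd par hk, ih rfl, lderiv_mul k (monomial_mem_parityPart par w),
        lderiv_coord, ← hw, eq_one_of_ne_zero hk, one_mul, one_mul]
      simp only [smul_mul_assoc]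
      rcases zmod_two_cases (w.map par).sum with e | e <;>
      rcases zmod_two_cases (par j) with e' | e' <;>
      by_cases h : k = j <;>
      first
        | (subst h; exact absurd e' hk)
        | (simp [e, e', h, show (1 + 1 : ZMod 2) = 0 from rfl, superPoly_neg_one_smul]; done)
        | (simp [e, e', h, show (1 + 1 : ZMod 2) = 0 from rfl, superPoly_neg_one_smul]; module)

end SuperPolyBasics

section Taylor

variable {K : Type} (par : K → ZMod 2)

/-! ### Values at the origin, degrees and Taylor's formula -/

/-- The restriction to the body as a homomorphism of algebras. -/
def bodyHom : SuperPoly par →ₐ[ℝ] MvPolynomial (Ev par) ℝ :=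
  (Algebra.TensorProduct.rid ℝ ℝ (MvPolynomial (Ev par) ℝ)).toAlgHom.comp
    (Algebra.TensorProduct.map (AlgHom.id ℝ _) ExteriorAlgebra.algebraMapInv)

theorem body_eq_bodyHom (f : SuperPoly par) : body par f = bodyHom par f := by
  induction f using TensorProduct.induction_on with
  | zero => simp
  | add x y hx hy => simp [hx, hy]
  | tmul x y => simp [body, bodyHom]

theorem body_mul (f g : SuperPoly par) : body par (f * g) = body par f * body par g := by
  simp [body_eq_bodyHom]

@[simp] theorem body_one : body par 1 = 1 := by simp [body_eq_bodyHom]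

theorem body_coord_even {k : K} (hk : par k = 0) :
    body par (coord par k) = MvPolynomial.X ⟨k, hk⟩ := by
  rw [coord_even par hk]; simp [body]

theorem body_coord_odd {k : K} (hk : par k ≠ 0) : body par (coord par k) = 0 := by
  rw [coord_odd par hk]; simp [body, ExteriorAlgebra.algebraMapInv]

/-- The value of a superfunction at the origin. -/
def evalZero : SuperPoly par →ₗ[ℝ] ℝ where
  toFun f := MvPolynomial.constantCoeff (body par f)
  map_add' f g := by simp
  map_smul' a f := by simp

theorem taylorCoeff_eq (w : List K) (f : SuperPoly par) :
    taylorCoeff par w f = evalZero par (wordDeriv par w f) := rfl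

@[simp] theorem evalZero_one : evalZero par 1 = 1 := by simp [evalZero]

@[simp] theorem evalZero_coord_mul (k : K) (f : SuperPoly par) :
    evalZero par (coord par k * f) = 0 := by
  by_cases hk : par k = 0
  · simp [evalZero, body_mul, body_coord_even par hk]
  · simp [evalZero, body_mul, body_coord_odd par hk]

variable {par}

theorem degreePart_induction {N : ℕ} {P : ∀ f, f ∈ degreePart par N → Prop}
    (zero : P 0 (Submodule.zero_mem _))
    (add : ∀ f g hf hg, P f hf → P g hg → P (f + g) (Submodule.add_mem _ hf hg))
    (smul : ∀ (a : ℝ) f hf, P f hf → P (a • f) (Submodule.smul_mem _ a hf))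
    (word : ∀ w (hw : w.length = N), P (monomial par w) (Submodule.subset_span ⟨w, hw, rfl⟩))
    {f : SuperPoly par} (hf : f ∈ degreePart par N) : P f hf := by
  induction hf using Submodule.span_induction with
  | mem x hx => obtain ⟨w, hw, rfl⟩ := hx; exact word w hw
  | zero => exact zero
  | add x y hx' hy' hx hy => exact add x y hx' hy' hx hy
  | smul a x hx' hx => exact smul a x hx' hx

theorem monomial_mem_degreePart (w : List K) : monomial par w ∈ degreePart par w.length :=
  Submodule.subset_span ⟨w, rfl, rfl⟩

theorem coord_mul_mem_degreePart (k : K) {N : ℕ} {f : SuperPoly par}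
    (hf : f ∈ degreePart par N) : coord par k * f ∈ degreePart par (N + 1) := by
  induction hf using degreePart_induction with
  | zero => simp
  | add f g _ _ hf hg => rw [mul_add]; exact Submodule.add_mem _ hf hg
  | smul a f _ hf => rw [mul_smul_comm]; exact Submodule.smul_mem _ _ hf
  | word w hw => exact Submodule.subset_span ⟨k :: w, by simp [hw], (monomial_cons par k w).symm⟩

theorem lderiv_eq_zero_of_mem_degreePart_zero (k : K) {f : SuperPoly par}
    (hf : f ∈ degreePart par 0) : lderiv par k f = 0 := by
  induction hf using degreePart_induction with
  | zero => simp
  | add f g _ _ hf hg => rw [map_add, hf, hg, add_zero]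
  | smul a f _ hf => rw [map_smul, hf, smul_zero]
  | word w hw => rw [List.length_eq_zero_iff.1 hw]; simp

theorem lderiv_mem_degreePart (k : K) {N : ℕ} {f : SuperPoly par}
    (hf : f ∈ degreePart par (N + 1)) : lderiv par k f ∈ degreePart par N := by
  classical
  induction hf using degreePart_induction with
  | zero => simp
  | add f g _ _ hf hg => rw [map_add]; exact Submodule.add_mem _ hf hg
  | smul a f _ hf => rw [map_smul]; exact Submodule.smul_mem _ _ hf
  | word w hw =>
    induction w generalizing N with
    | nil => simp
    | cons j w ih =>
      simp only [List.length_cons, add_left_inj] at hw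
      rw [monomial_cons, lderiv_coord_mul_eq]
      refine Submodule.add_mem _ ?_ (Submodule.smul_mem _ _ ?_)
      · split_ifs
        · exact hw ▸ monomial_mem_degreePart w
        · exact Submodule.zero_mem _
      · cases N with
        | zero => rw [List.length_eq_zero_iff.1 hw]; simp
        | succ N => exact coord_mul_mem_degreePart j (ih hw)

theorem evalZero_eq_zero_of_mem_degreePart {N : ℕ} (hN : N ≠ 0) {f : SuperPoly par}
    (hf : f ∈ degreePart par N) : evalZero par f = 0 := by
  induction hf using degreePart_induction with
  | zero => simp
  | add f g _ _ hf hg => rw [map_add, hf, hg, add_zero]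
  | smul a f _ hf => rw [map_smul, hf, smul_zero]
  | word w hw =>
    cases w with
    | nil => exact absurd hw.symm hN
    | cons k w => rw [monomial_cons, evalZero_coord_mul]

theorem wordDeriv_eq_zero {N : ℕ} {f : SuperPoly par} (hf : f ∈ degreePart par N) {w : List K}
    (hw : N < w.length) : wordDeriv par w f = 0 := by
  induction w generalizing N f with
  | nil => simp at hw
  | cons k w ih =>
    rw [wordDeriv, LinearMap.comp_apply]
    cases N with
    | zero => rw [lderiv_eq_zero_of_mem_degreePart_zero k hf, map_zero]
    | succ N => exact ih (lderiv_mem_degreePart k hf) (by simpa using hw)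

/-- Every superfunction is killed by all words in the partial derivatives that are long enough. -/
theorem exists_wordDeriv_eq_zero (f : SuperPoly par) :
    ∃ N : ℕ, ∀ w : List K, N ≤ w.length → wordDeriv par w f = 0 := by
  induction f using superPoly_induction with
  | zero => exact ⟨0, by simp⟩
  | add f g hf hg =>
    obtain ⟨M, hM⟩ := hf
    obtain ⟨N, hN⟩ := hg
    exact ⟨max M N, fun w hw => by
      rw [map_add, hM w (le_trans (le_max_left _ _) hw), hN w (le_trans (le_max_right _ _) hw),
        add_zero]⟩
  | smul a f hf =>
    obtain ⟨M, hM⟩ := hf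
    exact ⟨M, fun w hw => by rw [map_smul, hM w hw, smul_zero]⟩
  | word u =>
    exact ⟨u.length + 1, fun w hw => wordDeriv_eq_zero (monomial_mem_degreePart u) hw⟩

theorem taylorCoeff_eq_zero {N : ℕ} {f : SuperPoly par} (hf : f ∈ degreePart par N) {w : List K}
    (hw : w.length ≠ N) : taylorCoeff par w f = 0 := by
  rw [taylorCoeff_eq]
  induction w generalizing N f with
  | nil => exact evalZero_eq_zero_of_mem_degreePart (by simpa using hw.symm) hf
  | cons k w ih =>
    rw [wordDeriv, LinearMap.comp_apply]
    cases N with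
    | zero => rw [lderiv_eq_zero_of_mem_degreePart_zero k hf, map_zero, map_zero]
    | succ N => exact ih (lderiv_mem_degreePart k hf) (by simpa using hw)

variable [Fintype K]

/-- Euler's formula for homogeneous superfunctions. -/
theorem euler_formula {N : ℕ} {f : SuperPoly par} (hf : f ∈ degreePart par N) :
    ∑ k, coord par k * lderiv par k f = (N : ℝ) • f := by
  classical
  induction hf using degreePart_induction with
  | zero => simp
  | add f g _ _ hf hg => simp only [map_add, mul_add, Finset.sum_add_distrib, hf, hg, smul_add]
  | smul a f _ hf =>
    simp only [map_smul, mul_smul_comm, ← Finset.smul_sum, hf]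
    rw [smul_comm]
  | word w hw =>
    induction w generalizing N with
    | nil => simp at hw; simp [← hw]
    | cons j w ih =>
      rw [← hw, monomial_cons, List.length_cons]
      have h : ∀ k, coord par k * lderiv par k (coord par j * monomial par w) =
          (if k = j then coord par k * monomial par w else 0) +
            coord par j * (coord par k * lderiv par k (monomial par w)) := by
        intro k
        rw [lderiv_coord_mul_eq, mul_add, mul_smul_comm, mul_ite, mul_zero,
          ← mul_assoc (coord par k),
          coord_mul_coord par k j, smul_mul_assoc, smul_smul, sgn_mul_self, one_smul, mul_assoc]
      rw [Finset.sum_congr rfl fun k _ => h k, Finset.sum_add_distrib, ← Finset.mul_sum, ih rfl,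
        Finset.sum_ite_eq' Finset.univ j, if_pos (Finset.mem_univ _), mul_smul_comm]
      push_cast
      module

/-- Taylor's formula for homogeneous superfunctions. -/
theorem taylor_formula {N : ℕ} {f : SuperPoly par} (hf : f ∈ degreePart par N) :
    ∑ w : Fin N → K, taylorCoeff par (List.ofFn w) f • monomial par (List.ofFn w) =
      (N.factorial : ℝ) • f := by
  induction N generalizing f with
  | zero =>
    simp only [taylorCoeff_eq]
    induction hf using degreePart_induction with
    | zero => simp
    | add f g _ _ hf hg =>
      simp only [map_add, add_smul, Finset.sum_add_distrib, hf, hg, smul_add]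
    | smul a f _ hf =>
      simp only [map_smul, smul_assoc, ← Finset.smul_sum, hf]
      rw [smul_comm]
    | word w hw => rw [List.length_eq_zero_iff.1 hw]; simp [wordDeriv]
  | succ N ih =>
    rw [← (Fin.consEquiv fun _ : Fin (N + 1) => K).sum_comp, Fintype.sum_prod_type]
    have h : ∀ k, ∑ w : Fin N → K,
        taylorCoeff par (List.ofFn ((Fin.consEquiv fun _ : Fin (N + 1) => K) (k, w))) f •
          monomial par (List.ofFn ((Fin.consEquiv fun _ : Fin (N + 1) => K) (k, w))) =
        coord par k * ((N.factorial : ℝ) • lderiv par k f) := by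
      intro k
      rw [← ih (lderiv_mem_degreePart k hf), Finset.mul_sum]
      refine Finset.sum_congr rfl fun w _ => ?_
      simp only [Fin.consEquiv_apply, List.ofFn_succ, Fin.cons_zero, Fin.cons_succ, monomial_cons,
        mul_smul_comm]
      rfl
    rw [Finset.sum_congr rfl fun k _ => h k]
    simp only [mul_smul_comm, ← Finset.smul_sum]
    rw [euler_formula hf, smul_smul, Nat.factorial_succ]
    push_cast
    rw [mul_comm]

end Taylor


section Wick

open MeasureTheory

/-! ### Gaussian moments and the Wick rotation -/

/-- The moments of the Gaussian weight `exp (-y ^ 2 / 2)`. -/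
def gaussMoment (n : ℕ) : ℝ := ∫ y : ℝ, y ^ n * Real.exp (-(1 / 2) * y ^ 2)

theorem integrable_pow_mul_gauss (n : ℕ) :
    Integrable fun y : ℝ => y ^ n * Real.exp (-(1 / 2) * y ^ 2) := by
  have h := integrable_rpow_mul_exp_neg_mul_sq (b := 1 / 2) (by norm_num) (s := n)
    (lt_of_lt_of_le (by norm_num) (Nat.cast_nonneg n))
  simpa only [Real.rpow_natCast] using h

theorem gaussMoment_succ (n : ℕ) : gaussMoment (n + 1) = n * gaussMoment (n - 1) := by
  have hd : ∀ y : ℝ, HasDerivAt (fun y : ℝ => y ^ n * Real.exp (-(1 / 2) * y ^ 2))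
      (n * (y ^ (n - 1) * Real.exp (-(1 / 2) * y ^ 2)) -
        y ^ (n + 1) * Real.exp (-(1 / 2) * y ^ 2)) y := by
    intro y
    have h1 : HasDerivAt (fun y : ℝ => -(1 / 2) * y ^ 2) (-y) y := by
      refine ((hasDerivAt_pow 2 y).const_mul (-(1 / 2) : ℝ)).congr_deriv ?_
      simp
    refine ((hasDerivAt_pow n y).mul h1.exp).congr_deriv ?_
    ring
  have h1 := (integrable_pow_mul_gauss (n - 1)).const_mul (n : ℝ)
  have h2 := integrable_pow_mul_gauss (n + 1)
  have h := integral_eq_zero_of_hasDerivAt_of_integrable hd (h1.sub h2)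
    (integrable_pow_mul_gauss n)
  rw [integral_sub h1 h2, integral_const_mul] at h
  exact (sub_eq_zero.1 h).symm

theorem gaussMoment_zero_ne : gaussMoment 0 ≠ 0 := by
  have h : gaussMoment 0 = √(Real.pi / (1 / 2)) := by
    rw [← integral_gaussian]; simp [gaussMoment]
  rw [h]
  exact (Real.sqrt_pos.2 (by positivity)).ne'

theorem scaled_gauss {t : ℝ} (ht : 0 < t) (n : ℕ) :
    (Integrable fun y : ℝ => y ^ n * Real.exp (-(1 / 2) * (t * y) ^ 2)) ∧
      ∫ y : ℝ, y ^ n * Real.exp (-(1 / 2) * (t * y) ^ 2) = t⁻¹ ^ (n + 1) * gaussMoment n := by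
  have h : (fun y : ℝ => y ^ n * Real.exp (-(1 / 2) * (t * y) ^ 2)) =
      fun y => t⁻¹ ^ n * ((t * y) ^ n * Real.exp (-(1 / 2) * (t * y) ^ 2)) := by
    funext y
    rw [mul_pow t y n, ← mul_assoc, ← mul_assoc, ← mul_pow, inv_mul_cancel₀ ht.ne', one_pow,
      one_mul]
  rw [h]
  refine ⟨((integrable_pow_mul_gauss n).comp_mul_left' ht.ne').const_mul _, ?_⟩
  rw [integral_const_mul, Measure.integral_comp_mul_left
    (fun y => y ^ n * Real.exp (-(1 / 2) * y ^ 2)) t, abs_of_pos (inv_pos.2 ht), smul_eq_mul,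
    gaussMoment]
  ring

/-- The analytic continuation is unique because `ℂ ∖ {0}` is connected and the positive half-line
accumulates in it. -/
theorem continuationAtI_eq {g : ℝ → ℝ} {G : ℂ → ℂ} (hG : DifferentiableOn ℂ G {0}ᶜ)
    (h : ∀ t : ℝ, 0 < t → G t = g t) : continuationAtI g = G Complex.I := by
  have hex : ∃ G : ℂ → ℂ, DifferentiableOn ℂ G {0}ᶜ ∧ ∀ t : ℝ, 0 < t → G t = g t := ⟨G, hG, h⟩
  rw [continuationAtI, dif_pos hex]
  have hopen : IsOpen ({0}ᶜ : Set ℂ) := isOpen_compl_singleton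
  have hc : IsPreconnected ({0}ᶜ : Set ℂ) :=
    (isConnected_compl_singleton_of_one_lt_rank (by simp) 0).isPreconnected
  refine AnalyticOnNhd.eqOn_of_preconnected_of_frequently_eq (hex.choose_spec.1.analyticOnNhd hopen)
    (hG.analyticOnNhd hopen) hc (z₀ := 1) (by simp) ?_ (by simp)
  -- the two continuations agree at the points `1 + 1 / (n + 1)`
  have hlim : Filter.Tendsto (fun n : ℕ => ((1 + 1 / ((n : ℝ) + 1) : ℝ) : ℂ)) Filter.atTop
      (nhdsWithin 1 {1}ᶜ) := by
    refine tendsto_nhdsWithin_iff.2 ⟨?_, Filter.Eventually.of_forall fun n => ?_⟩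
    · have := (tendsto_one_div_add_atTop_nhds_zero_nat (𝕜 := ℝ)).const_add 1
      rw [add_zero] at this
      exact_mod_cast (Complex.continuous_ofReal.tendsto _).comp this
    · have : (0 : ℝ) < 1 / ((n : ℝ) + 1) := by positivity
      simp only [Set.mem_compl_iff, Set.mem_singleton_iff]
      intro e
      have e' : (1 + 1 / ((n : ℝ) + 1) : ℝ) = 1 := by exact_mod_cast e
      linarith
  refine hlim.frequently (Filter.Frequently.of_forall fun n => ?_)
  have hp : (0 : ℝ) < 1 + 1 / ((n : ℝ) + 1) := by positivity
  rw [hex.choose_spec.2 _ hp, h _ hp]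

variable {ι : Type} [Fintype ι]

open Classical in
/-- The Gaussian integral of the monomial `y ^ d`, where the squares with `ε_k ≠ 1` have been
rescaled by `z`. -/
def wickMonomial (ε : ι → ℝ) (z : ℂ) (d : ι →₀ ℕ) : ℂ :=
  ∏ k, (if ε k = 1 then 1 else z⁻¹) ^ (d k + 1) * (gaussMoment (d k) : ℂ)

theorem integral_monomial (ε : ι → ℝ) {t : ℝ} (ht : 0 < t) (d : ι →₀ ℕ) :
    (Integrable fun y : ι → ℝ => (∏ k, y k ^ d k) *
      Real.exp (-(1 / 2) * ∑ k, if ε k = 1 then y k ^ 2 else (t * y k) ^ 2)) ∧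
    ((∫ y : ι → ℝ, (∏ k, y k ^ d k) *
      Real.exp (-(1 / 2) * ∑ k, if ε k = 1 then y k ^ 2 else (t * y k) ^ 2) : ℝ) : ℂ) =
      wickMonomial ε t d := by
  classical
  set c : ι → ℝ := fun k => if ε k = 1 then 1 else t
  have hc : ∀ k, 0 < c k := fun k => by simp only [c]; split_ifs <;> [norm_num; exact ht]
  have h : (fun y : ι → ℝ => (∏ k, y k ^ d k) *
      Real.exp (-(1 / 2) * ∑ k, if ε k = 1 then y k ^ 2 else (t * y k) ^ 2)) =
      fun y => ∏ k, (y k ^ d k * Real.exp (-(1 / 2) * (c k * y k) ^ 2)) := by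
    funext y
    rw [Finset.prod_mul_distrib, ← Real.exp_sum, Finset.mul_sum]
    congr 2
    refine Finset.sum_congr rfl fun k _ => ?_
    simp only [c]
    split_ifs <;> simp
  rw [h]
  refine ⟨Integrable.fintype_prod (f := fun k (x : ℝ) =>
    x ^ d k * Real.exp (-(1 / 2) * (c k * x) ^ 2)) fun k => (scaled_gauss (hc k) (d k)).1, ?_⟩
  rw [integral_fintype_prod_volume_eq_prod (fun k (x : ℝ) =>
    x ^ d k * Real.exp (-(1 / 2) * (c k * x) ^ 2)), wickMonomial]
  push_cast
  refine Finset.prod_congr rfl fun k _ => ?_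
  rw [(scaled_gauss (hc k) (d k)).2]
  simp only [c]
  split_ifs <;> simp

theorem wickIntegral_eq (ε : ι → ℝ) (f : MvPolynomial ι ℝ) :
    wickIntegral ε f = ∑ d ∈ f.support, ((f.coeff d : ℝ) : ℂ) * wickMonomial ε Complex.I d := by
  classical
  refine continuationAtI_eq
    (G := fun z => ∑ d ∈ f.support, ((f.coeff d : ℝ) : ℂ) * wickMonomial ε z d) ?_ ?_
  · have : ∀ d : ι →₀ ℕ, DifferentiableOn ℂ (fun z => wickMonomial ε z d) {0}ᶜ := by
      intro d
      unfold wickMonomial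
      refine DifferentiableOn.fun_finsetProd fun k _ => ?_
      split_ifs
      · fun_prop
      · exact ((differentiableOn_inv.mono (by intro x hx; simpa using hx)).pow _).mul_const _
    exact DifferentiableOn.fun_sum fun d _ => (this d).const_mul _
  · intro t ht
    have h : (fun y : ι → ℝ => MvPolynomial.eval y f *
        Real.exp (-(1 / 2) * ∑ k, if ε k = 1 then y k ^ 2 else (t * y k) ^ 2)) =
        fun y => ∑ d ∈ f.support, f.coeff d * ((∏ k, y k ^ d k) *
          Real.exp (-(1 / 2) * ∑ k, if ε k = 1 then y k ^ 2 else (t * y k) ^ 2)) := by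
      funext y
      rw [MvPolynomial.eval_eq', Finset.sum_mul]
      exact Finset.sum_congr rfl fun d _ => mul_assoc _ _ _
    rw [h, integral_finsetSum _ fun d _ => (integral_monomial ε ht d).1.const_mul _]
    push_cast
    refine Finset.sum_congr rfl fun d _ => ?_
    rw [integral_const_mul, ← (integral_monomial ε ht d).2]
    push_cast
    rfl

/-- The Wick rotated Gaussian integral as a linear functional on polynomials. -/
def wickLinear (ε : ι → ℝ) : MvPolynomial ι ℝ →ₗ[ℝ] ℂ :=
  (MvPolynomial.basisMonomials ι ℝ).constr ℝ fun d => wickMonomial ε Complex.I d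

theorem wickLinear_monomial (ε : ι → ℝ) (d : ι →₀ ℕ) (a : ℝ) :
    wickLinear ε (MvPolynomial.monomial d a) = a * wickMonomial ε Complex.I d := by
  have h : MvPolynomial.monomial d a = a • MvPolynomial.basisMonomials ι ℝ d := by
    simp [MvPolynomial.coe_basisMonomials, MvPolynomial.smul_monomial]
  rw [h, map_smul, wickLinear, Module.Basis.constr_basis, Complex.real_smul]

theorem wickIntegral_eq_wickLinear (ε : ι → ℝ) (f : MvPolynomial ι ℝ) :
    wickIntegral ε f = wickLinear ε f := by
  rw [wickIntegral_eq]
  conv_rhs => rw [MvPolynomial.as_sum f]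
  rw [map_sum]
  exact Finset.sum_congr rfl fun d _ => (wickLinear_monomial ε d _).symm

theorem wickLinear_one_ne_zero (ε : ι → ℝ) : wickLinear ε 1 ≠ 0 := by
  classical
  rw [show (1 : MvPolynomial ι ℝ) = MvPolynomial.monomial 0 1 from rfl, wickLinear_monomial]
  simp only [Complex.ofReal_one, one_mul, wickMonomial]
  refine Finset.prod_ne_zero_iff.2 fun k _ => mul_ne_zero (pow_ne_zero _ ?_)
    (by exact_mod_cast gaussMoment_zero_ne)
  split_ifs <;> simp

/-- Integration by parts for the Wick rotated Gaussian integral. -/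
theorem wickLinear_pderiv {ε : ι → ℝ} (k : ι) (hε : ε k = 1 ∨ ε k = -1) (f : MvPolynomial ι ℝ) :
    wickLinear ε (MvPolynomial.pderiv k f) = ε k * wickLinear ε (MvPolynomial.X k * f) := by
  classical
  induction f using MvPolynomial.induction_on' with
  | add p q hp hq => rw [map_add, map_add, hp, hq, mul_add, map_add, mul_add]
  | monomial d a =>
    rw [MvPolynomial.pderiv_monomial, wickLinear_monomial, MvPolynomial.X,
      MvPolynomial.monomial_mul, wickLinear_monomial, one_mul]
    have hs : ∀ c : ι →₀ ℕ, (∀ j ≠ k, c j = d j) → wickMonomial ε Complex.I c =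
        ((if ε k = 1 then 1 else Complex.I⁻¹) ^ (c k + 1) * (gaussMoment (c k) : ℂ)) *
        ∏ j ∈ Finset.univ.erase k,
          (if ε j = 1 then 1 else Complex.I⁻¹) ^ (d j + 1) * (gaussMoment (d j) : ℂ) := by
      intro c hc
      rw [wickMonomial, ← Finset.mul_prod_erase Finset.univ _ (Finset.mem_univ k)]
      congr 1
      refine Finset.prod_congr rfl fun j hj => ?_
      rw [hc j (Finset.ne_of_mem_erase hj)]
    rw [hs _ fun j hj => by simp [Ne.symm hj],
      hs _ fun j hj => by simp [Ne.symm hj]]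
    simp only [Finsupp.tsub_apply, Finsupp.add_apply, Finsupp.single_eq_same]
    rw [add_comm 1 (d k), gaussMoment_succ]
    have hθ : (d k : ℂ) * (if ε k = 1 then 1 else Complex.I⁻¹) ^ (d k - 1 + 1) =
        ε k * ((if ε k = 1 then 1 else Complex.I⁻¹) ^ (d k + 1 + 1) * d k) := by
      cases d k with
      | zero => simp
      | succ n =>
        rcases hε with h | h
        · simp [h]
        · rw [h, if_neg (by norm_num), Nat.add_sub_cancel, pow_succ _ (n + 1 + 1),
            pow_succ _ (n + 1), mul_assoc (_ ^ (n + 1)), ← mul_inv, Complex.I_mul_I]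
          push_cast
          ring
    push_cast
    linear_combination (a * (gaussMoment (d k - 1) : ℂ) * ∏ j ∈ Finset.univ.erase k,
          (if ε j = 1 then 1 else Complex.I⁻¹) ^ (d j + 1) * (gaussMoment (d j) : ℂ)) * hθ

end Wick


section Gaussian

variable {K : Type} {par : K → ZMod 2}

/-! ### The Berezin integral -/

theorem rderiv_rderiv_odd {j k : K} (hj : par j ≠ 0) (hk : par k ≠ 0) (f : SuperPoly par) :
    rderiv par j (rderiv par k f) = -rderiv par k (rderiv par j f) := by
  induction f using TensorProduct.induction_on with
  | zero => simp
  | add x y hx hy => simp only [map_add, hx, hy, neg_add]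
  | tmul x y =>
    simp only [rderiv, hj, hk, dif_neg, not_false_eq_true, TensorProduct.map_tmul,
      LinearMap.id_coe, id_eq, LinearMap.flip_apply]
    rw [CliffordAlgebra.contractRight_comm, TensorProduct.tmul_neg]

theorem rderiv_self_odd {k : K} (hk : par k ≠ 0) (f : SuperPoly par) :
    rderiv par k (rderiv par k f) = 0 := by
  have h : (2 : ℝ) • rderiv par k (rderiv par k f) = 0 := by
    rw [two_smul]; nth_rewrite 1 [rderiv_rderiv_odd hk hk]; simp
  exact (smul_eq_zero.1 h).resolve_left two_ne_zero

theorem lderiv_even_rderiv_odd {j k : K} (hj : par j = 0) (hk : par k ≠ 0) (f : SuperPoly par) :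
    lderiv par j (rderiv par k f) = rderiv par k (lderiv par j f) := by
  induction f using TensorProduct.induction_on with
  | zero => simp
  | add x y hx hy => simp only [map_add, hx, hy]
  | tmul x y => simp [lderiv, rderiv, hj, hk]

theorem rderiv_monomial_of_notMem {k : K} (hk : par k ≠ 0) {w : List K} (h : k ∉ w) :
    rderiv par k (monomial par w) = 0 := by
  classical
  induction w using List.reverseRecOn with
  | nil => simp
  | append_singleton w j ih =>
    simp only [List.mem_append, List.mem_singleton, not_or] at h
    rw [monomial_append, show monomial par [j] = coord par j by simp [monomial],
      rderiv_mul_coord_odd par hk, ih h.1, if_neg h.2]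
    simp

variable (par) in
/-- Iterated right derivatives along a list of odd coordinates. -/
def iterRderiv : List (Od par) → (SuperPoly par →ₗ[ℝ] SuperPoly par)
  | [] => LinearMap.id
  | k :: l => iterRderiv l ∘ₗ rderiv par k.1

theorem foldl_rderiv_eq (l : List (Od par)) (f : SuperPoly par) :
    l.foldl (fun g k => rderiv par k.1 g) f = iterRderiv par l f := by
  induction l generalizing f with
  | nil => rfl
  | cons k l ih => exact ih _

theorem iterRderiv_rderiv {k : Od par} {l : List (Od par)} (h : k ∈ l) (f : SuperPoly par) :
    iterRderiv par l (rderiv par k.1 f) = 0 := by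
  induction l generalizing f with
  | nil => simp at h
  | cons j l ih =>
    rw [iterRderiv, LinearMap.comp_apply]
    by_cases hj : k = j
    · rw [hj, rderiv_self_odd j.2, map_zero]
    · rw [rderiv_rderiv_odd j.2 k.2, map_neg,
        ih ((List.mem_cons.1 h).resolve_left hj), neg_zero]

theorem iterRderiv_lderiv_even {k : K} (hk : par k = 0) (l : List (Od par)) (f : SuperPoly par) :
    iterRderiv par l (lderiv par k f) = lderiv par k (iterRderiv par l f) := by
  induction l generalizing f with
  | nil => rfl
  | cons j l ih =>
    simp only [iterRderiv, LinearMap.comp_apply]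
    rw [← lderiv_even_rderiv_odd hk j.2, ih]

theorem iterRderiv_tmul_one_mul (p : MvPolynomial (Ev par) ℝ) (l : List (Od par))
    (f : SuperPoly par) :
    iterRderiv par l ((p ⊗ₜ[ℝ] 1 : SuperPoly par) * f) = (p ⊗ₜ[ℝ] 1) * iterRderiv par l f := by
  induction l generalizing f with
  | nil => rfl
  | cons j l ih =>
    simp only [iterRderiv, LinearMap.comp_apply]
    rw [← ih]
    congr 1
    induction f using TensorProduct.induction_on with
    | zero => simp
    | add x y hx hy => simp only [map_add, mul_add, hx, hy]
    | tmul x y => simp [rderiv, j.2]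

theorem iterRderiv_top {l : List (Od par)} (hl : l.Nodup) :
    iterRderiv par l (monomial par (l.reverse.map Subtype.val)) = 1 := by
  classical
  induction l with
  | nil => simp [iterRderiv]
  | cons k l ih =>
    rw [List.nodup_cons] at hl
    have hk : k.1 ∉ l.reverse.map Subtype.val := by
      simpa [k.2] using hl.1
    rw [List.reverse_cons, List.map_append, monomial_append, iterRderiv, LinearMap.comp_apply,
      show monomial par (List.map Subtype.val [k]) = coord par k.1 by simp [monomial],
      rderiv_mul_coord_odd par k.2, if_pos rfl, rderiv_monomial_of_notMem k.2 hk, zero_mul,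
      smul_zero, add_zero, ih hl.2]

theorem body_lderiv_even {k : K} (hk : par k = 0) (f : SuperPoly par) :
    body par (lderiv par k f) = MvPolynomial.pderiv ⟨k, hk⟩ (body par f) := by
  induction f using TensorProduct.induction_on with
  | zero => simp
  | add x y hx hy => simp only [map_add, hx, hy]
  | tmul x y => simp [lderiv, body, hk]

theorem tmul_one_mem_parityPart (p : MvPolynomial (Ev par) ℝ) :
    (p ⊗ₜ[ℝ] 1 : SuperPoly par) ∈ parityPart par 0 := by
  induction p using MvPolynomial.induction_on with
  | C a =>
    rw [← mul_one (MvPolynomial.C a), ← MvPolynomial.smul_eq_C_mul, ← TensorProduct.smul_tmul']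
    exact Submodule.smul_mem _ a (one_mem_parityPart par)
  | add p q hp hq => rw [TensorProduct.add_tmul]; exact Submodule.add_mem _ hp hq
  | mul_X p k hp =>
    have := mul_mem_parityPart hp (coord_mem_parityPart par k.1)
    rwa [coord_even par k.2, Algebra.TensorProduct.tmul_mul_tmul, mul_one, k.2, add_zero] at this

/-! ### Powers of the ideal of odd coordinates -/

theorem coord_mul_monomial_of_mem {k : K} (hk : par k ≠ 0) {w : List K} (h : k ∈ w) :
    coord par k * monomial par w = 0 := by
  induction w with
  | nil => simp at h
  | cons j w ih =>
    rw [monomial_cons, ← mul_assoc]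
    by_cases hj : k = j
    · subst hj
      have h2 : (2 : ℝ) • (coord par k * coord par k) = 0 := by
        rw [two_smul]
        nth_rewrite 1 [coord_mul_coord]
        rw [eq_one_of_ne_zero hk, mul_one, sgn_one, superPoly_neg_one_smul, neg_add_cancel]
      rw [(smul_eq_zero.1 h2).resolve_left two_ne_zero, zero_mul]
    · rw [coord_mul_coord, smul_mul_assoc, mul_assoc, ih ((List.mem_cons.1 h).resolve_left hj),
        mul_zero, smul_zero]

open Classical in
theorem monomial_eq_zero_of_not_nodup {w : List K}
    (h : ¬ (w.filter fun k => par k ≠ 0).Nodup) : monomial par w = 0 := by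
  induction w with
  | nil => simp at h
  | cons k w ih =>
    rw [monomial_cons]
    by_cases hk : par k = 0
    · rw [ih (by simpa [hk] using h), mul_zero]
    · by_cases hm : k ∈ w
      · exact coord_mul_monomial_of_mem hk hm
      · rw [ih, mul_zero]
        intro hn
        refine h ?_
        rw [List.filter_cons_of_pos (by simpa using hk), List.nodup_cons]
        exact ⟨fun hm' => hm (List.mem_filter.1 hm').1, hn⟩

variable (par) in
open Classical in
/-- The `N`-th power of the ideal generated by the odd coordinates. -/
def oddPart (N : ℕ) : Submodule ℝ (SuperPoly par) :=
  Submodule.span ℝ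
    {f | ∃ w : List K, N ≤ (w.filter fun k => par k ≠ 0).length ∧ f = monomial par w}

theorem mul_mem_oddPart {M N : ℕ} {f g : SuperPoly par} (hf : f ∈ oddPart par M)
    (hg : g ∈ oddPart par N) : f * g ∈ oddPart par (M + N) := by
  have h : f * g ∈ oddPart par M * oddPart par N := Submodule.mul_mem_mul hf hg
  rw [oddPart, oddPart, Submodule.span_mul_span] at h
  refine Submodule.span_mono ?_ h
  rintro _ ⟨_, ⟨v, hv, rfl⟩, _, ⟨w, hw, rfl⟩, rfl⟩
  exact ⟨v ++ w, by rw [List.filter_append, List.length_append]; omega,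
    (monomial_append par v w).symm⟩

theorem pow_mem_oddPart {f : SuperPoly par} (hf : f ∈ oddPart par 1) (N : ℕ) :
    f ^ N ∈ oddPart par N := by
  induction N with
  | zero => exact Submodule.subset_span ⟨[], by simp⟩
  | succ N ih => rw [pow_succ]; exact mul_mem_oddPart ih hf

theorem body_tmul_one_sub_mem_oddPart (f : SuperPoly par) :
    (body par f ⊗ₜ[ℝ] 1 : SuperPoly par) - f ∈ oddPart par 1 := by
  classical
  induction f using superPoly_induction with
  | zero => simp
  | add f g hf hg =>
    rw [map_add, TensorProduct.add_tmul, add_sub_add_comm]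
    exact Submodule.add_mem _ hf hg
  | smul a f hf =>
    have h : (body par (a • f) ⊗ₜ[ℝ] 1 : SuperPoly par) - a • f =
        a • ((body par f ⊗ₜ[ℝ] 1 : SuperPoly par) - f) := by
      rw [map_smul, ← TensorProduct.smul_tmul']; module
    rw [h]
    exact Submodule.smul_mem _ _ hf
  | word w =>
    by_cases hw : 1 ≤ (w.filter fun k => par k ≠ 0).length
    · have h0 : body par (monomial par w) = 0 := by
        obtain ⟨k, hk⟩ := List.exists_mem_of_length_pos hw
        rw [List.mem_filter] at hk
        rw [body_eq_bodyHom, monomial, map_list_prod]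
        refine List.prod_eq_zero (List.mem_map.2 ⟨coord par k, List.mem_map.2 ⟨k, hk.1, rfl⟩, ?_⟩)
        rw [← body_eq_bodyHom, body_coord_odd par (by simpa using hk.2)]
      rw [h0, TensorProduct.zero_tmul, zero_sub]
      exact Submodule.neg_mem _ (Submodule.subset_span ⟨w, by convert hw, rfl⟩)
    · have h0 : ∀ k ∈ w, par k = 0 := by
        intro k hk
        by_contra hc
        exact hw (List.length_pos_of_mem (List.mem_filter.2 ⟨hk, by simpa using hc⟩))
      have h1 : (body par (monomial par w) ⊗ₜ[ℝ] 1 : SuperPoly par) = monomial par w := by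
        clear hw
        induction w with
        | nil => rw [monomial_nil, body_one, Algebra.TensorProduct.one_def]
        | cons k w ih =>
          have hk := h0 k (by simp)
          have ih' := ih fun j hj => h0 j (by simp [hj])
          rw [monomial_cons, body_mul, body_coord_even par hk]
          conv_rhs => rw [← ih']
          rw [coord_even par hk, Algebra.TensorProduct.tmul_mul_tmul, mul_one]
      rw [h1, sub_self]
      exact Submodule.zero_mem _

variable [Fintype K] [DecidableEq K]

theorem eq_zero_of_mem_oddPart {N : ℕ} (hN : Fintype.card (Od par) < N) {f : SuperPoly par}
    (hf : f ∈ oddPart par N) : f = 0 := by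
  classical
  have h : oddPart par N ≤ ⊥ := by
    refine Submodule.span_le.2 ?_
    rintro _ ⟨w, hw, rfl⟩
    refine (Submodule.mem_bot ℝ).2 (monomial_eq_zero_of_not_nodup fun hn => ?_)
    have h1 : (w.filter fun k => par k ≠ 0).length ≤ Fintype.card (Od par) := by
      rw [← List.toFinset_card_of_nodup hn, Fintype.card_subtype]
      refine Finset.card_le_card fun k hk => ?_
      simp only [List.mem_toFinset, List.mem_filter] at hk
      simpa using hk.2
    omega
  exact (Submodule.mem_bot ℝ).1 (h hf)

/-! ### The Gaussian superintegral and integration by parts -/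

variable (par) in
/-- The Berezin integral as a linear map. -/
def berezinLinear : SuperPoly par →ₗ[ℝ] MvPolynomial (Ev par) ℝ :=
  body par ∘ₗ iterRderiv par (Finset.univ : Finset (Od par)).toList

omit [DecidableEq K] in
theorem berezin_eq (f : SuperPoly par) : berezin par f = berezinLinear par f := by
  rw [berezin, foldl_rderiv_eq]; rfl

omit [DecidableEq K] in
theorem berezinLinear_lderiv_odd {k : K} (hk : par k ≠ 0) (f : SuperPoly par) :
    berezinLinear par (lderiv par k f) = 0 := by
  induction f using superPoly_induction with
  | zero => simp
  | add f g hf hg => rw [map_add, map_add, hf, hg, add_zero]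
  | smul a f hf => rw [map_smul, map_smul, hf, smul_zero]
  | word w =>
    have h := rderiv_of_mem hk (monomial_mem_parityPart par w)
    have h0 : berezinLinear par (rderiv par k (monomial par w)) = 0 := by
      rw [berezinLinear, LinearMap.comp_apply,
        iterRderiv_rderiv (k := ⟨k, hk⟩) (Finset.mem_toList.2 (Finset.mem_univ _)), map_zero]
    rw [h, map_smul] at h0
    exact (smul_eq_zero.1 h0).resolve_left (neg_ne_zero.2 (sgn_ne_zero _))

omit [DecidableEq K] in
theorem berezinLinear_lderiv_even {k : K} (hk : par k = 0) (f : SuperPoly par) :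
    berezinLinear par (lderiv par k f) = MvPolynomial.pderiv ⟨k, hk⟩ (berezinLinear par f) := by
  simp only [berezinLinear, LinearMap.comp_apply]
  rw [iterRderiv_lderiv_even hk, body_lderiv_even hk]

omit [DecidableEq K] in
theorem berezinLinear_tmul_one_mul (p : MvPolynomial (Ev par) ℝ) (f : SuperPoly par) :
    berezinLinear par ((p ⊗ₜ[ℝ] 1 : SuperPoly par) * f) = p * berezinLinear par f := by
  simp only [berezinLinear, LinearMap.comp_apply]
  rw [iterRderiv_tmul_one_mul, body_mul]
  congr 1
  simp [body]

variable {σ : SuperPoly par}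

omit [Fintype K] [DecidableEq K] in
theorem soul_mem_parityPart (hσ : σ ∈ parityPart par 0) :
    (body par σ ⊗ₜ[ℝ] 1 : SuperPoly par) - σ ∈ parityPart par 0 :=
  Submodule.sub_mem _ (tmul_one_mem_parityPart _) hσ

omit [Fintype K] [DecidableEq K] in
theorem pow_mem_parityPart_zero {f : SuperPoly par} (hf : f ∈ parityPart par 0) (N : ℕ) :
    f ^ N ∈ parityPart par 0 := by
  induction N with
  | zero => exact one_mem_parityPart par
  | succ N ih => rw [pow_succ]; simpa using mul_mem_parityPart ih hf

omit [Fintype K] [DecidableEq K] in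
theorem lderiv_pow (k : K) {f : SuperPoly par} (hf : f ∈ parityPart par 0) (N : ℕ) :
    lderiv par k (f ^ (N + 1)) = ((N + 1 : ℕ) : ℝ) • (lderiv par k f * f ^ N) := by
  induction N with
  | zero => simp
  | succ N ih =>
    have h : f ^ (N + 1) * lderiv par k f = lderiv par k f * f ^ (N + 1) := by
      rw [mul_comm_of_mem (pow_mem_parityPart_zero hf (N + 1)) (lderiv_mem_parityPart k hf)]
      simp
    rw [pow_succ f (N + 1), lderiv_mul k (pow_mem_parityPart_zero hf (N + 1)), ih, mul_zero,
      sgn_zero, one_smul, h, smul_mul_assoc, mul_assoc, ← pow_succ]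
    push_cast
    module

theorem lderiv_expSoul (k : K) (hσ : σ ∈ parityPart par 0) :
    lderiv par k (expSoul par σ) =
      lderiv par k ((body par σ ⊗ₜ[ℝ] 1 : SuperPoly par) - σ) * expSoul par σ := by
  set ν := (body par σ ⊗ₜ[ℝ] 1 : SuperPoly par) - σ with hν
  have hν0 : ν ∈ parityPart par 0 := soul_mem_parityPart hσ
  have hle : Fintype.card (Od par) ≤ Fintype.card K := Fintype.card_subtype_le _
  have hnil : ν ^ (Fintype.card K + 1) = 0 :=
    eq_zero_of_mem_oddPart (by omega) (pow_mem_oddPart (body_tmul_one_sub_mem_oddPart σ) _)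
  have hlast : lderiv par k ν * ν ^ Fintype.card K = 0 := by
    have h := lderiv_pow k hν0 (Fintype.card K)
    rw [hnil, map_zero] at h
    exact (smul_eq_zero.1 h.symm).resolve_left (by positivity)
  rw [expSoul, map_sum, Finset.sum_range_succ', Finset.mul_sum, Finset.sum_range_succ, ← hν]
  rw [pow_zero, map_smul, lderiv_one, smul_zero, add_zero, mul_smul_comm, hlast, smul_zero,
    add_zero]
  refine Finset.sum_congr rfl fun j _ => ?_
  rw [map_smul, lderiv_pow k hν0, smul_smul, mul_smul_comm, Nat.factorial_succ]
  congr 1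
  have : (j.factorial : ℝ) ≠ 0 := by positivity
  push_cast
  field_simp

theorem pderiv_evenSubst (T : Matrix (Ev par) (Ev par) ℝ) (j : Ev par)
    (p : MvPolynomial (Ev par) ℝ) : MvPolynomial.pderiv j (evenSubst par T p) =
      ∑ k, MvPolynomial.C (T k j) * evenSubst par T (MvPolynomial.pderiv k p) := by
  induction p using MvPolynomial.induction_on with
  | C a => simp [evenSubst]
  | add p q hp hq => simp only [map_add, hp, hq, mul_add, Finset.sum_add_distrib]
  | mul_X p i hp =>
    have hX : MvPolynomial.pderiv j (evenSubst par T (MvPolynomial.X i)) =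
        MvPolynomial.C (T i j) := by
      simp [evenSubst, MvPolynomial.pderiv_X, Pi.single_apply]
    rw [map_mul, Derivation.leibniz, hp, hX]
    simp only [Derivation.leibniz, MvPolynomial.pderiv_X, Pi.single_apply, smul_eq_mul, map_add,
      map_mul, mul_add, Finset.sum_add_distrib, Finset.mul_sum]
    congr 1
    · rw [Finset.sum_eq_single i (fun k _ hk => by simp [Ne.symm hk]) (by simp)]
      simp [mul_comm]
    · exact Finset.sum_congr rfl fun k _ => by ring

theorem evenSubst_pderiv {T : Matrix (Ev par) (Ev par) ℝ} (hT : IsUnit T.det) (k : Ev par)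
    (p : MvPolynomial (Ev par) ℝ) : evenSubst par T (MvPolynomial.pderiv k p) =
      ∑ j, MvPolynomial.C (T⁻¹ j k) * MvPolynomial.pderiv j (evenSubst par T p) := by
  simp only [pderiv_evenSubst, Finset.mul_sum]
  rw [Finset.sum_comm]
  have h : ∀ i, ∑ j, MvPolynomial.C (T⁻¹ j k) *
      (MvPolynomial.C (T i j) * evenSubst par T (MvPolynomial.pderiv i p)) =
      MvPolynomial.C ((T * T⁻¹) i k) * evenSubst par T (MvPolynomial.pderiv i p) := by
    intro i
    rw [Matrix.mul_apply, map_sum, Finset.sum_mul]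
    exact Finset.sum_congr rfl fun j _ => by rw [map_mul]; ring
  rw [Finset.sum_congr rfl fun i _ => h i, Matrix.mul_nonsing_inv T hT,
    Finset.sum_eq_single k (fun i _ hi => by simp [Matrix.one_apply_ne hi]) (by simp)]
  simp

variable {T : Matrix (Ev par) (Ev par) ℝ} {ε : Ev par → ℝ}

theorem wickLinear_evenSubst_pderiv (h : Diagonalises par σ T ε) (k : Ev par)
    (g : MvPolynomial (Ev par) ℝ) :
    wickLinear ε (evenSubst par T (MvPolynomial.pderiv k g)) =
      wickLinear ε (evenSubst par T (MvPolynomial.pderiv k (body par σ) * g)) := by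
  obtain ⟨hT, hε, hd⟩ := h
  have hb : evenSubst par T (MvPolynomial.pderiv k (body par σ)) =
      ∑ j, MvPolynomial.C (T⁻¹ j k) * (MvPolynomial.C (ε j) * MvPolynomial.X j) := by
    rw [evenSubst_pderiv hT, hd]
    refine Finset.sum_congr rfl fun j _ => ?_
    congr 1
    rw [MvPolynomial.pderiv_C_mul, map_sum,
      Finset.sum_eq_single j (fun i _ hi => by simp [MvPolynomial.pderiv_X, hi]) (by simp)]
    rw [MvPolynomial.pderiv_C_mul, Derivation.leibniz_pow, MvPolynomial.pderiv_X_self]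
    rw [smul_eq_mul, mul_one, pow_one, nsmul_eq_mul]
    have h2 : (MvPolynomial.C (1 / 2) * ((2 : ℕ) : MvPolynomial (Ev par) ℝ)) = 1 := by
      rw [← map_natCast (MvPolynomial.C (σ := Ev par) (R := ℝ)), ← map_mul]; norm_num
    linear_combination (MvPolynomial.C (ε j) * MvPolynomial.X j) * h2
  rw [map_mul, hb, Finset.sum_mul, map_sum, evenSubst_pderiv hT, map_sum]
  refine Finset.sum_congr rfl fun j _ => ?_
  rw [mul_assoc, mul_assoc, ← MvPolynomial.smul_eq_C_mul, ← MvPolynomial.smul_eq_C_mul,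
    ← MvPolynomial.smul_eq_C_mul, map_smul, map_smul, map_smul, wickLinear_pderiv j (hε j),
    Complex.real_smul (x := ε j)]

variable (σ T ε) in
/-- The Gaussian superintegral, up to the constant Jacobian, as a linear functional. -/
def gaussFunctional : SuperPoly par →ₗ[ℝ] ℂ :=
  wickLinear ε ∘ₗ (evenSubst par T).toLinearMap ∘ₗ berezinLinear par ∘ₗ
    LinearMap.mulRight ℝ (expSoul par σ)

omit [DecidableEq K] in
theorem gaussFunctional_apply (f : SuperPoly par) : gaussFunctional σ T ε f =
    wickLinear ε (evenSubst par T (berezinLinear par (f * expSoul par σ))) := rfl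

theorem gaussianIntegral_eq (f : SuperPoly par) :
    gaussianIntegral par σ T ε f = ((|T.det| : ℝ) : ℂ) * gaussFunctional σ T ε f := by
  rw [gaussianIntegral, wickIntegral_eq_wickLinear, berezin_eq, gaussFunctional_apply]

/-- Integration by parts for the Gaussian superintegral. -/
theorem gaussFunctional_lderiv (h : Diagonalises par σ T ε) (hσ : σ ∈ parityPart par 0) (k : K)
    (f : SuperPoly par) :
    gaussFunctional σ T ε (lderiv par k f) = gaussFunctional σ T ε (lderiv par k σ * f) := by
  induction f using superPoly_induction with
  | zero => simp
  | add f g hf hg => rw [map_add, map_add, hf, hg, mul_add, map_add]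
  | smul a f hf => rw [map_smul, map_smul, hf, mul_smul_comm, map_smul]
  | word w =>
    set f := monomial par w
    have hf : f ∈ parityPart par _ := monomial_mem_parityPart par w
    set e := expSoul par σ with he
    set b : SuperPoly par := body par σ ⊗ₜ[ℝ] 1 with hb
    have hν := soul_mem_parityPart hσ
    rw [← hb] at hν
    have key : lderiv par k (f * e) = lderiv par k f * e + lderiv par k b * (f * e) -
        lderiv par k σ * f * e := by
      rw [lderiv_mul k hf, he, lderiv_expSoul k hσ, ← hb, ← he, ← mul_assoc f,
        mul_comm_of_mem hf (lderiv_mem_parityPart k hν), smul_mul_assoc, smul_smul, add_zero,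
        mul_comm (par k), sgn_mul_self, one_smul, map_sub, sub_mul, sub_mul, mul_assoc]
      abel
    simp only [gaussFunctional_apply, ← he]
    by_cases hk : par k = 0
    · have hbk : lderiv par k b = MvPolynomial.pderiv ⟨k, hk⟩ (body par σ) ⊗ₜ[ℝ] 1 := by
        simp [lderiv, hk, hb]
      have h1 := congrArg (berezinLinear par) key
      rw [berezinLinear_lderiv_even hk, map_sub, map_add, hbk, berezinLinear_tmul_one_mul] at h1
      have h2 := wickLinear_evenSubst_pderiv h ⟨k, hk⟩ (berezinLinear par (f * e))
      rw [h1, map_sub, map_sub, map_add, map_add] at h2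
      linear_combination h2
    · have hbk : lderiv par k b = 0 := by
        simp [lderiv, hk, hb]
      have h1 := congrArg (berezinLinear par) key
      rw [berezinLinear_lderiv_odd hk, hbk, zero_mul, add_zero, map_sub] at h1
      rw [sub_eq_zero.1 h1.symm]

omit [DecidableEq K] in
/-- A functional satisfying a Wick recursion is determined by its value at `1`. -/
theorem eq_zero_of_wick_recursion {N : Type*} [AddCommGroup N] [Module ℝ N] (g : K → K → ℝ)
    {I : SuperPoly par →ₗ[ℝ] N}
    (hI : ∀ k f, I (coord par k * f) = ∑ j, g k j • I (lderiv par j f)) (h1 : I 1 = 0) :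
    I = 0 := by
  have key : ∀ N : ℕ, ∀ f ∈ degreePart par N, I f = 0 := by
    intro N
    induction N using Nat.strong_induction_on with
    | _ N ih =>
      intro f hf
      induction hf using degreePart_induction with
      | zero => simp
      | add f g _ _ hf hg => rw [map_add, hf, hg, add_zero]
      | smul a f _ hf => rw [map_smul, hf, smul_zero]
      | word w hw =>
        cases w with
        | nil => simpa using h1
        | cons k w =>
          rw [monomial_cons, hI]
          refine Finset.sum_eq_zero fun j _ => ?_
          have hmem := monomial_mem_degreePart (par := par) w
          rcases hl : w.length with _ | M
          · rw [hl] at hmem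
            rw [lderiv_eq_zero_of_mem_degreePart_zero j hmem, map_zero, smul_zero]
          · rw [hl] at hmem
            rw [ih M (by simp only [List.length_cons] at hw; omega) _
              (lderiv_mem_degreePart j hmem), smul_zero]
  exact linearMap_ext_monomial fun w => by
    rw [key _ _ (monomial_mem_degreePart w), LinearMap.zero_apply]

/-- The Gaussian superintegral of the product of all odd coordinates does not vanish. -/
theorem gaussFunctional_top_ne_zero (σ : SuperPoly par) (T : Matrix (Ev par) (Ev par) ℝ)
    (ε : Ev par → ℝ) : gaussFunctional σ T ε (monomial par
      ((Finset.univ : Finset (Od par)).toList.reverse.map Subtype.val)) ≠ 0 := by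
  classical
  set l := (Finset.univ : Finset (Od par)).toList with hl
  set t := monomial par (l.reverse.map Subtype.val) with ht
  have htop : t ∈ oddPart par (Fintype.card (Od par)) := by
    refine Submodule.subset_span ⟨_, ?_, rfl⟩
    rw [List.filter_eq_self.2]
    · simp [hl]
    · intro k hk
      obtain ⟨j, -, rfl⟩ := List.mem_map.1 hk
      simpa using j.2
  have hmul : t * expSoul par σ = t := by
    rw [expSoul, Finset.mul_sum, Finset.sum_eq_single 0]
    · simp
    · intro j _ hj
      obtain ⟨i, rfl⟩ := Nat.exists_eq_succ_of_ne_zero hj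
      have h0 := eq_zero_of_mem_oddPart (N := Fintype.card (Od par) + 1) (by omega)
        (mul_mem_oddPart htop (body_tmul_one_sub_mem_oddPart σ))
      rw [mul_smul_comm, Nat.succ_eq_add_one, pow_succ', ← mul_assoc, h0, zero_mul, smul_zero]
    · simp
  rw [gaussFunctional_apply, hmul, berezinLinear, LinearMap.comp_apply, ← hl, ht,
    iterRderiv_top (Finset.nodup_toList _), body_one, map_one]
  exact wickLinear_one_ne_zero ε

theorem gaussFunctional_one_ne_zero (h : Diagonalises par σ T ε) (hσ : σ ∈ parityPart par 0)
    (hnd : ∃ g : K → K → ℝ, ∀ k, coord par k = ∑ j, g k j • lderiv par j σ) :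
    gaussFunctional σ T ε 1 ≠ 0 := by
  obtain ⟨g, hg⟩ := hnd
  intro h1
  have h0 : gaussFunctional σ T ε = 0 := by
    refine eq_zero_of_wick_recursion g (fun k f => ?_) h1
    rw [hg, Finset.sum_mul, map_sum]
    refine Finset.sum_congr rfl fun j _ => ?_
    rw [smul_mul_assoc, map_smul, gaussFunctional_lderiv h hσ]
  exact gaussFunctional_top_ne_zero σ T ε (by rw [h0, LinearMap.zero_apply])

end Gaussian


namespace ContractibleDGFrobenius

variable {A : Type*} [NonUnitalRing A] [Module ℝ A] [IsScalarTower ℝ A A] [SMulCommClass ℝ A A]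
variable (F : ContractibleDGFrobenius A)

/-! ### The parity involution and homogeneous bases -/

theorem isCompl_gr : IsCompl (F.gr 0) (F.gr 1) :=
  (DirectSum.isInternal_submodule_iff_isCompl F.gr (by decide) (by
    ext i; rcases zmod_two_cases i with rfl | rfl <;> simp)).1 F.isInternal

theorem exists_homogeneous_add (a : A) : ∃ b ∈ F.gr 0, ∃ c ∈ F.gr 1, b + c = a :=
  Submodule.mem_sup.1 (F.isCompl_gr.sup_eq_top ▸ Submodule.mem_top)

variable {F} in
theorem homogeneous_induction {P : A → Prop} (a : A) (add : ∀ a b, P a → P b → P (a + b))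
    (hom : ∀ p, ∀ a ∈ F.gr p, P a) : P a := by
  obtain ⟨b, hb, c, hc, rfl⟩ := F.exists_homogeneous_add a
  exact add _ _ (hom 0 b hb) (hom 1 c hc)

/-- The parity involution `a ↦ (-1)^{|a|} a` of `A`. -/
def involution : A →ₗ[ℝ] A :=
  LinearMap.ofIsCompl F.isCompl_gr (F.gr 0).subtype (-(F.gr 1).subtype)

theorem involution_of_mem {p : ZMod 2} {a : A} (ha : a ∈ F.gr p) :
    F.involution a = sgn p • a := by
  rcases zmod_two_cases p with rfl | rfl
  · simpa [involution] using LinearMap.ofIsCompl_apply_left F.isCompl_gr (⟨a, ha⟩ : F.gr 0)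
      (φ := (F.gr 0).subtype) (ψ := -(F.gr 1).subtype)
  · simpa [involution] using LinearMap.ofIsCompl_apply_right F.isCompl_gr (⟨a, ha⟩ : F.gr 1)
      (φ := (F.gr 0).subtype) (ψ := -(F.gr 1).subtype)

@[simp] theorem involution_involution (a : A) : F.involution (F.involution a) = a := by
  induction a using homogeneous_induction (F := F) with
  | add a b ha hb => rw [map_add, map_add, ha, hb]
  | hom p a ha => rw [F.involution_of_mem ha, map_smul, F.involution_of_mem ha, smul_smul,
      sgn_mul_self, one_smul]

theorem mem_gr_of_involution {p : ZMod 2} {a : A} (h : F.involution a = sgn p • a) :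
    a ∈ F.gr p := by
  obtain ⟨b, hb, c, hc, rfl⟩ := F.exists_homogeneous_add a
  rw [map_add, F.involution_of_mem hb, F.involution_of_mem hc] at h
  rcases zmod_two_cases p with rfl | rfl
  · have h2 : (2 : ℝ) • c = 0 := by
      simp only [sgn_zero, sgn_one, one_smul, neg_smul] at h
      rw [two_smul]
      nth_rewrite 1 [← add_left_cancel h]; simp
    rw [(smul_eq_zero.1 h2).resolve_left two_ne_zero, add_zero]
    exact hb
  · have h2 : (2 : ℝ) • b = 0 := by
      simp only [sgn_zero, sgn_one, one_smul, neg_smul, neg_add] at h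
      rw [two_smul]
      nth_rewrite 1 [add_right_cancel h]; simp
    rw [(smul_eq_zero.1 h2).resolve_left two_ne_zero, zero_add]
    exact hc

theorem d_involution (a : A) : F.d (F.involution a) = -F.involution (F.d a) := by
  induction a using homogeneous_induction (F := F) with
  | add a b ha hb => simp only [map_add, ha, hb, neg_add]
  | hom p a ha =>
    rw [F.involution_of_mem ha, map_smul, F.involution_of_mem (F.d_mem ha), sgn_add]
    simp

theorem form_comm (a b : A) : F.form a b = F.form b a := by
  induction a using homogeneous_induction (F := F) with
  | add a a' ha ha' => simp only [map_add, LinearMap.add_apply, ha, ha']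
  | hom p a ha =>
    induction b using homogeneous_induction (F := F) with
    | add b b' hb hb' => simp only [map_add, LinearMap.add_apply, hb, hb']
    | hom q b hb =>
      by_cases h : p + q = 0
      · rw [F.form_odd ha hb h, F.form_odd hb ha (by rwa [add_comm])]
      · rw [F.form_symm ha hb]
        have : p * q = 0 := by clear ha hb; revert p q; decide
        rw [this, sgn_zero, one_mul]

theorem form_left_ext {a b : A} (h : ∀ x, F.form a x = F.form b x) : a = b :=
  F.form_nondegenerate.1 (LinearMap.ext h)

theorem form_involution (a b : A) : F.form (F.involution a) b = -F.form a (F.involution b) := by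
  induction a using homogeneous_induction (F := F) with
  | add a a' ha ha' => simp only [map_add, LinearMap.add_apply, ha, ha', neg_add]
  | hom p a ha =>
    induction b using homogeneous_induction (F := F) with
    | add b b' hb hb' => simp only [map_add, hb, hb', neg_add]
    | hom q b hb =>
      rw [F.involution_of_mem ha, F.involution_of_mem hb]
      by_cases h : p + q = 0
      · simp [F.form_odd ha hb h]
      · have : sgn p = -sgn q := by
          rw [neg_sgn]; congr 1; clear ha hb; revert p q; decide
        simp [this]

theorem involution_mul (a b : A) :
    F.involution (a * b) = F.involution a * F.involution b := by
  induction a using homogeneous_induction (F := F) with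
  | add a a' ha ha' => simp only [map_add, add_mul, ha, ha']
  | hom p a ha =>
    induction b using homogeneous_induction (F := F) with
    | add b b' hb hb' => simp only [map_add, mul_add, hb, hb']
    | hom q b hb =>
      rw [F.involution_of_mem ha, F.involution_of_mem hb, F.involution_of_mem (F.mul_mem ha hb),
        sgn_add, smul_mul_smul_comm]

theorem d_mul' (a b : A) : F.d (a * b) = F.d a * b + F.involution a * F.d b := by
  induction a using homogeneous_induction (F := F) with
  | add a a' ha ha' => simp only [map_add, add_mul, ha, ha']; abel
  | hom p a ha => rw [F.d_mul b ha, F.involution_of_mem ha, smul_mul_assoc]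

theorem form_d' (a b : A) : F.form (F.d a) b = -F.form (F.involution a) (F.d b) := by
  induction a using homogeneous_induction (F := F) with
  | add a a' ha ha' => simp only [map_add, LinearMap.add_apply, ha, ha', neg_add]
  | hom p a ha =>
    have h := F.form_d b ha
    rw [F.involution_of_mem ha, map_smul, LinearMap.smul_apply, smul_eq_mul]
    linarith

theorem exists_homogeneous_basis [Module.Finite ℝ A] {L : Submodule ℝ A}
    (hL : L = (L ⊓ F.gr 0) ⊔ (L ⊓ F.gr 1)) :
    ∃ (r : ℕ) (par : Fin r → ZMod 2) (b : Module.Basis (Fin r) ℝ L),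
      ∀ α, (b α : A) ∈ F.gr (par α) := by
  set L0 := L ⊓ F.gr 0
  set L1 := L ⊓ F.gr 1
  let b0 := Module.finBasis ℝ L0
  let b1 := Module.finBasis ℝ L1
  let v : Fin (Module.finrank ℝ L0) ⊕ Fin (Module.finrank ℝ L1) → A :=
    Sum.elim (L0.subtype ∘ b0) (L1.subtype ∘ b1)
  have hs : ∀ (N : Submodule ℝ A) (b : Module.Basis (Fin (Module.finrank ℝ N)) ℝ N),
      Submodule.span ℝ (Set.range (N.subtype ∘ b)) = N := by
    intro N b
    rw [Set.range_comp, Submodule.span_image, b.span_eq, Submodule.map_top, Submodule.range_subtype]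
  have hv : LinearIndependent ℝ v := by
    refine LinearIndependent.sum_type (b0.linearIndependent.map' _ L0.ker_subtype)
      (b1.linearIndependent.map' _ L1.ker_subtype) ?_
    rw [hs, hs]
    exact (F.isCompl_gr.disjoint).mono inf_le_right inf_le_right
  have hspan : Submodule.span ℝ (Set.range v) = L := by
    rw [Set.Sum.elim_range, Submodule.span_union, hs, hs, ← hL]
  let b : Module.Basis _ ℝ L := (Module.Basis.span hv).map (LinearEquiv.ofEq _ _ hspan)
  refine ⟨_, fun α => Sum.elim (fun _ => 0) (fun _ => 1) (finSumFinEquiv.symm α),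
    b.reindex finSumFinEquiv, fun α => ?_⟩
  have hb : ∀ i, (b i : A) = v i := by
    intro i
    simp only [b, Module.Basis.map_apply, LinearEquiv.coe_ofEq_apply]
    exact congrArg Subtype.val (Module.Basis.span_apply hv i)
  rw [Module.Basis.reindex_apply, hb]
  dsimp only
  rcases finSumFinEquiv.symm α with i | i
  · exact (b0 i).2.2
  · exact (b1 i).2.2

/-! ### Existence of gauge conditions -/

theorem form_d_eq_zero {a b : A} (hb : F.d b = 0) : F.form (F.d a) b = 0 := by
  rw [form_d', hb, map_zero, neg_zero]

theorem mem_range_d_iff {a : A} : a ∈ LinearMap.range F.d ↔ F.d a = 0 :=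
  ⟨by rintro ⟨b, rfl⟩; exact F.d_d b, fun h => F.contractible a h⟩

/-- The form embeds an isotropic subspace into its annihilator. -/
theorem finrank_isotropic_le [Module.Finite ℝ A] {L : Submodule ℝ A} (hL : F.IsIsotropic L) :
    2 * Module.finrank ℝ L ≤ Module.finrank ℝ A := by
  have h : Module.finrank ℝ (L.map F.form) ≤ Module.finrank ℝ L.dualAnnihilator := by
    refine Submodule.finrank_mono ?_
    rintro _ ⟨a, ha, rfl⟩
    exact (Submodule.mem_dualAnnihilator _).2 fun b hb => hL.2 a ha b hb
  rw [← (Submodule.equivMapOfInjective F.form F.form_nondegenerate.1 L).finrank_eq] at h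
  have := Subspace.finrank_add_finrank_dualAnnihilator_eq L
  omega

/-- Since the cohomology vanishes, `d A` has half the dimension of `A`, hence so does a complement,
which is then maximally isotropic as soon as it is isotropic. -/
theorem isMaxIsotropic_of_isCompl [Module.Finite ℝ A] {L : Submodule ℝ A} (hL : F.IsIsotropic L)
    (hc : IsCompl L (LinearMap.range F.d)) : F.IsMaxIsotropic L := by
  refine ⟨hL, fun L' hL' => ?_⟩
  have h1 := F.finrank_isotropic_le hL'
  have h2 := Submodule.finrank_add_eq_of_isCompl hc
  have h3 := LinearMap.finrank_range_add_finrank_ker F.d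
  have h4 : LinearMap.ker F.d = LinearMap.range F.d := by
    ext a; rw [LinearMap.mem_ker, mem_range_d_iff]
  rw [h4] at h3
  omega

/-- Choose a complement `L0` of the even part of `d A` in the even part of `A`; the odd part of a
gauge is then the orthogonal complement of `L0` in the odd part of `A`. -/
theorem exists_isGauge [Module.Finite ℝ A] : ∃ L : Submodule ℝ A, F.IsGauge L := by
  set R := LinearMap.range F.d with hR
  set R0 := R ⊓ F.gr 0 with hR0
  obtain ⟨C, hC⟩ := Submodule.exists_isCompl R0
  set L0 := C ⊓ F.gr 0 with hL0
  have hsup0 : R0 ⊔ L0 = F.gr 0 := by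
    rw [hL0, ← sup_inf_assoc_of_le C (inf_le_right : R0 ≤ F.gr 0), hC.sup_eq_top, top_inf_eq]
  let L1 : Submodule ℝ A :=
    { carrier := {a | a ∈ F.gr 1 ∧ ∀ x ∈ L0, F.form x a = 0}
      add_mem' := fun ha hb => ⟨Submodule.add_mem _ ha.1 hb.1, fun x hx => by
        rw [map_add, ha.2 x hx, hb.2 x hx, add_zero]⟩
      zero_mem' := ⟨Submodule.zero_mem _, by simp⟩
      smul_mem' := fun c a ha => ⟨Submodule.smul_mem _ c ha.1, fun x hx => by
        rw [map_smul, ha.2 x hx, smul_zero]⟩ }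
  -- the odd part of `d A` is the orthogonal complement of its even part
  have hR1 : ∀ a ∈ F.gr 1, (∀ y ∈ R0, F.form y a = 0) → a ∈ R := by
    intro a ha h
    rw [hR, mem_range_d_iff]
    refine F.form_left_ext fun x => ?_
    rw [map_zero, LinearMap.zero_apply, form_comm]
    induction x using homogeneous_induction (F := F) with
    | add x y hx hy => rw [map_add, LinearMap.add_apply, hx, hy, add_zero]
    | hom p x hx =>
      rcases zmod_two_cases p with rfl | rfl
      · exact F.form_odd hx (F.d_mem ha) (by decide)
      · have h0 := F.form_d a hx
        rw [h _ ⟨⟨x, rfl⟩, F.d_mem hx⟩] at h0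
        simpa using h0
  have hdisj1 : ∀ a ∈ L1, a ∈ R → a = 0 := by
    intro a ha haR
    refine F.form_left_ext fun x => ?_
    rw [map_zero, LinearMap.zero_apply, form_comm]
    induction x using homogeneous_induction (F := F) with
    | add x y hx hy => rw [map_add, LinearMap.add_apply, hx, hy, add_zero]
    | hom p x hx =>
      rcases zmod_two_cases p with rfl | rfl
      · rw [← hsup0] at hx
        obtain ⟨y, hy, z, hz, rfl⟩ := Submodule.mem_sup.1 hx
        obtain ⟨w, rfl⟩ := hy.1
        rw [map_add, LinearMap.add_apply, ha.2 z hz,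
          F.form_d_eq_zero ((F.mem_range_d_iff).1 haR), add_zero]
      · exact F.form_odd hx ha.1 (by decide)
  have hspan1 : ∀ a ∈ F.gr 1, a ∈ L1 ⊔ R := by
    intro a ha
    -- the functional equal to `⟨-, a⟩` on the even part of `d A` and zero on `L0` and on odd
    -- elements
    let π : A →ₗ[ℝ] A := LinearMap.ofIsCompl F.isCompl_gr (F.gr 0).subtype 0
    let π' : A →ₗ[ℝ] A := LinearMap.ofIsCompl hC R0.subtype 0
    obtain ⟨l, hl⟩ := F.form_nondegenerate.2 (F.form a ∘ₗ π' ∘ₗ π)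
    have hl' : ∀ x, F.form l x = F.form a (π' (π x)) := fun x => LinearMap.congr_fun hl x
    have hπ0 : ∀ x ∈ F.gr 0, π x = x := fun x hx =>
      LinearMap.ofIsCompl_apply_left F.isCompl_gr (⟨x, hx⟩ : F.gr 0)
        (φ := (F.gr 0).subtype) (ψ := 0)
    have hπ1 : ∀ x ∈ F.gr 1, π x = 0 := fun x hx =>
      LinearMap.ofIsCompl_apply_right F.isCompl_gr (⟨x, hx⟩ : F.gr 1)
        (φ := (F.gr 0).subtype) (ψ := 0)
    have hπ'0 : ∀ x ∈ R0, π' x = x := fun x hx =>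
      LinearMap.ofIsCompl_apply_left hC (⟨x, hx⟩ : R0) (φ := R0.subtype) (ψ := 0)
    have hπ'1 : ∀ x ∈ C, π' x = 0 := fun x hx =>
      LinearMap.ofIsCompl_apply_right hC (⟨x, hx⟩ : C) (φ := R0.subtype) (ψ := 0)
    have hl1 : l ∈ F.gr 1 := by
      obtain ⟨b, hb, c, hc, hbc⟩ := F.exists_homogeneous_add l
      have hb0 : b = 0 := by
        refine F.form_left_ext fun x => ?_
        rw [map_zero, LinearMap.zero_apply]
        induction x using homogeneous_induction (F := F) with
        | add x y hx hy => rw [map_add, hx, hy, add_zero]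
        | hom p x hx =>
          rcases zmod_two_cases p with rfl | rfl
          · exact F.form_odd hb hx (by decide)
          · have h0 := hl' x
            rw [hπ1 x hx, map_zero, map_zero, ← hbc, map_add, LinearMap.add_apply,
              F.form_odd hc hx (by decide), add_zero] at h0
            exact h0
      rw [← hbc, hb0, zero_add]; exact hc
    have hlL : l ∈ L1 := ⟨hl1, fun x hx => by
      rw [form_comm, hl', hπ0 x hx.2, hπ'1 x hx.1, map_zero]⟩
    have hr : a - l ∈ R := hR1 _ (Submodule.sub_mem _ ha hl1) fun y hy => by
      rw [form_comm, map_sub, LinearMap.sub_apply, hl', hπ0 y hy.2, hπ'0 y hy, sub_self]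
    rw [← add_sub_cancel l a]
    exact Submodule.add_mem_sup hlL hr
  have hgr0 : ∀ {x}, x ∈ L0 → x ∈ F.gr 0 := fun hx => hx.2
  have hgraded : L0 ⊔ L1 = ((L0 ⊔ L1) ⊓ F.gr 0) ⊔ ((L0 ⊔ L1) ⊓ F.gr 1) :=
    le_antisymm (sup_le_sup (le_inf le_sup_left fun x hx => hx.2)
      (le_inf le_sup_right fun x hx => hx.1)) (sup_le inf_le_left inf_le_left)
  have hiso : F.IsIsotropic (L0 ⊔ L1) := by
    refine ⟨hgraded, fun a ha b hb => ?_⟩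
    obtain ⟨a0, ha0, a1, ha1, rfl⟩ := Submodule.mem_sup.1 ha
    obtain ⟨b0, hb0, b1, hb1, rfl⟩ := Submodule.mem_sup.1 hb
    simp only [map_add, LinearMap.add_apply]
    rw [F.form_odd ha0.2 hb0.2 (by decide), F.form_odd ha1.1 hb1.1 (by decide), hb1.2 a0 ha0,
      F.form_comm a1 b0, ha1.2 b0 hb0]
    simp
  have hcompl : IsCompl (L0 ⊔ L1) R := by
    refine ⟨Submodule.disjoint_def.2 fun x hx hxR => ?_, codisjoint_iff.2 (eq_top_iff.2 ?_)⟩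
    · obtain ⟨a, ha, b, hb, rfl⟩ := Submodule.mem_sup.1 hx
      rw [hR, mem_range_d_iff, map_add] at hxR
      have hda : F.d a = 0 := by
        refine Submodule.disjoint_def.1 F.isCompl_gr.disjoint _ ?_ (F.d_mem ha.2)
        rw [eq_neg_of_add_eq_zero_left hxR]
        exact Submodule.neg_mem _ (F.d_mem hb.1)
      have hdb : F.d b = 0 := by rwa [hda, zero_add] at hxR
      have ha0 : a = 0 := Submodule.disjoint_def.1 hC.disjoint a
        ⟨(F.mem_range_d_iff).2 hda, ha.2⟩ ha.1
      rw [ha0, hdisj1 b hb ((F.mem_range_d_iff).2 hdb), add_zero]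
    · rw [← F.isCompl_gr.sup_eq_top]
      refine sup_le ?_ fun a ha => ?_
      · rw [← hsup0]
        exact sup_le (inf_le_left.trans le_sup_right) (le_sup_left.trans le_sup_left)
      · exact sup_le_sup_right le_sup_right R (hspan1 a ha)
  exact ⟨L0 ⊔ L1, F.isMaxIsotropic_of_isCompl hiso hcompl, hcompl⟩

end ContractibleDGFrobenius


namespace ContractibleDGFrobenius

variable {A : Type*} [NonUnitalRing A] [Module ℝ A] [IsScalarTower ℝ A A] [SMulCommClass ℝ A A]
variable (F : ContractibleDGFrobenius A)

/-! ### The contracting homotopy of a gauge condition -/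

/-- `s` is an odd contracting homotopy of `A` with image in `L`. -/
structure IsHomotopy (L : Submodule ℝ A) (s : A →ₗ[ℝ] A) : Prop where
  mem : ∀ a, s a ∈ L
  d_add : ∀ a, F.d (s a) + s (F.d a) = a
  odd : ∀ {p : ZMod 2} {a : A}, a ∈ F.gr p → s a ∈ F.gr (p + 1)

variable {F}

theorem involution_mem {L : Submodule ℝ A} (hL : F.IsIsotropic L) {a : A} (ha : a ∈ L) :
    F.involution a ∈ L := by
  rw [hL.1] at ha
  obtain ⟨b, hb, c, hc, rfl⟩ := Submodule.mem_sup.1 ha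
  rw [map_add, F.involution_of_mem hb.2, F.involution_of_mem hc.2]
  exact Submodule.add_mem _ (Submodule.smul_mem _ _ hb.1) (Submodule.smul_mem _ _ hc.1)

/-- With respect to `A = L ⊕ d A` the differential is an isomorphism of `L` with `d A`; the homotopy
is its inverse on `d A` and zero on `L`. -/
theorem IsGauge.exists_homotopy {L : Submodule ℝ A} (hL : F.IsGauge L) :
    ∃ s, F.IsHomotopy L s := by
  obtain ⟨⟨hiso, -⟩, hc⟩ := hL
  set R := LinearMap.range F.d with hR
  let projL : A →ₗ[ℝ] A := LinearMap.ofIsCompl hc L.subtype 0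
  let projR : A →ₗ[ℝ] R := LinearMap.ofIsCompl hc 0 LinearMap.id
  have hL1 : ∀ x ∈ L, projL x = x := fun x hx =>
    LinearMap.ofIsCompl_apply_left hc (⟨x, hx⟩ : L) (φ := L.subtype) (ψ := 0)
  have hL2 : ∀ x ∈ R, projL x = 0 := fun x hx =>
    LinearMap.ofIsCompl_apply_right hc (⟨x, hx⟩ : R) (φ := L.subtype) (ψ := 0)
  have hR1 : ∀ x ∈ L, projR x = 0 := fun x hx =>
    LinearMap.ofIsCompl_apply_left hc (⟨x, hx⟩ : L) (φ := 0) (ψ := LinearMap.id)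
  have hR2 : ∀ x (hx : x ∈ R), projR x = ⟨x, hx⟩ := fun x hx =>
    LinearMap.ofIsCompl_apply_right hc (⟨x, hx⟩ : R) (φ := 0) (ψ := LinearMap.id)
  have hdec : ∀ x, ∃ l ∈ L, ∃ r ∈ R, l + r = x := fun x =>
    Submodule.mem_sup.1 (hc.sup_eq_top ▸ Submodule.mem_top)
  have hmemL : ∀ x, projL x ∈ L := by
    intro x
    obtain ⟨l, hl, r, hr, rfl⟩ := hdec x
    rwa [map_add, hL1 l hl, hL2 r hr, add_zero]
  have hsub : ∀ x, projL x + projR x = x := by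
    intro x
    obtain ⟨l, hl, r, hr, rfl⟩ := hdec x
    rw [map_add, map_add, hL1 l hl, hL2 r hr, hR1 l hl, hR2 r hr, add_zero, zero_add]
  have hdL : ∀ x, F.d (projL x) = F.d x := by
    intro x
    conv_rhs => rw [← hsub x]
    rw [map_add, F.mem_range_d_iff.1 (projR x).2, add_zero]
  obtain ⟨t, ht⟩ := F.d.rangeRestrict.exists_rightInverse_of_surjective F.d.range_rangeRestrict
  have ht' : ∀ x : R, F.d (t x) = x := fun x => congrArg Subtype.val (LinearMap.congr_fun ht x)
  let s : A →ₗ[ℝ] A := projL ∘ₗ t ∘ₗ projR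
  have hsL : ∀ a, s a ∈ L := fun a => hmemL _
  have hds : ∀ a, F.d (s a) = projR a := fun a => by
    simp only [s, LinearMap.comp_apply]
    rw [hdL, ht']
  have hsd : ∀ a, s (F.d a) = projL a := fun a => by
    have h : t (projR (F.d a)) - a ∈ R := by
      refine F.mem_range_d_iff.2 ?_
      rw [map_sub, ht', hR2 _ ⟨a, rfl⟩, sub_self]
    have h' := hL2 _ h
    rw [map_sub] at h'
    exact sub_eq_zero.1 h'
  have hs : ∀ a, F.d (s a) + s (F.d a) = a := fun a => by rw [hds, hsd, add_comm, hsub]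
  -- a homotopy with image in `L` is unique, hence it anticommutes with the parity involution
  have hanti : ∀ a, F.involution (s (F.involution a)) = -s a := by
    have hu1 : ∀ a, s (F.d a) + F.involution (s (F.involution (F.d a))) = 0 := by
      intro a
      refine Submodule.disjoint_def.1 hc.disjoint _
        (Submodule.add_mem _ (hsL _) (involution_mem hiso (hsL _))) (F.mem_range_d_iff.2 ?_)
      rw [map_add, d_involution, hds, hds,
        hR2 _ ⟨a, rfl⟩,
        hR2 _ (F.mem_range_d_iff.2 <| by rw [d_involution, F.d_d, map_zero, neg_zero])]
      simp
    intro a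
    rw [← add_eq_zero_iff_eq_neg, add_comm]
    refine Submodule.disjoint_def.1 hc.disjoint _
      (Submodule.add_mem _ (hsL _) (involution_mem hiso (hsL _))) (F.mem_range_d_iff.2 ?_)
    rw [map_add, d_involution]
    have e1 := hs a
    have e2 := congrArg F.involution (hs (F.involution a))
    have e3 := hu1 a
    rw [map_add, involution_involution, d_involution, map_neg, map_neg] at e2
    have : F.d (s a) + -F.involution (F.d (s (F.involution a))) =
        (F.d (s a) + s (F.d a)) - (F.involution (F.d (s (F.involution a))) +
          -F.involution (s (F.involution (F.d a)))) -
        (s (F.d a) + F.involution (s (F.involution (F.d a)))) := by abel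
    rw [this, e1, e2, e3]
    simp
  refine ⟨s, hsL, hs, fun {p a} ha => F.mem_gr_of_involution ?_⟩
  have h := hanti a
  rw [F.involution_of_mem ha, map_smul, map_smul] at h
  calc F.involution (s a) = (sgn p * sgn p) • F.involution (s a) := by simp
    _ = sgn (p + 1) • s a := by rw [mul_smul, h, sgn_add]; simp

/-- The homotopy is self-adjoint, up to sign, because its image is isotropic. -/
theorem IsHomotopy.form_comm {L : Submodule ℝ A} (hL : F.IsIsotropic L) {s : A →ₗ[ℝ] A}
    (hs : F.IsHomotopy L s) {p : ZMod 2} {a : A} (ha : a ∈ F.gr p) (b : A) :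
    F.form (s a) b = sgn p * F.form a (s b) := by
  have h1 : F.form (s a) b = F.form (s a) (F.d (s b)) := by
    conv_lhs => rw [← hs.d_add b]
    rw [map_add, hL.2 _ (hs.mem a) _ (hs.mem (F.d b)), add_zero]
  have h2 : F.form a (s b) = F.form (F.d (s a)) (s b) := by
    conv_lhs => rw [← hs.d_add a]
    rw [map_add, LinearMap.add_apply, hL.2 _ (hs.mem (F.d a)) _ (hs.mem b), add_zero]
  have h3 := F.form_d (s b) (hs.odd ha)
  rw [h1, h2]
  rw [sgn_add, sgn_one] at h3
  linear_combination -sgn p * h3 + (- F.form (s a) (F.d (s b))) * sgn_mul_self p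

/-! ### The trivial extension of `A` carrying the trace -/

variable (F)

/-- The right action of `A` on `ℝ ⊕ A ⊕ ℝ`, where the last summand receives the scalar product:
`(x, c, y) · a = (0, x a + c a, ⟨c, a⟩)`.  The last coordinate of `1 · a_1 ⋯ a_N` is
`⟨a_1 ⋯ a_{N-1}, a_N⟩`. -/
def rmul : A →ₗ[ℝ] (ℝ × A × ℝ) →ₗ[ℝ] (ℝ × A × ℝ) :=
  LinearMap.mk₂ ℝ (fun a c => (0, c.1 • a + c.2.1 * a, F.form c.2.1 a))
    (fun a b c => by simp [mul_add]; abel)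
    (fun r a c => by simp [mul_smul_comm, smul_comm r])
    (fun a c c' => by simp [add_mul, add_smul]; abel)
    (fun r a c => by simp [smul_mul_assoc, mul_smul])

theorem rmul_apply (a : A) (c : ℝ × A × ℝ) :
    F.rmul a c = (0, c.1 • a + c.2.1 * a, F.form c.2.1 a) := rfl

/-- The parity involution of `ℝ ⊕ A ⊕ ℝ`; the last summand is odd. -/
def extInvolution : (ℝ × A × ℝ) →ₗ[ℝ] (ℝ × A × ℝ) :=
  LinearMap.prodMap LinearMap.id (LinearMap.prodMap F.involution (-LinearMap.id))

theorem extInvolution_apply (c : ℝ × A × ℝ) :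
    F.extInvolution c = (c.1, F.involution c.2.1, -c.2.2) := rfl

@[simp] theorem extInvolution_extInvolution (c : ℝ × A × ℝ) :
    F.extInvolution (F.extInvolution c) = c := by
  simp [extInvolution_apply]

/-- The differential of `A` extended by zero to `ℝ ⊕ A ⊕ ℝ`. -/
def extD : (ℝ × A × ℝ) →ₗ[ℝ] (ℝ × A × ℝ) :=
  LinearMap.prodMap 0 (LinearMap.prodMap F.d 0)

theorem extD_apply (c : ℝ × A × ℝ) : F.extD c = (0, F.d c.2.1, 0) := rfl

theorem rmul_rmul {p q : ZMod 2} {a b : A} (ha : a ∈ F.gr p) (hb : b ∈ F.gr q) (c : ℝ × A × ℝ) :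
    F.rmul b (F.rmul a c) = sgn (p * q) • F.rmul a (F.rmul b c) := by
  simp only [rmul_apply, Prod.smul_mk, zero_smul, zero_add, smul_eq_mul, add_mul,
    smul_mul_assoc, map_add, map_smul, LinearMap.add_apply, LinearMap.smul_apply, F.form_mul,
    mul_assoc]
  rw [F.mul_comm ha hb, F.form_symm ha hb]
  simp only [mul_smul_comm, map_smul, smul_eq_mul, smul_add, smul_comm (sgn (p * q)) c.1]
  refine Prod.ext (mul_zero _).symm (Prod.ext ?_ ?_)
  · rfl
  · simp only []; ring

theorem extInvolution_rmul {p : ZMod 2} {a : A} (ha : a ∈ F.gr p) (c : ℝ × A × ℝ) :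
    F.extInvolution (F.rmul a c) = sgn p • F.rmul a (F.extInvolution c) := by
  simp only [rmul_apply, extInvolution_apply, Prod.smul_mk, smul_eq_mul, map_add,
    map_smul, involution_mul, F.involution_of_mem ha, mul_smul_comm, smul_add, form_involution,
    smul_comm (sgn p) c.1]
  refine Prod.ext (mul_zero _).symm (Prod.ext ?_ ?_)
  · rfl
  · simp only [mul_neg, ← mul_assoc, sgn_mul_self, one_mul]

theorem extD_rmul (a : A) (c : ℝ × A × ℝ) :
    F.extD (F.rmul a c) = F.rmul a (F.extD c) + F.rmul (F.d a) (F.extInvolution c) := by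
  simp only [rmul_apply, extD_apply, extInvolution_apply, map_add, map_smul, d_mul', zero_smul,
    zero_add, Prod.mk_add_mk]
  refine Prod.ext rfl (Prod.ext ?_ ?_)
  · simp only []; abel
  · simp only [form_d']; ring

theorem extInvolution_extD (c : ℝ × A × ℝ) :
    F.extInvolution (F.extD c) = -F.extD (F.extInvolution c) := by
  simp [extD_apply, extInvolution_apply, d_involution]

end ContractibleDGFrobenius


theorem sum_Iio_succ {N : ℕ} {R : Type*} [AddCommMonoid R] (t : Fin N) (g : Fin (N + 1) → R) :
    ∑ s ∈ Finset.Iio t.succ, g s = g 0 + ∑ s ∈ Finset.Iio t, g s.succ := by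
  have h : ∀ {M : ℕ} (t : Fin M) (f : Fin M → R),
      ∑ s ∈ Finset.Iio t, f s = ∑ s, if s < t then f s else 0 := by
    intro M t f
    rw [← Finset.sum_filter]
    congr 1
    ext; simp
  rw [h, h, Fin.sum_univ_succ]
  simp

theorem sum_Iio_zero {N : ℕ} {R : Type*} [AddCommMonoid R] (g : Fin (N + 1) → R) :
    ∑ s ∈ Finset.Iio (0 : Fin (N + 1)), g s = 0 := by
  rw [Finset.sum_eq_zero]
  intro s hs
  simp at hs

namespace ContractibleDGFrobenius

variable {A : Type*} [NonUnitalRing A] [Module ℝ A] [IsScalarTower ℝ A A] [SMulCommClass ℝ A A]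

/-- A finite family of homogeneous elements of `A` together with their parities. -/
structure Frame (F : ContractibleDGFrobenius A) where
  /-- the number of elements -/
  r : ℕ
  /-- the parities -/
  par : Fin r → ZMod 2
  /-- the elements -/
  e : Fin r → A
  mem : ∀ α, e α ∈ F.gr (par α)

/-- The power `γ^p` of the parity involution of `ℝ ⊕ A ⊕ ℝ`. -/
def extPow (F : ContractibleDGFrobenius A) (p : ZMod 2) : (ℝ × A × ℝ) →ₗ[ℝ] (ℝ × A × ℝ) :=
  if p = 0 then LinearMap.id else F.extInvolution

/-- Homogeneous elements of `ℝ ⊕ A ⊕ ℝ` of parity `q`. -/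
def ExtHom (F : ContractibleDGFrobenius A) (q : ZMod 2) (c : ℝ × A × ℝ) : Prop :=
  F.extInvolution c = sgn q • c

section Ext

variable {F : ContractibleDGFrobenius A}

theorem ExtHom.extPow {q : ZMod 2} {c : ℝ × A × ℝ} (hc : F.ExtHom q c) (p : ZMod 2) :
    F.extPow p c = sgn (p * q) • c := by
  rcases zmod_two_cases p with rfl | rfl
  · simp [ContractibleDGFrobenius.extPow]
  · simpa [ContractibleDGFrobenius.extPow, ExtHom] using hc

theorem ExtHom.rmul {q p : ZMod 2} {c : ℝ × A × ℝ} (hc : F.ExtHom q c) {a : A}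
    (ha : a ∈ F.gr p) : F.ExtHom (q + p) (F.rmul a c) := by
  rw [ExtHom, F.extInvolution_rmul ha, hc, map_smul, smul_smul, add_comm, sgn_add]

theorem ExtHom.extD {q : ZMod 2} {c : ℝ × A × ℝ} (hc : F.ExtHom q c) :
    F.ExtHom (q + 1) (F.extD c) := by
  rw [ExtHom, F.extInvolution_extD, hc, map_smul, sgn_add, sgn_one]
  simp

theorem extHom_one : F.ExtHom 0 ((1, 0, 0) : ℝ × A × ℝ) := by
  simp [ExtHom, extInvolution_apply]

theorem extHom_mk {p : ZMod 2} {a : A} (ha : a ∈ F.gr p) : F.ExtHom p ((0, a, 0) : ℝ × A × ℝ) := by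
  simp [ExtHom, extInvolution_apply, F.involution_of_mem ha]

theorem ext_linearMap_ext {N : Type*} [AddCommGroup N] [Module ℝ N]
    {f g : (ℝ × A × ℝ) →ₗ[ℝ] N} (h : ∀ q c, F.ExtHom q c → f c = g c) : f = g := by
  refine LinearMap.ext fun c => ?_
  have h0 := h 0 (c + F.extInvolution c) (by
    simp [ExtHom, add_comm])
  have h1 := h 1 (c - F.extInvolution c) (by
    simp [ExtHom])
  have hc : c = (1 / 2 : ℝ) • ((c + F.extInvolution c) + (c - F.extInvolution c)) := by
    rw [add_add_sub_cancel, ← two_smul ℝ c, smul_smul]; norm_num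
  rw [hc, map_smul f, map_smul g, map_add f (_ + _) (_ - _), map_add g (_ + _) (_ - _), h0, h1]

end Ext

namespace Frame

variable {F : ContractibleDGFrobenius A} (Θ : F.Frame) (n m : ℕ)

/-! ### The generic point of `A ⊗ V` and the map `Ψ` -/

/-- Superfunctions in the coordinates of `A ⊗ V` defined by a frame. -/
abbrev Fun : Type := SuperPoly (tensorPar Θ.par n m)

/-- Multiplication by `∑_α e_α ⊗ z_{(α, i)}`, the value of the `i`-th coordinate of `V` at the
generic point of `A ⊗ V`, on functions of an element `c` of `ℝ ⊕ A ⊕ ℝ`. The signs and the power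
of the parity involution come from moving `z_{(α, i)}` to the left past `e_α` and `c`. -/
def zeta (i : VIdx n m) : Module.End ℝ ((ℝ × A × ℝ) →ₗ[ℝ] Θ.Fun n m) where
  toFun T := ∑ α, sgn ((Θ.par α + vPar n m i) * (1 + Θ.par α)) •
    (LinearMap.mulLeft ℝ (coord (tensorPar Θ.par n m) (α, i)) ∘ₗ T ∘ₗ F.rmul (Θ.e α) ∘ₗ
      F.extPow (Θ.par α + vPar n m i))
  map_add' T T' := by
    simp only [LinearMap.comp_add, LinearMap.add_comp, smul_add, Finset.sum_add_distrib]
  map_smul' a T := by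
    simp only [LinearMap.comp_smul, LinearMap.smul_comp, RingHom.id_apply, Finset.smul_sum]
    exact Finset.sum_congr rfl fun α _ => smul_comm _ _ _

variable {n m}

theorem zeta_apply (i : VIdx n m) (T : (ℝ × A × ℝ) →ₗ[ℝ] Θ.Fun n m) {q : ZMod 2}
    {c : ℝ × A × ℝ} (hc : F.ExtHom q c) : Θ.zeta n m i T c =
      ∑ α, sgn ((Θ.par α + vPar n m i) * (1 + Θ.par α + q)) •
        (coord (tensorPar Θ.par n m) (α, i) * T (F.rmul (Θ.e α) c)) := by
  simp only [zeta, LinearMap.coe_mk, AddHom.coe_mk, LinearMap.sum_apply, LinearMap.smul_apply,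
    LinearMap.comp_apply, LinearMap.mulLeft_apply, hc.extPow, map_smul, smul_smul,
    ← sgn_add, ← mul_add]

theorem zeta_mul_zeta (i j : VIdx n m) : Θ.zeta n m i * Θ.zeta n m j =
    sgn (vPar n m i * vPar n m j) • (Θ.zeta n m j * Θ.zeta n m i) := by
  have hs : ∀ a b i j q : ZMod 2, (a + i) * (1 + a + q) + (b + j) * (1 + b + (q + a)) +
      (a * b + (a + i) * (b + j)) =
        i * j + (b + j) * (1 + b + q) + (a + i) * (1 + a + (q + b)) := by
    decide
  refine LinearMap.ext fun T => ext_linearMap_ext (F := F) fun q c hc => ?_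
  simp only [Module.End.mul_apply, LinearMap.smul_apply]
  rw [Θ.zeta_apply i _ hc, Θ.zeta_apply j _ hc]
  simp only [Θ.zeta_apply _ _ (hc.rmul (Θ.mem _)), Finset.mul_sum, Finset.smul_sum,
    mul_smul_comm, smul_smul, ← mul_assoc]
  rw [Finset.sum_comm]
  refine Finset.sum_congr rfl fun β _ => Finset.sum_congr rfl fun α _ => ?_
  rw [F.rmul_rmul (Θ.mem α) (Θ.mem β), map_smul, coord_mul_coord]
  simp only [smul_mul_assoc, mul_smul_comm, smul_smul, ← sgn_add]
  congr 2
  exact hs _ _ _ _ _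

variable (n m) in
/-- Evaluation of Hamiltonians at the generic point of `A ⊗ V`. -/
def evalHom : Ham n m →ₐ[ℝ] Module.End ℝ ((ℝ × A × ℝ) →ₗ[ℝ] Θ.Fun n m) :=
  lift (vPar n m) (Θ.zeta n m) Θ.zeta_mul_zeta

variable (n m) in
/-- The trace of `ℝ ⊕ A ⊕ ℝ`, its last coordinate, as a constant function. -/
def trace : (ℝ × A × ℝ) →ₗ[ℝ] Θ.Fun n m :=
  (LinearMap.toSpanSingleton ℝ (Θ.Fun n m) 1) ∘ₗ LinearMap.snd ℝ A ℝ ∘ₗ LinearMap.snd ℝ ℝ (A × ℝ)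

@[simp] theorem trace_apply (c : ℝ × A × ℝ) : Θ.trace n m c = c.2.2 • (1 : Θ.Fun n m) := rfl

variable (n m) in
/-- The function `c ↦ tr (c · h(Z))`, where `Z` is the generic point of `A ⊗ V`. -/
def evalTrace : Ham n m →ₗ[ℝ] (ℝ × A × ℝ) →ₗ[ℝ] Θ.Fun n m :=
  (LinearMap.applyₗ (Θ.trace n m)) ∘ₗ (Θ.evalHom n m).toLinearMap

theorem evalTrace_apply (h : Ham n m) : Θ.evalTrace n m h = Θ.evalHom n m h (Θ.trace n m) := rfl

@[simp] theorem evalTrace_one : Θ.evalTrace n m 1 = Θ.trace n m := by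
  rw [evalTrace_apply, map_one, Module.End.one_apply]

theorem evalTrace_mul (g h : Ham n m) :
    Θ.evalTrace n m (g * h) = Θ.evalHom n m g (Θ.evalTrace n m h) := by
  rw [evalTrace_apply, map_mul, Module.End.mul_apply, evalTrace_apply]

theorem evalHom_coord (i : VIdx n m) : Θ.evalHom n m (coord (vPar n m) i) = Θ.zeta n m i :=
  lift_coord _ _ _ _

theorem evalTrace_coord_mul (i : VIdx n m) (h : Ham n m) :
    Θ.evalTrace n m (coord (vPar n m) i * h) = Θ.zeta n m i (Θ.evalTrace n m h) := by
  rw [evalTrace_mul, evalHom_coord]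

variable (n m) in
/-- The map `Ψ`, as the trace of a Hamiltonian evaluated at the generic point of `A ⊗ V`. -/
def psiLinear : Ham n m →ₗ[ℝ] Θ.Fun n m :=
  LinearMap.applyₗ ((1, 0, 0) : ℝ × A × ℝ) ∘ₗ Θ.evalTrace n m

theorem psiLinear_apply (h : Ham n m) : Θ.psiLinear n m h = Θ.evalTrace n m h (1, 0, 0) := rfl

/-! #### Comparison with the definition by polarised tensors -/

/-- The trace of `c · a_1 ⋯ a_N`. -/
def wordTrace (F : ContractibleDGFrobenius A) (c : ℝ × A × ℝ) (l : List A) : ℝ :=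
  (l.foldl (fun c a => F.rmul a c) c).2.2

theorem wordTrace_eq_zero {q : ZMod 2} {c : ℝ × A × ℝ} (hc : F.ExtHom q c) (l : List (Fin Θ.r))
    (h : q + (l.map Θ.par).sum = 0) : wordTrace F c (l.map Θ.e) = 0 := by
  induction l generalizing q c with
  | nil =>
    have h1 := congrArg (fun c : ℝ × A × ℝ => c.2.2) hc
    simp only [extInvolution_apply, Prod.smul_snd] at h1
    simp only [List.map_nil, List.sum_nil, add_zero] at h
    rw [h, sgn_zero, one_smul] at h1
    simp only [wordTrace, List.map_nil, List.foldl_nil]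
    linarith
  | cons α l ih =>
    exact ih (hc.rmul (Θ.mem α)) (by rw [← h, List.map_cons, List.sum_cons, add_assoc])

theorem wordTrace_mk (c : A) (y : ℝ) {l : List A} (hl : l ≠ []) :
    wordTrace F (0, c, y) l = F.mTildeAux c l := by
  induction l generalizing c y with
  | nil => exact absurd rfl hl
  | cons a l ih =>
    have h : wordTrace F (0, c, y) (a :: l) = wordTrace F (0, c * a, F.form c a) l := by
      simp [wordTrace, rmul_apply]
    rw [h]
    cases l with
    | nil => simp [wordTrace, mTildeAux]
    | cons b l => rw [ih _ _ (by simp), mTildeAux]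

theorem wordTrace_one (l : List A) : wordTrace F (1, 0, 0) l = F.mTilde l := by
  cases l with
  | nil => simp [wordTrace, mTilde]
  | cons a l =>
    have h : wordTrace F (1, 0, 0) (a :: l) = wordTrace F (0, a, 0) l := by
      simp [wordTrace, rmul_apply]
    rw [h, mTilde]
    cases l with
    | nil => simp [wordTrace, mTildeAux]
    | cons b l => exact wordTrace_mk _ _ (by simp)

theorem evalTrace_monomial {N : ℕ} (w : Fin N → VIdx n m) {q : ZMod 2} {c : ℝ × A × ℝ}
    (hc : F.ExtHom q c) : Θ.evalTrace n m (monomial (vPar n m) (List.ofFn w)) c =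
      ∑ α : Fin N → Fin Θ.r,
        (sgn (∑ t : Fin N, ∑ s ∈ Finset.Iio t,
            (Θ.par (α s) * Θ.par (α t) + vPar n m (w s) * Θ.par (α t)))
          * wordTrace F c (List.ofFn fun s => Θ.e (α s))) •
          monomial (tensorPar Θ.par n m) (List.ofFn fun s => (α s, w s)) := by
  induction N generalizing q c with
  | zero => simp [wordTrace]
  | succ N ih =>
    rw [List.ofFn_succ, monomial_cons, evalTrace_coord_mul, Θ.zeta_apply _ _ hc,
      ← (Fin.consEquiv fun _ : Fin (N + 1) => Fin Θ.r).sum_comp, Fintype.sum_prod_type]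
    refine Finset.sum_congr rfl fun α _ => ?_
    rw [ih _ (hc.rmul (Θ.mem α)), Finset.mul_sum, Finset.smul_sum]
    refine Finset.sum_congr rfl fun β _ => ?_
    simp only [Fin.consEquiv_apply, Fin.sum_univ_succ, sum_Iio_zero, sum_Iio_succ, Fin.cons_zero,
      Fin.cons_succ, zero_add, List.ofFn_succ, monomial_cons, mul_smul_comm, smul_smul]
    congr 1
    have hw : wordTrace F c (Θ.e α :: List.ofFn fun s => Θ.e (β s)) =
        wordTrace F (F.rmul (Θ.e α) c) (List.ofFn fun s => Θ.e (β s)) := rfl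
    rw [hw, ← mul_assoc]
    have hl : (List.ofFn fun s => Θ.e (β s)) = (List.ofFn β).map Θ.e := by
      rw [List.map_ofFn]; rfl
    have hsum : ((List.ofFn β).map Θ.par).sum = ∑ t, Θ.par (β t) := by
      rw [List.map_ofFn, List.sum_ofFn]; rfl
    by_cases h0 : q + Θ.par α + ((List.ofFn β).map Θ.par).sum = 0
    · rw [hl, Θ.wordTrace_eq_zero (hc.rmul (Θ.mem α)) _ h0, mul_zero, mul_zero]
    · congr 1
      have h1 := eq_one_of_ne_zero h0
      rw [hsum] at h1
      simp only [Finset.sum_add_distrib, ← Finset.mul_sum]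
      rw [← sgn_add]
      congr 1
      have hs : ∀ a i q S x y : ZMod 2, q + a + S = 1 →
          (a + i) * (1 + a + q) + (x + y) = (a * S + i * S) + (x + y) := by decide
      rw [hs _ _ _ _ _ _ h1]

theorem psiWord_eq {N : ℕ} (w : Fin N → VIdx n m) : F.psiWord Θ.par Θ.e n m w =
    Θ.psiLinear n m (monomial (vPar n m) (List.ofFn w)) := by
  rw [psiLinear_apply, Θ.evalTrace_monomial w extHom_one, psiWord]
  simp only [wordTrace_one]

theorem psiDegree_eq (N : ℕ) (h : Ham n m) : F.psiDegree Θ.par Θ.e n m N h =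
    Θ.psiLinear n m ((N.factorial : ℝ)⁻¹ • ∑ w : Fin N → VIdx n m,
      taylorCoeff (vPar n m) (List.ofFn w) h • monomial (vPar n m) (List.ofFn w)) := by
  simp only [psiDegree, psiWord_eq, map_smul, map_sum]

theorem psiDegree_hasFiniteSupport (h : Ham n m) :
    (Function.support fun N => F.psiDegree Θ.par Θ.e n m N h).Finite := by
  obtain ⟨M, hM⟩ := exists_wordDeriv_eq_zero h
  refine (Set.finite_lt_nat M).subset fun N hN => ?_
  by_contra hlt
  refine hN ?_
  simp only [Set.mem_ofPred_eq, not_lt] at hlt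
  simp only [psiDegree]
  rw [Finset.sum_eq_zero, smul_zero]
  intro w _
  rw [taylorCoeff_eq, hM _ (by simpa using hlt), map_zero, zero_smul]

/-- The definition of `Ψ` by polarised tensors agrees with the trace at the generic point. By
linearity it is enough to compare words, where this is Taylor's formula. -/
theorem psi_eq (h : Ham n m) : F.psi Θ.par Θ.e n m h = Θ.psiLinear n m h := by
  induction h using superPoly_induction with
  | zero => simp [psi, psiDegree, taylorCoeff]
  | add f g hf hg =>
    rw [map_add, ← hf, ← hg, psi, psi, psi, ← finsum_add_distrib (Θ.psiDegree_hasFiniteSupport f)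
      (Θ.psiDegree_hasFiniteSupport g)]
    refine finsum_congr fun N => ?_
    simp only [psiDegree_eq, taylorCoeff_eq, map_add, add_smul, Finset.sum_add_distrib, smul_add]
  | smul a f hf =>
    rw [map_smul, ← hf, psi, psi, smul_finsum]
    refine finsum_congr fun N => ?_
    simp only [psiDegree_eq, taylorCoeff_eq, map_smul, smul_assoc, ← Finset.smul_sum]
    exact smul_comm _ _ _
  | word u =>
    have hu := monomial_mem_degreePart (par := vPar n m) u
    rw [psi, finsum_eq_single _ u.length]
    · rw [psiDegree_eq, taylor_formula hu, smul_smul, inv_mul_cancel₀ (by positivity), one_smul]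
    · intro N hN
      simp only [psiDegree]
      rw [Finset.sum_eq_zero, smul_zero]
      intro w _
      rw [taylorCoeff_eq_zero hu (by simpa using hN), zero_smul]

end Frame

end ContractibleDGFrobenius


theorem superPoly_neg_smul {K : Type} {par : K → ZMod 2} (a : ℝ) (f : SuperPoly par) :
    (-a) • f = -(a • f) := by
  rw [← neg_one_mul, mul_smul, superPoly_neg_one_smul]

/-! ### Superderivations -/

section Derivations

variable {K : Type} {par : K → ZMod 2}

/-- Derivations of parity `v` of the superalgebra of functions. -/
structure IsSuperDerivation (v : ZMod 2) (D : SuperPoly par →ₗ[ℝ] SuperPoly par) : Prop where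
  mem : ∀ {p : ZMod 2} {f : SuperPoly par}, f ∈ parityPart par p → D f ∈ parityPart par (p + v)
  leibniz : ∀ {p : ZMod 2} {f : SuperPoly par} (g : SuperPoly par), f ∈ parityPart par p →
    D (f * g) = D f * g + sgn (v * p) • (f * D g)

theorem isSuperDerivation_lderiv (k : K) : IsSuperDerivation (par k) (lderiv par k) where
  mem hf := by rw [add_comm]; exact lderiv_mem_parityPart k hf
  leibniz g hf := lderiv_mul k hf g

namespace IsSuperDerivation

variable {v : ZMod 2} {D D' : SuperPoly par →ₗ[ℝ] SuperPoly par}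

theorem map_one (hD : IsSuperDerivation v D) : D 1 = 0 := by
  have h := hD.leibniz 1 (one_mem_parityPart par)
  simpa using h

theorem add (hD : IsSuperDerivation v D) (hD' : IsSuperDerivation v D') :
    IsSuperDerivation v (D + D') where
  mem hf := Submodule.add_mem _ (hD.mem hf) (hD'.mem hf)
  leibniz g hf := by
    simp only [LinearMap.add_apply, hD.leibniz g hf, hD'.leibniz g hf, add_mul, mul_add, smul_add]
    abel

theorem zero : IsSuperDerivation v (0 : SuperPoly par →ₗ[ℝ] SuperPoly par) where
  mem _ := Submodule.zero_mem _
  leibniz g hf := by simp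

theorem smul (a : ℝ) (hD : IsSuperDerivation v D) : IsSuperDerivation v (a • D) where
  mem hf := Submodule.smul_mem _ _ (hD.mem hf)
  leibniz g hf := by
    simp only [LinearMap.smul_apply, hD.leibniz g hf, smul_mul_assoc, mul_smul_comm, smul_add]
    rw [smul_comm a]

theorem sum {ι : Type*} (s : Finset ι) {D : ι → SuperPoly par →ₗ[ℝ] SuperPoly par}
    (hD : ∀ i ∈ s, IsSuperDerivation v (D i)) : IsSuperDerivation v (∑ i ∈ s, D i) :=
  Finset.sum_induction D (IsSuperDerivation v) (fun _ _ => add) zero hD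

theorem mulLeft {x : ZMod 2} {X : SuperPoly par} (hX : X ∈ parityPart par x)
    (hD : IsSuperDerivation v D) : IsSuperDerivation (x + v) (LinearMap.mulLeft ℝ X ∘ₗ D) where
  mem hf := by
    simpa [add_comm, add_left_comm] using mul_mem_parityPart hX (hD.mem hf)
  leibniz {p f} g hf := by
    simp only [LinearMap.comp_apply, LinearMap.mulLeft_apply, hD.leibniz g hf, mul_add,
      mul_smul_comm, ← mul_assoc]
    rw [mul_comm_of_mem hX hf, smul_mul_assoc, smul_smul, ← sgn_add, add_mul, add_comm (x * p)]

theorem congr {v' : ZMod 2} (hD : IsSuperDerivation v D) (h : v = v') : IsSuperDerivation v' D :=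
  h ▸ hD

end IsSuperDerivation

variable (par) in
theorem evalZero_mul (f g : SuperPoly par) :
    evalZero par (f * g) = evalZero par f * evalZero par g := by
  simp [evalZero, body_mul]

variable [Fintype K]

variable (par) in
/-- The vector field with components `X k`. -/
def vectorField (X : K → SuperPoly par) : SuperPoly par →ₗ[ℝ] SuperPoly par :=
  ∑ k, LinearMap.mulLeft ℝ (X k) ∘ₗ lderiv par k

theorem vectorField_apply (X : K → SuperPoly par) (f : SuperPoly par) :
    vectorField par X f = ∑ k, X k * lderiv par k f := by
  simp [vectorField]

theorem vectorField_coord [DecidableEq K] (X : K → SuperPoly par) (k : K) :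
    vectorField par X (coord par k) = X k := by
  simp [vectorField_apply, lderiv_coord]

theorem isSuperDerivation_vectorField {v : ZMod 2} {X : K → SuperPoly par}
    (hX : ∀ k, X k ∈ parityPart par (par k + v)) : IsSuperDerivation v (vectorField par X) := by
  refine IsSuperDerivation.sum _ fun k _ =>
    (IsSuperDerivation.mulLeft (hX k) (isSuperDerivation_lderiv k)).congr ?_
  have : ∀ a v : ZMod 2, a + v + a = v := by decide
  exact this _ _

theorem lderiv_vectorField {v : ZMod 2} {X : K → SuperPoly par}
    (hX : ∀ k, X k ∈ parityPart par (par k + v)) (j : K) (f : SuperPoly par) :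
    lderiv par j (vectorField par X f) =
      sgn (v * par j) • vectorField par X (lderiv par j f) +
        ∑ k, lderiv par j (X k) * lderiv par k f := by
  simp only [vectorField_apply, map_sum, lderiv_mul j (hX _), Finset.sum_add_distrib,
    Finset.smul_sum]
  rw [add_comm]
  congr 1
  refine Finset.sum_congr rfl fun k _ => ?_
  rw [lderiv_lderiv par j k f, mul_smul_comm, smul_smul, ← sgn_add]
  congr 2
  have : ∀ a b v : ZMod 2, b * (a + v) + b * a = v * b := by decide
  exact this _ _ _

/-- Vector fields with homogeneous linear components vanish at the origin. -/
theorem evalZero_vectorField {X : K → SuperPoly par} (hX : ∀ k, evalZero par (X k) = 0)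
    (f : SuperPoly par) : evalZero par (vectorField par X f) = 0 := by
  simp [vectorField_apply, evalZero_mul, hX]

end Derivations


namespace ContractibleDGFrobenius

variable {A : Type*} [NonUnitalRing A] [Module ℝ A] [IsScalarTower ℝ A A] [SMulCommClass ℝ A A]

namespace Frame

variable {F : ContractibleDGFrobenius A} (Θ : F.Frame) {n m : ℕ}

theorem lderiv_evalTrace_monomial (k : Fin Θ.r × VIdx n m) (w : List (VIdx n m)) {q : ZMod 2}
    {c : ℝ × A × ℝ} (hc : F.ExtHom q c) :
    lderiv (tensorPar Θ.par n m) k (Θ.evalTrace n m (monomial (vPar n m) w) c) =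
      sgn ((Θ.par k.1 + vPar n m k.2) * (1 + Θ.par k.1 + q)) •
        Θ.evalTrace n m (lderiv (vPar n m) k.2 (monomial (vPar n m) w)) (F.rmul (Θ.e k.1) c) := by
  obtain ⟨γ, j⟩ := k
  induction w generalizing q c with
  | nil => simp [lderiv_one]
  | cons i w ih =>
    have hs : ∀ g j a i q : ZMod 2, (a + i) * (1 + a + q) + ((g + j) * (a + i) +
        (g + j) * (1 + g + (q + a))) =
        (g + j) * (1 + g + q) + (j * i + ((a + i) * (1 + a + (q + g)) + g * a)) := by decide
    rw [monomial_cons, evalTrace_coord_mul, Θ.zeta_apply _ _ hc, lderiv_coord_mul_eq, map_add,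
      map_smul, evalTrace_coord_mul, LinearMap.add_apply, LinearMap.smul_apply,
      Θ.zeta_apply _ _ (hc.rmul (Θ.mem γ))]
    simp only [map_sum, map_smul, lderiv_coord_mul_eq, smul_add, Finset.sum_add_distrib]
    congr 1
    · simp only [Prod.mk.injEq]
      by_cases hij : j = i
      · subst hij
        simp
      · simp [hij]
    · simp only [Finset.smul_sum]
      refine Finset.sum_congr rfl fun α _ => ?_
      rw [ih (hc.rmul (Θ.mem α)), F.rmul_rmul (Θ.mem γ) (Θ.mem α), map_smul]
      simp only [mul_smul_comm, smul_smul, ← sgn_add, tensorPar]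
      rw [hs]

/-- The chain rule: differentiating in the direction `e_γ ⊗ v_j` differentiates the Hamiltonian
along `v_j` and inserts `e_γ` into the trace. -/
theorem lderiv_evalTrace (k : Fin Θ.r × VIdx n m) (h : Ham n m) {q : ZMod 2}
    {c : ℝ × A × ℝ} (hc : F.ExtHom q c) :
    lderiv (tensorPar Θ.par n m) k (Θ.evalTrace n m h c) =
      sgn ((Θ.par k.1 + vPar n m k.2) * (1 + Θ.par k.1 + q)) •
        Θ.evalTrace n m (lderiv (vPar n m) k.2 h) (F.rmul (Θ.e k.1) c) := by
  induction h using superPoly_induction with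
  | zero => simp
  | add f g hf hg => simp only [map_add, LinearMap.add_apply, hf, hg, smul_add]
  | smul a f hf => simp only [map_smul, LinearMap.smul_apply, hf]; rw [smul_comm]
  | word w => exact Θ.lderiv_evalTrace_monomial k w hc

theorem evalTrace_mem {p q : ZMod 2} {h : Ham n m} (hh : h ∈ parityPart (vPar n m) p)
    {c : ℝ × A × ℝ} (hc : F.ExtHom q c) :
    Θ.evalTrace n m h c ∈ parityPart (tensorPar Θ.par n m) (p + q + 1) := by
  induction hh using parityPart_induction with
  | zero => rw [map_zero]; exact Submodule.zero_mem _
  | add f g _ _ hf hg => rw [map_add]; exact Submodule.add_mem _ hf hg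
  | smul a f _ hf => rw [map_smul]; exact Submodule.smul_mem _ _ hf
  | word w hw =>
    induction w generalizing p q c with
    | nil =>
      have h1 := congrArg (fun c : ℝ × A × ℝ => c.2.2) hc
      simp only [extInvolution_apply, Prod.smul_snd, smul_eq_mul] at h1
      simp only [List.map_nil, List.sum_nil] at hw
      subst hw
      rw [monomial_nil, evalTrace_one, trace_apply]
      rcases zmod_two_cases q with rfl | rfl
      · rw [sgn_zero] at h1
        rw [show c.2.2 = 0 by linarith, zero_smul]
        exact Submodule.zero_mem _
      · exact Submodule.smul_mem _ _ (one_mem_parityPart _)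
    | cons i w ih =>
      rw [monomial_cons, evalTrace_coord_mul, Θ.zeta_apply _ _ hc]
      refine Submodule.sum_mem _ fun α _ => Submodule.smul_mem _ _ ?_
      have h1 := mul_mem_parityPart (coord_mem_parityPart (tensorPar Θ.par n m) (α, i))
        (ih (hc.rmul (Θ.mem α)) rfl)
      rw [List.map_cons, List.sum_cons] at hw
      have hs : ∀ a i q w : ZMod 2, a + i + (w + (q + a) + 1) = i + w + q + 1 := by decide
      rw [← hw, ← hs (Θ.par α)]
      exact h1

theorem psiLinear_mem {p : ZMod 2} {h : Ham n m} (hh : h ∈ parityPart (vPar n m) p) :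
    Θ.psiLinear n m h ∈ parityPart (tensorPar Θ.par n m) (p + 1) := by
  rw [psiLinear_apply]
  simpa using Θ.evalTrace_mem hh extHom_one

theorem lderiv_psiLinear (k : Fin Θ.r × VIdx n m) (h : Ham n m) :
    lderiv (tensorPar Θ.par n m) k (Θ.psiLinear n m h) =
      sgn (vPar n m k.2 * (1 + Θ.par k.1)) •
        Θ.evalTrace n m (lderiv (vPar n m) k.2 h) (0, Θ.e k.1, 0) := by
  have hs : ∀ g j : ZMod 2, (g + j) * (1 + g + 0) = j * (1 + g) := by decide
  rw [psiLinear_apply, Θ.lderiv_evalTrace k h extHom_one, hs]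
  simp [rmul_apply]

/-- The trace of a Hamiltonian without constant term is insensitive to the last summand. -/
theorem evalTrace_last {h : Ham n m} (hh : h ∈ orderPart (vPar n m) 1) (c : A) (y : ℝ) :
    Θ.evalTrace n m h (0, c, y) = Θ.evalTrace n m h (0, c, 0) := by
  rw [orderPart] at hh
  induction hh using Submodule.span_induction with
  | zero => simp
  | add f g _ _ hf hg => rw [map_add, LinearMap.add_apply, LinearMap.add_apply, hf, hg]
  | smul a f _ hf => rw [map_smul, LinearMap.smul_apply, LinearMap.smul_apply, hf]
  | mem f hf =>
    obtain ⟨w, hw, rfl⟩ := hf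
    cases w with
    | nil => simp at hw
    | cons i w =>
      have h1 : ∀ p : ZMod 2, ∀ a, F.rmul a (F.extPow p (0, c, y)) =
          F.rmul a (F.extPow p (0, c, 0)) := by
        intro p a
        rcases zmod_two_cases p with rfl | rfl <;>
          simp [extPow, rmul_apply, extInvolution_apply]
      rw [monomial_cons, evalTrace_coord_mul]
      simp only [zeta, LinearMap.coe_mk, AddHom.coe_mk, LinearMap.sum_apply, LinearMap.smul_apply,
        LinearMap.comp_apply, h1]

end Frame

/-- A homogeneous basis of `A` together with the dual basis for the scalar product. -/
structure BasisFrame (F : ContractibleDGFrobenius A) extends Frame F where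
  /-- the basis -/
  basis : Module.Basis (Fin r) ℝ A
  basis_apply : ∀ α, basis α = e α
  /-- the dual basis -/
  dual : Fin r → A
  form_dual : ∀ α a, F.form (dual α) a = basis.repr a α

theorem exists_basisFrame (F : ContractibleDGFrobenius A) [Module.Finite ℝ A] :
    Nonempty F.BasisFrame := by
  have h : (⊤ : Submodule ℝ A) = (⊤ ⊓ F.gr 0) ⊔ (⊤ ⊓ F.gr 1) := by
    rw [top_inf_eq, top_inf_eq, F.isCompl_gr.sup_eq_top]
  obtain ⟨r, par, b, hb⟩ := F.exists_homogeneous_basis h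
  let b' := b.map Submodule.topEquiv
  choose dual hdual using fun α => F.form_nondegenerate.2 (b'.coord α)
  exact ⟨{ r := r, par := par, e := fun α => b α, mem := hb, basis := b',
           basis_apply := fun α => rfl, dual := dual,
           form_dual := fun α a => by rw [hdual]; rfl }⟩

namespace BasisFrame

variable {F : ContractibleDGFrobenius A} (Θ : F.BasisFrame) {n m : ℕ}

theorem sum_form_dual (a : A) : ∑ α, F.form (Θ.dual α) a • Θ.e α = a := by
  simp only [Θ.form_dual, ← Θ.basis_apply]
  exact Θ.basis.sum_repr a

theorem sum_form (a : A) : ∑ α, F.form (Θ.e α) a • Θ.dual α = a := by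
  refine F.form_left_ext fun x => ?_
  conv_rhs => rw [F.form_comm, ← Θ.sum_form_dual x]
  simp only [map_sum, LinearMap.sum_apply, map_smul, LinearMap.smul_apply, smul_eq_mul]
  exact Finset.sum_congr rfl fun α _ => _root_.mul_comm _ _

theorem repr_involution (a : A) (α : Fin Θ.r) :
    Θ.basis.repr (F.involution a) α = sgn (Θ.par α) * Θ.basis.repr a α := by
  have : Θ.basis.coord α ∘ₗ F.involution = sgn (Θ.par α) • Θ.basis.coord α := by
    refine Θ.basis.ext fun β => ?_
    have h := Θ.mem β
    rw [← Θ.basis_apply] at h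
    simp only [LinearMap.comp_apply, F.involution_of_mem h, map_smul, LinearMap.smul_apply,
      Module.Basis.coord_apply, Module.Basis.repr_self, Finsupp.single_apply]
    by_cases hab : β = α
    · rw [hab]
    · simp [hab]
  exact LinearMap.congr_fun this a

theorem dual_mem (α : Fin Θ.r) : Θ.dual α ∈ F.gr (Θ.par α + 1) := by
  refine F.mem_gr_of_involution (F.form_left_ext fun x => ?_)
  rw [form_involution, Θ.form_dual, repr_involution, map_smul, LinearMap.smul_apply, Θ.form_dual,
    sgn_add, sgn_one]
  simp

theorem repr_eq_zero {p : ZMod 2} {a : A} (ha : a ∈ F.gr p) {α : Fin Θ.r} (h : Θ.par α ≠ p) :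
    Θ.basis.repr a α = 0 := by
  have h1 := Θ.repr_involution a α
  rw [F.involution_of_mem ha, map_smul, Finsupp.smul_apply, smul_eq_mul] at h1
  rcases zmod_two_cases p with rfl | rfl <;> rcases zmod_two_cases (Θ.par α) with h2 | h2
  · exact absurd h2 h
  · rw [h2, sgn_zero, sgn_one] at h1; linarith
  · rw [h2, sgn_zero, sgn_one] at h1; linarith
  · exact absurd h2 h

theorem gr_induction {p : ZMod 2} {P : ∀ a, a ∈ F.gr p → Prop} (zero : P 0 (Submodule.zero_mem _))
    (add : ∀ a b ha hb, P a ha → P b hb → P (a + b) (Submodule.add_mem _ ha hb))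
    (smul : ∀ (r : ℝ) a ha, P a ha → P (r • a) (Submodule.smul_mem _ r ha))
    (e : ∀ α (h : Θ.par α = p), P (Θ.e α) (h ▸ Θ.mem α)) {a : A} (ha : a ∈ F.gr p) : P a ha := by
  have h : ∃ h, P a h := by
    rw [← Θ.sum_form_dual a]
    refine Finset.sum_induction _ (fun a => ∃ h, P a h)
      (fun a b ha hb => ⟨_, add a b _ _ ha.2 hb.2⟩) ⟨_, zero⟩ fun α _ => ?_
    by_cases h : Θ.par α = p
    · exact ⟨_, smul _ _ _ (e α h)⟩
    · rw [Θ.form_dual, Θ.repr_eq_zero ha h, zero_smul]; exact ⟨_, zero⟩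
  exact h.2

/-! ### The Casimir element -/

section Casimir

variable {M : Type*} [AddCommGroup M] [Module ℝ M] (β : A →ₗ[ℝ] A →ₗ[ℝ] M)

/-- A linear map may be moved from one factor of the Casimir element to its adjoint on the other. -/
theorem sum_adjoint {T T' : A →ₗ[ℝ] A} (h : ∀ a b, F.form (T' a) b = F.form a (T b)) :
    ∑ α, β (T (Θ.e α)) (Θ.dual α) = ∑ α, β (Θ.e α) (T' (Θ.dual α)) := by
  have h1 : ∀ α, β (T (Θ.e α)) (Θ.dual α) =
      ∑ γ, F.form (Θ.dual γ) (T (Θ.e α)) • β (Θ.e γ) (Θ.dual α) := by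
    intro α
    conv_lhs => rw [← Θ.sum_form_dual (T (Θ.e α))]
    simp only [map_sum, map_smul, LinearMap.sum_apply, LinearMap.smul_apply]
  have h2 : ∀ γ, β (Θ.e γ) (T' (Θ.dual γ)) =
      ∑ α, F.form (Θ.e α) (T' (Θ.dual γ)) • β (Θ.e γ) (Θ.dual α) := by
    intro γ
    conv_lhs => rw [← Θ.sum_form (T' (Θ.dual γ))]
    simp only [map_sum, map_smul]
  simp only [h1, h2]
  rw [Finset.sum_comm]
  refine Finset.sum_congr rfl fun γ _ => Finset.sum_congr rfl fun α _ => ?_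
  rw [← h, F.form_comm]

/-- The Casimir element `∑ e_α ⊗ e^α` is symmetric. -/
theorem sum_symm : ∑ α, β (Θ.dual α) (Θ.e α) = ∑ α, β (Θ.e α) (Θ.dual α) := by
  have h1 : ∀ α, β (Θ.dual α) (Θ.e α) =
      ∑ γ, F.form (Θ.dual γ) (Θ.dual α) • β (Θ.e γ) (Θ.e α) := by
    intro α
    conv_lhs => rw [← Θ.sum_form_dual (Θ.dual α)]
    simp only [map_sum, map_smul, LinearMap.sum_apply, LinearMap.smul_apply]
  have h2 : ∀ γ, β (Θ.e γ) (Θ.dual γ) =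
      ∑ α, F.form (Θ.dual α) (Θ.dual γ) • β (Θ.e γ) (Θ.e α) := by
    intro γ
    conv_lhs => rw [← Θ.sum_form_dual (Θ.dual γ)]
    simp only [map_sum, map_smul]
  simp only [h1, h2]
  rw [Finset.sum_comm]
  refine Finset.sum_congr rfl fun γ _ => Finset.sum_congr rfl fun α _ => ?_
  rw [F.form_comm]

end Casimir

/-- Inserting the Casimir element into two traces multiplies the Hamiltonians. -/
theorem sum_evalTrace_mul_monomial (w : List (VIdx n m)) {t : (ℝ × A × ℝ) →ₗ[ℝ] Θ.Fun n m}
    (ht : ∀ c y, t (0, c, y) = t (0, c, 0)) {q : ZMod 2} {c : ℝ × A × ℝ} (hc : F.ExtHom q c)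
    (hw : w ≠ [] ∨ c.1 = 0) :
    ∑ γ, sgn (Θ.par γ * (w.map (vPar n m)).sum) •
      (Θ.evalTrace n m (monomial (vPar n m) w) (F.rmul (Θ.e γ) c) * t (0, Θ.dual γ, 0)) =
      Θ.evalHom n m (monomial (vPar n m) w) t c := by
  induction w generalizing q c with
  | nil =>
    obtain ⟨x, c, y⟩ := c
    obtain rfl : x = 0 := hw.resolve_left (by simp)
    have h1 : (0, c, 0) = LinearMap.inr ℝ ℝ (A × ℝ) (LinearMap.inl ℝ A ℝ c) := rfl
    rw [monomial_nil, map_one (Θ.evalHom n m), Module.End.one_apply, ht, h1]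
    conv_rhs => rw [← Θ.sum_form c]
    simp only [map_sum, map_smul, Frame.evalTrace_one, Frame.trace_apply, rmul_apply, List.map_nil,
      List.sum_nil, mul_zero, sgn_zero, one_smul, smul_mul_assoc, one_mul]
    refine Finset.sum_congr rfl fun γ _ => ?_
    rw [F.form_comm]
    rfl
  | cons i w ih =>
    have hs : ∀ g i S a q : ZMod 2, g * (i + S) + ((a + i) * (1 + a + (q + g)) + g * a) =
        (a + i) * (1 + a + q) + g * S := by decide
    rw [monomial_cons, map_mul (Θ.evalHom n m), Module.End.mul_apply,
      Frame.evalHom_coord, Θ.zeta_apply _ _ hc]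
    simp only [Frame.evalTrace_coord_mul, Θ.zeta_apply _ _ (hc.rmul (Θ.mem _)), Finset.sum_mul,
      Finset.smul_sum]
    rw [Finset.sum_comm]
    refine Finset.sum_congr rfl fun α _ => ?_
    rw [← ih (hc.rmul (Θ.mem α)) (Or.inr rfl), Finset.mul_sum, Finset.smul_sum]
    refine Finset.sum_congr rfl fun γ _ => ?_
    rw [F.rmul_rmul (Θ.mem γ) (Θ.mem α), map_smul]
    simp only [List.map_cons, List.sum_cons, mul_smul_comm, smul_mul_assoc, smul_smul, mul_assoc,
      ← sgn_add]
    rw [hs]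

end BasisFrame

end ContractibleDGFrobenius


/-! ### The Poisson bracket -/

section Bracket

variable {n m : ℕ}

/-- The index of the canonical coordinate conjugate to a given one. -/
def conj : VIdx n m → VIdx n m
  | Sum.inl (Sum.inl i) => Sum.inl (Sum.inr i)
  | Sum.inl (Sum.inr i) => Sum.inl (Sum.inl i)
  | Sum.inr i => Sum.inr i

/-- The sign with which the derivatives along a coordinate and its conjugate enter the
Poisson bracket. -/
def conjSign : VIdx n m → ℝ
  | Sum.inl (Sum.inl _) => -1
  | Sum.inl (Sum.inr _) => 1
  | Sum.inr _ => 1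

@[simp] theorem conj_conj (i : VIdx n m) : conj (conj i) = i := by
  rcases i with (i | i) | i <;> rfl

@[simp] theorem vPar_conj (i : VIdx n m) : vPar n m (conj i) = vPar n m i := by
  rcases i with (i | i) | i <;> rfl

theorem conjSign_conj (i : VIdx n m) : conjSign (conj i) = -sgn (vPar n m i) * conjSign i := by
  rcases i with (i | i) | i <;> simp [conj, conjSign, vPar]

theorem conjSign_mul_self (i : VIdx n m) : conjSign i * conjSign i = 1 := by
  rcases i with (i | i) | i <;> simp [conjSign]

variable (n m) in
/-- Conjugation as a permutation of the canonical coordinates. -/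
def conjEquiv : VIdx n m ≃ VIdx n m where
  toFun := conj
  invFun := conj
  left_inv := conj_conj
  right_inv := conj_conj

theorem sum_conj {M : Type*} [AddCommMonoid M] (f : VIdx n m → M) :
    ∑ i, f (conj i) = ∑ i, f i :=
  (conjEquiv n m).sum_comp f

theorem symplecticForm_eq (i j : VIdx n m) :
    symplecticForm n m i j = if j = conj i then conjSign j else 0 := by
  rcases i with (i | i) | i <;> rcases j with (j | j) | j <;>
    simp [symplecticForm, conj, conjSign, eq_comm]

theorem bracket_apply {p : ZMod 2} {a : Ham n m} (ha : a ∈ parityPart (vPar n m) p)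
    (b : Ham n m) : bracket n m a b = ∑ i, (conjSign i * sgn (vPar n m i * p)) •
      (lderiv (vPar n m) i a * lderiv (vPar n m) (conj i) b) := by
  rw [bracket, Fintype.sum_sum_type, Fintype.sum_sum_type, sub_eq_add_neg,
    ← Finset.sum_neg_distrib, Finset.sum_sub_distrib]
  simp only [conjSign, conj, vPar, zero_mul, sgn_zero, mul_one, one_mul, qIdx, pIdx, xIdx,
    one_smul, superPoly_neg_one_smul, Finset.sum_neg_distrib]
  congr 1
  · abel
  · rw [← Finset.sum_neg_distrib]
    refine Finset.sum_congr rfl fun i _ => ?_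
    rw [rderiv_of_mem (k := (Sum.inr i : VIdx n m)) (by simp [vPar]) ha]
    rw [smul_mul_assoc, ← superPoly_neg_one_smul, smul_smul, neg_one_mul, neg_neg]

/-- The Hamiltonian vector field of a function of parity `p`. -/
theorem bracket_eq_vectorField {p : ZMod 2} {a : Ham n m} (ha : a ∈ parityPart (vPar n m) p)
    (b : Ham n m) : bracket n m a b = vectorField (vPar n m)
      (fun k => (conjSign (conj k) * sgn (vPar n m k * p)) • lderiv (vPar n m) (conj k) a) b := by
  rw [bracket_apply ha, ← sum_conj, vectorField_apply]
  simp only [conj_conj, vPar_conj, smul_mul_assoc]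

theorem isSuperDerivation_bracket {p : ZMod 2} {a : Ham n m}
    (ha : a ∈ parityPart (vPar n m) p) : IsSuperDerivation p (vectorField (vPar n m)
      (fun k => (conjSign (conj k) * sgn (vPar n m k * p)) • lderiv (vPar n m) (conj k) a)) := by
  refine isSuperDerivation_vectorField fun k => Submodule.smul_mem _ _ ?_
  simpa using lderiv_mem_parityPart (conj k) ha

theorem bracket_mem_parityPart {p q : ZMod 2} {a b : Ham n m}
    (ha : a ∈ parityPart (vPar n m) p) (hb : b ∈ parityPart (vPar n m) q) :
    bracket n m a b ∈ parityPart (vPar n m) (p + q) := by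
  rw [bracket_eq_vectorField ha, add_comm]
  exact (isSuperDerivation_bracket ha).mem hb

/-- Contracting two derivatives of an even or odd function with the symplectic form gives zero. -/
theorem sum_conjSign_lderiv (h : Ham n m) :
    ∑ i, conjSign i • lderiv (vPar n m) i (lderiv (vPar n m) (conj i) h) = 0 := by
  set S := ∑ i, conjSign i • lderiv (vPar n m) i (lderiv (vPar n m) (conj i) h) with hS
  have h1 : S = (-1 : ℝ) • S := by
    conv_lhs => rw [hS, ← sum_conj]
    rw [hS, Finset.smul_sum]
    refine Finset.sum_congr rfl fun i _ => ?_
    have h2 : ∀ a : ZMod 2, a * a = a := by decide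
    rw [conj_conj, conjSign_conj, lderiv_lderiv, vPar_conj, smul_smul, smul_smul, h2]
    congr 1
    linear_combination (-conjSign i) * sgn_mul_self (vPar n m i)
  have h2 : (2 : ℝ) • S = 0 := by
    calc (2 : ℝ) • S = S + S := two_smul ℝ S
      _ = S + (-1 : ℝ) • S := by rw [← h1]
      _ = 0 := by rw [superPoly_neg_one_smul, add_neg_cancel]
  exact (smul_eq_zero.1 h2).resolve_left two_ne_zero

theorem evalZero_eq_zero_of_odd {K : Type} {par : K → ZMod 2} {f : SuperPoly par}
    (hf : f ∈ parityPart par 1) : evalZero par f = 0 := by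
  induction hf using parityPart_induction with
  | zero => simp
  | add f g _ _ hf hg => rw [map_add, hf, hg, add_zero]
  | smul a f _ hf => rw [map_smul, hf, smul_zero]
  | word w hw =>
    cases w with
    | nil => simp at hw
    | cons k w => rw [monomial_cons, evalZero_coord_mul]

theorem degreePart_one_eq {K : Type} [Fintype K] {par : K → ZMod 2} {f : SuperPoly par}
    (hf : f ∈ degreePart par 1) : f = ∑ k, evalZero par (lderiv par k f) • coord par k := by
  classical
  induction hf using degreePart_induction with
  | zero => simp
  | add f g _ _ hf hg =>
    conv_lhs => rw [hf, hg]
    simp only [map_add, add_smul, Finset.sum_add_distrib]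
  | smul a f _ hf =>
    conv_lhs => rw [hf]
    simp only [map_smul, smul_assoc, Finset.smul_sum]
  | word w hw =>
    obtain ⟨k, rfl⟩ := List.length_eq_one_iff.1 hw
    have h1 : ∀ j, evalZero par (lderiv par j (coord par k)) = if j = k then 1 else 0 := by
      intro j
      rw [lderiv_coord]
      split_ifs <;> simp [evalZero_one]
    simp [monomial, h1]

end Bracket


namespace ContractibleDGFrobenius

variable {A : Type*} [NonUnitalRing A] [Module ℝ A] [IsScalarTower ℝ A A] [SMulCommClass ℝ A A]

namespace BasisFrame

variable {F : ContractibleDGFrobenius A} (Θ : F.BasisFrame) {n m : ℕ}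

/-! ### Directional derivatives on `A ⊗ V` -/

/-- The derivative of functions on `A ⊗ V` in the direction `a ⊗ v_i`. -/
def pd (i : VIdx n m) : A →ₗ[ℝ] Θ.Fun n m →ₗ[ℝ] Θ.Fun n m :=
  ∑ γ, (Θ.basis.coord γ).smulRight (lderiv (tensorPar Θ.par n m) (γ, i))

theorem pd_apply (i : VIdx n m) (a : A) (f : Θ.Fun n m) :
    Θ.pd i a f = ∑ γ, Θ.basis.repr a γ • lderiv (tensorPar Θ.par n m) (γ, i) f := by
  simp [pd]

theorem pd_e (i : VIdx n m) (α : Fin Θ.r) (f : Θ.Fun n m) :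
    Θ.pd i (Θ.e α) f = lderiv (tensorPar Θ.par n m) (α, i) f := by
  rw [pd_apply, ← Θ.basis_apply, Θ.basis.repr_self, Finset.sum_eq_single α]
  · simp
  · intro γ _ h
    rw [Finsupp.single_eq_of_ne h, zero_smul]
  · simp

theorem isSuperDerivation_pd (i : VIdx n m) {p : ZMod 2} {a : A} (ha : a ∈ F.gr p) :
    IsSuperDerivation (p + vPar n m i) (Θ.pd i a) := by
  induction ha using Θ.gr_induction with
  | zero => rw [map_zero]; exact IsSuperDerivation.zero
  | add a b _ _ ha hb => rw [map_add]; exact ha.add hb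
  | smul r a _ ha => rw [map_smul]; exact ha.smul r
  | e α h =>
    have h1 : Θ.pd i (Θ.e α) = lderiv (tensorPar Θ.par n m) (α, i) :=
      LinearMap.ext fun f => Θ.pd_e i α f
    rw [h1, ← h]
    exact isSuperDerivation_lderiv (α, i)

theorem pd_pd (i j : VIdx n m) {p q : ZMod 2} {a b : A} (ha : a ∈ F.gr p) (hb : b ∈ F.gr q)
    (f : Θ.Fun n m) : Θ.pd i a (Θ.pd j b f) =
      sgn ((p + vPar n m i) * (q + vPar n m j)) • Θ.pd j b (Θ.pd i a f) := by
  induction ha using Θ.gr_induction with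
  | zero => simp
  | add a a' _ _ ha ha' => simp only [map_add, LinearMap.add_apply, ha, ha', smul_add]
  | smul r a _ ha => simp only [map_smul, LinearMap.smul_apply, ha]; rw [smul_comm]
  | e α h =>
    subst h
    induction hb using Θ.gr_induction with
    | zero => simp
    | add a a' _ _ ha ha' => simp only [map_add, LinearMap.add_apply, ha, ha', smul_add]
    | smul r a _ ha => simp only [map_smul, LinearMap.smul_apply, ha]; rw [smul_comm]
    | e β h =>
      subst h
      simp only [pd_e]
      exact lderiv_lderiv (par := tensorPar Θ.par n m) (α, i) (β, j) f

theorem pd_coord (i : VIdx n m) (a : A) (k : Fin Θ.r × VIdx n m) :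
    Θ.pd i a (coord (tensorPar Θ.par n m) k) =
      if i = k.2 then Θ.basis.repr a k.1 • (1 : Θ.Fun n m) else 0 := by
  obtain ⟨κ, j⟩ := k
  rw [pd_apply]
  simp only [lderiv_coord, Prod.mk.injEq]
  by_cases h : i = j
  · subst h; simp
  · simp [h]

theorem pd_psiLinear (i : VIdx n m) (h : Ham n m) {p : ZMod 2} {a : A} (ha : a ∈ F.gr p) :
    Θ.pd i a (Θ.psiLinear n m h) =
      sgn (vPar n m i * (1 + p)) • Θ.evalTrace n m (lderiv (vPar n m) i h) (0, a, 0) := by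
  have h1 : ∀ a : A, ((0, a, 0) : ℝ × A × ℝ) = LinearMap.inr ℝ ℝ (A × ℝ) (LinearMap.inl ℝ A ℝ a) :=
    fun _ => rfl
  induction ha using Θ.gr_induction with
  | zero => simp only [h1, map_zero, LinearMap.zero_apply, smul_zero]
  | add a b _ _ ha hb =>
    simp only [h1, map_add, LinearMap.add_apply, smul_add] at ha hb ⊢
    rw [ha, hb]
  | smul r a _ ha =>
    simp only [h1, map_smul, LinearMap.smul_apply] at ha ⊢
    rw [ha, smul_comm]
  | e α h => subst h; rw [pd_e, Frame.lderiv_psiLinear]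

theorem pd_evalTrace (i : VIdx n m) (h : Ham n m) {p q : ZMod 2} {a : A} (ha : a ∈ F.gr p)
    {c : ℝ × A × ℝ} (hc : F.ExtHom q c) :
    Θ.pd i a (Θ.evalTrace n m h c) = sgn ((p + vPar n m i) * (1 + p + q)) •
      Θ.evalTrace n m (lderiv (vPar n m) i h) (F.rmul a c) := by
  induction ha using Θ.gr_induction with
  | zero => simp
  | add a b _ _ ha hb => simp only [map_add, LinearMap.add_apply, ha, hb, smul_add]
  | smul r a _ ha => simp only [map_smul, LinearMap.smul_apply, ha]; rw [smul_comm]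
  | e α h => subst h; rw [pd_e, Θ.lderiv_evalTrace _ h hc]

/-! ### The differential -/

variable (n m) in
/-- The components of the odd vector field induced by `d`. Their signs are such that the field
takes the trace `c ↦ tr (c · h(Z))` at the generic point `Z` to `c ↦ tr (d c · h(Z))`. -/
def differentialComponent (k : Fin Θ.r × VIdx n m) : Θ.Fun n m :=
  ∑ α, (-sgn (Θ.par α) * Θ.basis.repr (F.d (Θ.e α)) k.1) • coord (tensorPar Θ.par n m) (α, k.2)

variable (n m) in
/-- The odd vector field on `A ⊗ V` induced by the differential of `A`. -/
def differential : Θ.Fun n m →ₗ[ℝ] Θ.Fun n m :=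
  vectorField (tensorPar Θ.par n m) (Θ.differentialComponent n m)

theorem differentialComponent_mem (k : Fin Θ.r × VIdx n m) :
    Θ.differentialComponent n m k ∈
      parityPart (tensorPar Θ.par n m) (tensorPar Θ.par n m k + 1) := by
  refine Submodule.sum_mem _ fun α _ => ?_
  by_cases h : Θ.par k.1 = Θ.par α + 1
  · refine Submodule.smul_mem _ _ ?_
    have h1 := coord_mem_parityPart (tensorPar Θ.par n m) (α, k.2)
    have hs : ∀ a i : ZMod 2, a + i = a + 1 + i + 1 := by decide
    simp only [tensorPar] at h1 ⊢
    rwa [h, ← hs]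
  · rw [Θ.repr_eq_zero (F.d_mem (Θ.mem α)) h, mul_zero, zero_smul]
    exact Submodule.zero_mem _

theorem isSuperDerivation_differential : IsSuperDerivation 1 (Θ.differential n m) :=
  isSuperDerivation_vectorField Θ.differentialComponent_mem

theorem evalZero_differential (f : Θ.Fun n m) :
    evalZero (tensorPar Θ.par n m) (Θ.differential n m f) = 0 := by
  refine evalZero_vectorField (fun k => ?_) f
  simp only [differentialComponent, map_sum, map_smul]
  refine Finset.sum_eq_zero fun α _ => ?_
  rw [← mul_one (coord _ _), evalZero_coord_mul, smul_zero]

theorem differential_pd (i : VIdx n m) {p : ZMod 2} {a : A} (ha : a ∈ F.gr p) (f : Θ.Fun n m) :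
    Θ.differential n m (Θ.pd i a f) = sgn (p + vPar n m i) • Θ.pd i a (Θ.differential n m f) +
      sgn (vPar n m i) • Θ.pd i (F.d a) f := by
  induction ha using Θ.gr_induction with
  | zero => simp
  | add a b _ _ ha hb => simp only [map_add, LinearMap.add_apply, ha, hb, smul_add]; abel
  | smul r a _ ha =>
    simp only [map_smul, LinearMap.smul_apply, ha, smul_add]
    rw [smul_comm r, smul_comm r]
  | e α h =>
    subst h
    have h1 : ∑ k, lderiv (tensorPar Θ.par n m) (α, i) (Θ.differentialComponent n m k) *
        lderiv (tensorPar Θ.par n m) k f = (-sgn (Θ.par α)) • Θ.pd i (F.d (Θ.e α)) f := by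
      rw [Fintype.sum_prod_type, pd_apply, Finset.smul_sum]
      refine Finset.sum_congr rfl fun β _ => ?_
      rw [Finset.sum_eq_single i]
      · simp only [differentialComponent, map_sum, map_smul, lderiv_coord, Prod.mk.injEq]
        rw [Finset.sum_eq_single α]
        · simp only [and_self, if_true, smul_mul_assoc, one_mul, smul_smul]
        · intro γ _ h; simp [Ne.symm h]
        · simp
      · intro j _ h
        simp only [differentialComponent, map_sum, map_smul, lderiv_coord, Prod.mk.injEq]
        rw [Finset.sum_eq_zero, zero_mul]
        intro γ _
        simp [Ne.symm h]
      · simp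
    have h2 := lderiv_vectorField Θ.differentialComponent_mem (α, i) f
    rw [h1] at h2
    simp only [pd_e]
    change _ = sgn _ • lderiv _ _ (vectorField _ _ f) + _
    rw [h2, smul_add, smul_smul, smul_smul, ← sgn_add, one_mul]
    have hs : ∀ a i : ZMod 2, a + i + (a + i) = 0 := by decide
    simp only [tensorPar]
    rw [hs, sgn_zero, one_smul, add_assoc, ← add_smul]
    have : sgn (Θ.par α + vPar n m i) * -sgn (Θ.par α) + sgn (vPar n m i) = 0 := by
      rw [sgn_add]
      linear_combination (-sgn (vPar n m i)) * sgn_mul_self (Θ.par α)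
    rw [this, zero_smul, add_zero]
    rfl

theorem differential_coord (k : Fin Θ.r × VIdx n m) :
    Θ.differential n m (coord (tensorPar Θ.par n m) k) = Θ.differentialComponent n m k :=
  vectorField_coord _ _

theorem differential_evalTrace_monomial (w : List (VIdx n m)) {q : ZMod 2} {c : ℝ × A × ℝ}
    (hc : F.ExtHom q c) : Θ.differential n m (Θ.evalTrace n m (monomial (vPar n m) w) c) =
      Θ.evalTrace n m (monomial (vPar n m) w) (F.extD c) := by
  induction w generalizing q c with
  | nil =>
    simp [Θ.isSuperDerivation_differential.map_one, extD_apply]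
  | cons i w ih =>
    have hd : ∀ α, F.extD (F.rmul (Θ.e α) c) = F.rmul (Θ.e α) (F.extD c) +
        sgn q • ∑ β, Θ.basis.repr (F.d (Θ.e α)) β • F.rmul (Θ.e β) c := by
      intro α
      rw [extD_rmul, show F.extInvolution c = sgn q • c from hc, map_smul]
      conv_lhs => rw [← Θ.sum_form_dual (F.d (Θ.e α))]
      simp only [map_sum, map_smul, LinearMap.sum_apply, LinearMap.smul_apply, Θ.form_dual]
    rw [monomial_cons, Frame.evalTrace_coord_mul, Θ.zeta_apply _ _ hc, Θ.zeta_apply _ _ hc.extD]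
    simp only [map_sum, map_smul,
      Θ.isSuperDerivation_differential.leibniz _ (coord_mem_parityPart _ _),
      ih (hc.rmul (Θ.mem _)), hd, map_add, mul_add, smul_add, Finset.sum_add_distrib,
      differential_coord, differentialComponent, Finset.sum_mul, Finset.mul_sum, Finset.smul_sum,
      mul_smul_comm, smul_mul_assoc, smul_smul]
    rw [Finset.sum_comm, add_left_comm, ← Finset.sum_add_distrib]
    conv_rhs => rw [← add_zero (∑ _, _)]
    congr 1
    · refine Finset.sum_congr rfl fun α _ => ?_
      rw [← sgn_add]
      congr 2
      simp only [tensorPar]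
      ring
    · refine Finset.sum_eq_zero fun α _ => ?_
      rw [← Finset.sum_add_distrib]
      refine Finset.sum_eq_zero fun β _ => ?_
      rw [← add_smul]
      by_cases h : Θ.par β = Θ.par α + 1
      · have hs : ∀ a i q : ZMod 2, (a + 1 + i) * 1 + (a + 1 + i) * (a + 1) + (a + 1 + i) * q + a =
            (a + i) * 1 + (a + i) * a + (a + i) * q + (1 * (a + i) + q) := by decide
        rw [h, ← mul_assoc, mul_neg, ← sgn_add, hs, sgn_add _ (1 * _ + q), sgn_add (1 * _) q]
        simp only [tensorPar]
        convert zero_smul ℝ _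
        ring
      · simp [Θ.repr_eq_zero (F.d_mem (Θ.mem α)) h]

end BasisFrame

end ContractibleDGFrobenius


namespace ContractibleDGFrobenius

variable {A : Type*} [NonUnitalRing A] [Module ℝ A] [IsScalarTower ℝ A A] [SMulCommClass ℝ A A]

/-- The power `γ^p` of the parity involution of `A`. -/
def invPow (F : ContractibleDGFrobenius A) (p : ZMod 2) : A →ₗ[ℝ] A :=
  if p = 0 then LinearMap.id else F.involution

theorem invPow_of_mem (F : ContractibleDGFrobenius A) (p : ZMod 2) {q : ZMod 2} {a : A}
    (ha : a ∈ F.gr q) : F.invPow p a = sgn (p * q) • a := by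
  rcases zmod_two_cases p with rfl | rfl
  · simp [invPow]
  · simp [invPow, F.involution_of_mem ha]

/-- Linear maps of parity `τ`. -/
def HasParity (F : ContractibleDGFrobenius A) (τ : ZMod 2) (T : A →ₗ[ℝ] A) : Prop :=
  ∀ ⦃p : ZMod 2⦄ ⦃a : A⦄, a ∈ F.gr p → T a ∈ F.gr (p + τ)

section Parity

variable {F : ContractibleDGFrobenius A}

theorem hasParity_id : F.HasParity 0 LinearMap.id := fun _ _ ha => by simpa using ha

theorem HasParity.comp {τ τ' : ZMod 2} {T T' : A →ₗ[ℝ] A} (hT : F.HasParity τ T)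
    (hT' : F.HasParity τ' T') : F.HasParity (τ' + τ) (T ∘ₗ T') := fun p a ha => by
  rw [← add_assoc]; exact hT (hT' ha)

theorem hasParity_invPow (p : ZMod 2) : F.HasParity 0 (F.invPow p) := fun q a ha => by
  rw [F.invPow_of_mem p ha, add_zero]; exact Submodule.smul_mem _ _ ha

theorem hasParity_ext {T T' : A →ₗ[ℝ] A}
    (h : ∀ p, ∀ a ∈ F.gr p, T a = T' a) : T = T' :=
  LinearMap.ext fun a => homogeneous_induction (F := F) a
    (fun a b ha hb => by rw [map_add, map_add, ha, hb]) fun p a ha => h p a ha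

end Parity

namespace BasisFrame

variable {F : ContractibleDGFrobenius A} (Θ : F.BasisFrame) {n m : ℕ}

theorem differential_psiLinear (h : Ham n m) : Θ.differential n m (Θ.psiLinear n m h) = 0 := by
  induction h using superPoly_induction with
  | zero => simp
  | add f g hf hg => rw [map_add, map_add, hf, hg, add_zero]
  | smul a f hf => rw [map_smul, map_smul, hf, smul_zero]
  | word w =>
    have h : F.extD ((1, 0, 0) : ℝ × A × ℝ) = 0 := by simp [extD_apply]
    rw [Frame.psiLinear_apply, Θ.differential_evalTrace_monomial w extHom_one, h, map_zero]

/-! ### Second order operators with constant coefficients -/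

/-- The contraction of the second derivatives along `v_i` and its conjugate with a
linear map of `A`. -/
def contraction (i : VIdx n m) : (A →ₗ[ℝ] A) →ₗ[ℝ] Θ.Fun n m →ₗ[ℝ] Θ.Fun n m where
  toFun T := ∑ α, Θ.pd i (T (Θ.e α)) ∘ₗ Θ.pd (conj i) (Θ.dual α)
  map_add' T T' := by
    simp only [LinearMap.add_apply, map_add, LinearMap.add_comp, Finset.sum_add_distrib]
  map_smul' r T := by
    simp only [LinearMap.smul_apply, map_smul, LinearMap.smul_comp, Finset.smul_sum,
      RingHom.id_apply]

theorem contraction_apply (i : VIdx n m) (T : A →ₗ[ℝ] A) (f : Θ.Fun n m) :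
    Θ.contraction i T f = ∑ α, Θ.pd i (T (Θ.e α)) (Θ.pd (conj i) (Θ.dual α) f) := by
  simp [contraction]

/-- The bilinear map `(a, b) ↦ ∂_{a, i} ∂_{b, j} f`. -/
def pdTwo (i j : VIdx n m) (f : Θ.Fun n m) : A →ₗ[ℝ] A →ₗ[ℝ] Θ.Fun n m :=
  LinearMap.mk₂ ℝ (fun a b => Θ.pd i a (Θ.pd j b f))
    (fun a b c => by simp only [map_add, LinearMap.add_apply])
    (fun r a c => by simp only [map_smul, LinearMap.smul_apply])
    (fun a c c' => by simp only [map_add, LinearMap.add_apply])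
    (fun r a c => by simp only [map_smul, LinearMap.smul_apply])

theorem pdTwo_apply (i j : VIdx n m) (f : Θ.Fun n m) (a b : A) :
    Θ.pdTwo i j f a b = Θ.pd i a (Θ.pd j b f) := rfl

theorem differential_contraction (i : VIdx n m) {τ : ZMod 2} {T : A →ₗ[ℝ] A}
    (hT : F.HasParity τ T) (f : Θ.Fun n m) :
    Θ.differential n m (Θ.contraction i T f) =
      sgn (τ + 1) • Θ.contraction i T (Θ.differential n m f) +
        Θ.contraction i (sgn τ • (T ∘ₗ F.d) + sgn (vPar n m i) • (F.d ∘ₗ T)) f := by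
  have h1 : Θ.contraction i (T ∘ₗ F.d) f = ∑ α, sgn (Θ.par α) •
      Θ.pd i (T (Θ.e α)) (Θ.pd (conj i) (F.d (Θ.dual α)) f) := by
    have h2 := Θ.sum_adjoint ((Θ.pdTwo i (conj i) f) ∘ₗ T) (T := F.d) (T' := -(F.d ∘ₗ F.involution))
      (fun a b => by simp [form_d'])
    simp only [LinearMap.comp_apply, pdTwo_apply] at h2
    rw [contraction_apply]
    simp only [LinearMap.comp_apply]
    rw [h2]
    refine Finset.sum_congr rfl fun α _ => ?_
    rw [LinearMap.neg_apply, LinearMap.comp_apply, F.involution_of_mem (Θ.dual_mem α), map_smul,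
      ← neg_smul, sgn_add, sgn_one]
    simp only [map_smul, LinearMap.smul_apply, mul_neg, mul_one, neg_neg]
  have hs1 : ∀ a i t : ZMod 2, a + t + i + (a + 1 + i) = t + 1 := by decide
  have hs2 : ∀ a i t : ZMod 2, a + t + i + i = t + a := by decide
  rw [map_add, map_smul, map_smul, LinearMap.add_apply, LinearMap.smul_apply,
    LinearMap.smul_apply, h1]
  simp only [contraction_apply, map_sum, Finset.smul_sum, LinearMap.comp_apply,
    Θ.differential_pd i (hT (Θ.mem _)), Θ.differential_pd (conj i) (Θ.dual_mem _), map_add,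
    map_smul, smul_add, smul_smul, ← sgn_add, vPar_conj, hs1, hs2, Finset.sum_add_distrib]
  exact add_assoc _ _ _

/-- The operator `-½ ∑ ± ∂_{T e_α ⊗ v_i} ∂_{e^α ⊗ v_{i*}}` with constant coefficients defined by a
linear map `T` of `A` of parity `τ` and the symplectic form of `V`. The powers of the parity
involution produce the Koszul signs; the operator has parity `τ + 1`, the scalar product of `A`
being odd. -/
def laplace (n m : ℕ) (τ : ZMod 2) (T : A →ₗ[ℝ] A) : Θ.Fun n m →ₗ[ℝ] Θ.Fun n m :=
  (-1 / 2 : ℝ) • ∑ i : VIdx n m, (conjSign i * sgn (vPar n m i * τ)) •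
    Θ.contraction i (T ∘ₗ F.invPow (1 + vPar n m i))

theorem laplace_apply (τ : ZMod 2) (T : A →ₗ[ℝ] A) (f : Θ.Fun n m) :
    Θ.laplace n m τ T f = (-1 / 2 : ℝ) • ∑ i : VIdx n m, (conjSign i * sgn (vPar n m i * τ)) •
      Θ.contraction i (T ∘ₗ F.invPow (1 + vPar n m i)) f := by
  simp [laplace]

theorem laplace_apply' (τ : ZMod 2) (T : A →ₗ[ℝ] A) (f : Θ.Fun n m) :
    Θ.laplace n m τ T f = (-1 / 2 : ℝ) • ∑ i : VIdx n m, ∑ α,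
      (conjSign i * sgn (vPar n m i * τ + (1 + vPar n m i) * Θ.par α)) •
        Θ.pd i (T (Θ.e α)) (Θ.pd (conj i) (Θ.dual α) f) := by
  simp only [laplace_apply, contraction_apply, LinearMap.comp_apply, F.invPow_of_mem _ (Θ.mem _),
    map_smul, LinearMap.smul_apply, Finset.smul_sum, smul_smul, sgn_add, mul_assoc]

/-- Invariance of the scalar product under `d`: commuting `D` with the operator of `T` yields the
operator of the supercommutator of `d` with `T`. -/
theorem differential_laplace {τ : ZMod 2} {T : A →ₗ[ℝ] A} (hT : F.HasParity τ T)
    (f : Θ.Fun n m) : Θ.differential n m (Θ.laplace n m τ T f) =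
      sgn (τ + 1) • Θ.laplace n m τ T (Θ.differential n m f) +
        Θ.laplace n m (τ + 1) (F.d ∘ₗ T + sgn (τ + 1) • (T ∘ₗ F.d)) f := by
  simp only [laplace_apply, map_smul, map_sum, Finset.smul_sum]
  rw [← Finset.sum_add_distrib]
  refine Finset.sum_congr rfl fun i _ => ?_
  have hT' : F.HasParity τ (T ∘ₗ F.invPow (1 + vPar n m i)) := by
    have := hT.comp (hasParity_invPow (F := F) (1 + vPar n m i))
    rwa [zero_add] at this
  have h1 : sgn τ • ((T ∘ₗ F.invPow (1 + vPar n m i)) ∘ₗ F.d) +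
      sgn (vPar n m i) • (F.d ∘ₗ T ∘ₗ F.invPow (1 + vPar n m i)) = sgn (vPar n m i) •
        ((F.d ∘ₗ T + sgn (τ + 1) • (T ∘ₗ F.d)) ∘ₗ F.invPow (1 + vPar n m i)) := by
    refine hasParity_ext (F := F) fun p a ha => ?_
    have hs : ∀ i t p : ZMod 2, t + (1 + i) * (p + 1) = i + (t + 1 + (1 + i) * p) := by decide
    simp only [LinearMap.add_apply, LinearMap.smul_apply, LinearMap.comp_apply,
      F.invPow_of_mem _ ha, F.invPow_of_mem _ (F.d_mem ha), map_smul, smul_add, smul_smul,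
      ← sgn_add, hs]
    rw [add_comm, add_comm (τ + 1)]
  rw [Θ.differential_contraction i hT', h1, map_smul, LinearMap.smul_apply]
  simp only [smul_add, smul_smul]
  congr 1
  · congr 1; ring
  · congr 1; rw [mul_add, mul_one, sgn_add]; ring

theorem pd_contraction (i j : VIdx n m) {p τ : ZMod 2} {c : A} (hc : c ∈ F.gr p)
    {T : A →ₗ[ℝ] A} (hT : F.HasParity τ T) (f : Θ.Fun n m) :
    Θ.pd j c (Θ.contraction i T f) =
      sgn ((p + vPar n m j) * (τ + 1)) • Θ.contraction i T (Θ.pd j c f) := by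
  have hs : ∀ a i t p j : ZMod 2, (p + j) * (a + t + i) + (p + j) * (a + 1 + i) =
      (p + j) * (t + 1) := by decide
  simp only [contraction_apply, map_sum, Finset.smul_sum, Θ.pd_pd j i hc (hT (Θ.mem _)),
    Θ.pd_pd j (conj i) hc (Θ.dual_mem _), map_smul, smul_smul, ← sgn_add, vPar_conj, hs]

theorem pd_laplace (j : VIdx n m) {p τ : ZMod 2} {c : A} (hc : c ∈ F.gr p)
    {T : A →ₗ[ℝ] A} (hT : F.HasParity τ T) (f : Θ.Fun n m) :
    Θ.pd j c (Θ.laplace n m τ T f) =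
      sgn ((p + vPar n m j) * (τ + 1)) • Θ.laplace n m τ T (Θ.pd j c f) := by
  simp only [laplace_apply, map_smul, map_sum, Finset.smul_sum]
  refine Finset.sum_congr rfl fun i _ => ?_
  have hT' : F.HasParity τ (T ∘ₗ F.invPow (1 + vPar n m i)) := by
    have := hT.comp (hasParity_invPow (F := F) (1 + vPar n m i))
    rwa [zero_add] at this
  rw [Θ.pd_contraction i j hc hT']
  simp only [smul_smul]
  congr 1
  ring

/-- Operators with constant coefficients supercommute; the operator of `T` has parity `τ + 1`. -/
theorem laplace_laplace {τ τ' : ZMod 2} {T T' : A →ₗ[ℝ] A} (hT : F.HasParity τ T)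
    (hT' : F.HasParity τ' T') (f : Θ.Fun n m) :
    Θ.laplace n m τ T (Θ.laplace n m τ' T' f) =
      sgn ((τ + 1) * (τ' + 1)) • Θ.laplace n m τ' T' (Θ.laplace n m τ T f) := by
  have hs : ∀ a i t t' : ZMod 2, (a + 1 + i) * (t' + 1) + (a + t + i) * (t' + 1) =
      (t + 1) * (t' + 1) := by decide
  rw [Θ.laplace_apply' τ T f, Θ.laplace_apply' τ T]
  simp only [map_smul, map_sum, Θ.pd_laplace _ (Θ.dual_mem _) hT',
    Θ.pd_laplace _ (hT (Θ.mem _)) hT', smul_smul, ← sgn_add, vPar_conj, hs,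
    Finset.smul_sum]
  refine Finset.sum_congr rfl fun i _ => Finset.sum_congr rfl fun α _ => ?_
  congr 1
  ring

end BasisFrame

end ContractibleDGFrobenius


/-! ### Comparing the odd Laplacian with the Poisson bracket -/

theorem orderPart_induction {K : Type} {par : K → ZMod 2} {N : ℕ}
    {P : ∀ f, f ∈ orderPart par N → Prop}
    (zero : P 0 (Submodule.zero_mem _))
    (add : ∀ f g hf hg, P f hf → P g hg → P (f + g) (Submodule.add_mem _ hf hg))
    (smul : ∀ (a : ℝ) f hf, P f hf → P (a • f) (Submodule.smul_mem _ a hf))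
    (word : ∀ w (hw : N ≤ w.length), P (monomial par w) (Submodule.subset_span ⟨w, hw, rfl⟩))
    {f : SuperPoly par} (hf : f ∈ orderPart par N) : P f hf := by
  induction hf using Submodule.span_induction with
  | mem x hx => obtain ⟨w, hw, rfl⟩ := hx; exact word w hw
  | zero => exact zero
  | add f g hf hg h1 h2 => exact add f g hf hg h1 h2
  | smul a f hf h => exact smul a f hf h

/-- The power of the parity involution on superfunctions. -/
def parityPow {K : Type} (par : K → ZMod 2) (p : ZMod 2) : SuperPoly par →ₗ[ℝ] SuperPoly par :=
  if p = 0 then LinearMap.id else (parityInvolution par).toLinearMap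

theorem parityPow_of_mem {K : Type} {par : K → ZMod 2} (p : ZMod 2) {q : ZMod 2}
    {f : SuperPoly par} (hf : f ∈ parityPart par q) : parityPow par p f = sgn (p * q) • f := by
  rcases zmod_two_cases p with rfl | rfl
  · simp [parityPow]
  · simp [parityPow, parityInvolution_of_mem hf]

namespace ContractibleDGFrobenius

variable {A : Type*} [NonUnitalRing A] [Module ℝ A] [IsScalarTower ℝ A A] [SMulCommClass ℝ A A]

namespace BasisFrame

variable {F : ContractibleDGFrobenius A} (Θ : F.BasisFrame) {n m : ℕ}

/-- Inserting the Casimir element into the traces of two Hamiltonians gives the trace of their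
product. -/
theorem sum_evalTrace_mul {p : ZMod 2} {g h : Ham n m} (hg : g ∈ orderPart (vPar n m) 1)
    (hgp : g ∈ parityPart (vPar n m) p) (hh : h ∈ orderPart (vPar n m) 1) :
    ∑ γ, sgn (Θ.par γ * p) •
      (Θ.evalTrace n m g (0, Θ.e γ, 0) * Θ.evalTrace n m h (0, Θ.dual γ, 0)) =
      Θ.psiLinear n m (g * h) := by
  have h1 : ∑ γ, Θ.evalTrace n m (parityPow (vPar n m) (Θ.par γ) g) (0, Θ.e γ, 0) *
      Θ.evalTrace n m h (0, Θ.dual γ, 0) = Θ.psiLinear n m (g * h) := by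
    clear hgp
    induction hg using orderPart_induction with
    | zero => simp
    | add f g _ _ hf hg =>
      simp only [map_add, LinearMap.add_apply, add_mul, Finset.sum_add_distrib] at hf hg ⊢
      rw [hf, hg]
    | smul a f _ hf =>
      simp only [map_smul, LinearMap.smul_apply, smul_mul_assoc] at hf ⊢
      rw [← Finset.smul_sum, hf]
    | word w hw =>
      have h2 := Θ.sum_evalTrace_mul_monomial w (t := Θ.evalTrace n m h)
        (fun c y => Θ.evalTrace_last hh c y) extHom_one
        (Or.inl (List.ne_nil_of_length_pos hw))
      rw [Frame.psiLinear_apply, Frame.evalTrace_mul, ← h2]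
      refine Finset.sum_congr rfl fun γ _ => ?_
      rw [parityPow_of_mem _ (monomial_mem_parityPart (par := vPar n m) w)]
      simp only [rmul_apply, map_smul, LinearMap.smul_apply, smul_mul_assoc, one_smul, zero_mul,
        add_zero, map_zero, LinearMap.zero_apply]
  rw [← h1]
  refine Finset.sum_congr rfl fun γ _ => ?_
  rw [parityPow_of_mem _ hgp]
  simp only [map_smul, LinearMap.smul_apply, smul_mul_assoc]

/-- The biderivation measuring the failure of the odd Laplacian to be a derivation, as a
derivation in its second argument; `φ` is the parity of the first argument. -/
def antibracket (φ : ZMod 2) (f : Θ.Fun n m) : Θ.Fun n m →ₗ[ℝ] Θ.Fun n m :=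
  ∑ i : VIdx n m, ∑ α, (-(conjSign i *
    sgn (Θ.par α * (1 + vPar n m i) + (Θ.par α + 1 + vPar n m i) * φ))) •
      (LinearMap.mulLeft ℝ (Θ.pd i (Θ.e α) f) ∘ₗ Θ.pd (conj i) (Θ.dual α))

theorem antibracket_apply (φ : ZMod 2) (f g : Θ.Fun n m) : Θ.antibracket φ f g =
    ∑ i : VIdx n m, ∑ α, (-(conjSign i *
      sgn (Θ.par α * (1 + vPar n m i) + (Θ.par α + 1 + vPar n m i) * φ))) •
        (Θ.pd i (Θ.e α) f * Θ.pd (conj i) (Θ.dual α) g) := by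
  simp only [antibracket, LinearMap.sum_apply, LinearMap.smul_apply, LinearMap.comp_apply,
    LinearMap.mulLeft_apply]

theorem isSuperDerivation_antibracket {φ : ZMod 2} {f : Θ.Fun n m}
    (hf : f ∈ parityPart (tensorPar Θ.par n m) φ) :
    IsSuperDerivation (φ + 1) (Θ.antibracket φ f) := by
  refine IsSuperDerivation.sum _ fun i _ => IsSuperDerivation.sum _ fun α _ =>
    IsSuperDerivation.smul _ ?_
  have hs : ∀ a i p : ZMod 2, p + (a + i) + (a + 1 + i) = p + 1 := by decide
  refine (IsSuperDerivation.mulLeft ((Θ.isSuperDerivation_pd i (Θ.mem α)).mem hf)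
    (Θ.isSuperDerivation_pd (conj i) (Θ.dual_mem α))).congr ?_
  rw [vPar_conj, hs]

variable (n m) in
/-- The odd Laplacian on functions on `A ⊗ V`. -/
def oddLaplace : Θ.Fun n m →ₗ[ℝ] Θ.Fun n m := Θ.laplace n m 0 LinearMap.id

theorem oddLaplace_apply (f : Θ.Fun n m) : Θ.oddLaplace n m f =
    (-1 / 2 : ℝ) • ∑ i : VIdx n m, ∑ α, (conjSign i * sgn ((1 + vPar n m i) * Θ.par α)) •
        Θ.pd i (Θ.e α) (Θ.pd (conj i) (Θ.dual α) f) := by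
  rw [oddLaplace, laplace_apply']
  simp

/-- The odd Laplacian has order two. -/
theorem oddLaplace_mul {φ : ZMod 2} {f : Θ.Fun n m}
    (hf : f ∈ parityPart (tensorPar Θ.par n m) φ) (g : Θ.Fun n m) :
    Θ.oddLaplace n m (f * g) = Θ.oddLaplace n m f * g + sgn φ • (f * Θ.oddLaplace n m g) +
      Θ.antibracket φ f g := by
  -- the two cross terms of the Leibniz rule agree by the symmetry of the Casimir element
  have hcross : ∑ i : VIdx n m, ∑ α, (conjSign i * sgn ((1 + vPar n m i) * Θ.par α +
      (Θ.par α + vPar n m i) * (φ + (Θ.par α + 1 + vPar n m i)))) •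
        (Θ.pd (conj i) (Θ.dual α) f * Θ.pd i (Θ.e α) g) =
      ∑ i : VIdx n m, ∑ α, (conjSign i * sgn ((1 + vPar n m i) * Θ.par α +
        (Θ.par α + 1 + vPar n m i) * φ)) •
        (Θ.pd i (Θ.e α) f * Θ.pd (conj i) (Θ.dual α) g) := by
    conv_rhs => rw [← sum_conj]
    refine Finset.sum_congr rfl fun i _ => ?_
    let β : A →ₗ[ℝ] A →ₗ[ℝ] Θ.Fun n m := LinearMap.mk₂ ℝ
      (fun a b => Θ.pd (conj i) a f * Θ.pd i (F.invPow (1 + vPar n m i + φ) b) g)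
      (fun a b c => by simp only [map_add, LinearMap.add_apply, add_mul])
      (fun r a c => by simp only [map_smul, LinearMap.smul_apply, smul_mul_assoc])
      (fun a c c' => by simp only [map_add, LinearMap.add_apply, mul_add])
      (fun r a c => by simp only [map_smul, LinearMap.smul_apply, mul_smul_comm])
    have h := Θ.sum_symm β
    simp only [β, LinearMap.mk₂_apply, F.invPow_of_mem _ (Θ.mem _),
      F.invPow_of_mem _ (Θ.dual_mem _), map_smul, LinearMap.smul_apply, mul_smul_comm] at h
    have hs1 : ∀ a i p : ZMod 2, (1 + i) * a + (a + i) * (p + (a + 1 + i)) =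
        i * p + (1 + i + p) * a := by decide
    have hs2 : ∀ a i p : ZMod 2, (1 + i) * a + (a + 1 + i) * p =
        i + 1 + (i * p + (1 + i + p) * (a + 1)) := by decide
    simp only [hs1, hs2, sgn_add (vPar n m i * φ), conj_conj, vPar_conj, conjSign_conj]
    simp only [sgn_add (vPar n m i + 1), sgn_add (vPar n m i * φ), ← mul_assoc]
    simp only [mul_smul _ (sgn ((1 + vPar n m i + φ) * _)), ← Finset.smul_sum, h]
    congr 1
    rw [sgn_add, sgn_one]
    linear_combination (-(conjSign i * sgn (vPar n m i * φ))) * sgn_mul_self (vPar n m i)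
  have hs3 : ∀ a i p : ZMod 2, (a + 1 + i) * p + (a + i) * p = p := by decide
  have hterm : ∀ (i : VIdx n m) (α : Fin Θ.r), Θ.pd i (Θ.e α) (Θ.pd (conj i) (Θ.dual α) (f * g)) =
      Θ.pd i (Θ.e α) (Θ.pd (conj i) (Θ.dual α) f) * g +
        sgn ((Θ.par α + vPar n m i) * (φ + (Θ.par α + 1 + vPar n m i))) •
          (Θ.pd (conj i) (Θ.dual α) f * Θ.pd i (Θ.e α) g) +
        (sgn ((Θ.par α + 1 + vPar n m i) * φ) •
          (Θ.pd i (Θ.e α) f * Θ.pd (conj i) (Θ.dual α) g) +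
        sgn φ • (f * Θ.pd i (Θ.e α) (Θ.pd (conj i) (Θ.dual α) g))) := by
    intro i α
    have hd := Θ.isSuperDerivation_pd (conj i) (Θ.dual_mem α)
    have he := Θ.isSuperDerivation_pd i (Θ.mem α)
    rw [hd.leibniz g hf, map_add, he.leibniz g (hd.mem hf), map_smul, he.leibniz _ hf, smul_add,
      smul_smul, ← sgn_add, vPar_conj, hs3]
  simp only [oddLaplace_apply, hterm, smul_add, Finset.sum_add_distrib, smul_smul, mul_assoc,
    ← sgn_add] at hcross ⊢
  rw [hcross, antibracket_apply]
  simp only [Finset.sum_mul, Finset.mul_sum, smul_mul_assoc, mul_smul_comm, Finset.smul_sum,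
    smul_smul]
  have hs4 : ∀ i : VIdx n m, ∀ α, -(conjSign i *
      sgn (Θ.par α * (1 + vPar n m i) + (Θ.par α + 1 + vPar n m i) * φ)) =
      (-1 / 2) * (conjSign i *
        sgn ((1 + vPar n m i) * Θ.par α + (Θ.par α + 1 + vPar n m i) * φ)) + (-1 / 2) *
      (conjSign i * sgn ((1 + vPar n m i) * Θ.par α + (Θ.par α + 1 + vPar n m i) * φ)) := by
    intro i α
    rw [_root_.mul_comm (Θ.par α)]
    ring
  simp only [hs4, add_smul, Finset.sum_add_distrib]
  have hs5 : ∀ i : VIdx n m, ∀ α, (-1 / 2 : ℝ) * (conjSign i * (sgn ((1 + vPar n m i) * Θ.par α) *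
      sgn φ)) = sgn φ * (-1 / 2 * (conjSign i * sgn ((1 + vPar n m i) * Θ.par α))) := by
    intro i α; ring
  simp only [sgn_add _ φ, hs5]
  abel

/-- Both derivatives hit the same trace, so that contracting them with the symplectic form of `V`
gives zero. -/
theorem oddLaplace_psiLinear (h : Ham n m) : Θ.oddLaplace n m (Θ.psiLinear n m h) = 0 := by
  have hterm : ∀ (i : VIdx n m) (α : Fin Θ.r), (conjSign i * sgn ((1 + vPar n m i) * Θ.par α)) •
      Θ.pd i (Θ.e α) (Θ.pd (conj i) (Θ.dual α) (Θ.psiLinear n m h)) =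
      sgn (Θ.par α) • Θ.evalTrace n m
        (conjSign i • lderiv (vPar n m) i (lderiv (vPar n m) (conj i) h))
        (F.rmul (Θ.e α) (0, Θ.dual α, 0)) := by
    intro i α
    have hs : ∀ a i : ZMod 2, (1 + i) * a + (i * (1 + (a + 1)) + (a + i) * (1 + a + (a + 1))) = a :=
      by decide
    rw [Θ.pd_psiLinear _ _ (Θ.dual_mem α), map_smul,
      Θ.pd_evalTrace _ _ (Θ.mem α) (extHom_mk (Θ.dual_mem α)), smul_smul, smul_smul,
      mul_assoc, mul_assoc, ← sgn_add, ← sgn_add, vPar_conj, hs, map_smul,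
      LinearMap.smul_apply, smul_smul,
      _root_.mul_comm]
  rw [oddLaplace_apply]
  simp only [hterm]
  rw [Finset.sum_comm]
  simp only [← Finset.smul_sum, ← LinearMap.sum_apply, ← map_sum]
  simp only [sum_conjSign_lderiv, map_zero, LinearMap.zero_apply, smul_zero, Finset.sum_const_zero]

/-- The contraction over `A` joins the two traces into one, and the contraction over `V` turns the
product of the two Hamiltonians into their Poisson bracket. -/
theorem antibracket_psiLinear {p : ZMod 2} {g h : Ham n m} (hg : g ∈ orderPart (vPar n m) 2)
    (hgp : g ∈ parityPart (vPar n m) p) (hh : h ∈ orderPart (vPar n m) 2) :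
    Θ.antibracket (p + 1) (Θ.psiLinear n m g) (Θ.psiLinear n m h) =
      sgn p • Θ.psiLinear n m (bracket n m g h) := by
  rw [antibracket_apply, bracket_apply hgp, map_sum, Finset.smul_sum]
  refine Finset.sum_congr rfl fun i _ => ?_
  rw [map_smul, ← Θ.sum_evalTrace_mul (lderiv_mem _ _ hg) (lderiv_mem_parityPart _ hgp)
    (lderiv_mem _ _ hh), Finset.smul_sum, Finset.smul_sum]
  refine Finset.sum_congr rfl fun α _ => ?_
  have hs : ∀ a i p : ZMod 2, a * (1 + i) + (a + 1 + i) * (p + 1) +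
      (i * (1 + a) + i * (1 + (a + 1))) = 1 + (p + (i * p + a * (i + p))) := by decide
  rw [Θ.pd_psiLinear _ _ (Θ.mem α), Θ.pd_psiLinear _ _ (Θ.dual_mem α), smul_mul_smul_comm,
    smul_smul, smul_smul, smul_smul, ← sgn_add, vPar_conj, neg_mul, mul_assoc, ← sgn_add, hs,
    sgn_add, sgn_one, sgn_add p, sgn_add (vPar n m i * p)]
  congr 1
  ring

end BasisFrame

end ContractibleDGFrobenius


/-! ### Quadratic Hamiltonians -/

section Quadratic

variable {n m : ℕ}

/-- The coefficient of `x_j` in the bracket of a quadratic Hamiltonian `η` of parity `q`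
with `x_k`. -/
def adCoeff (q : ZMod 2) (η : Ham n m) (k j : VIdx n m) : ℝ :=
  conjSign (conj k) * sgn (vPar n m k * q) *
    evalZero (vPar n m) (lderiv (vPar n m) j (lderiv (vPar n m) (conj k) η))

theorem bracket_coord {q : ZMod 2} {η : Ham n m} (hη : η ∈ degreePart (vPar n m) 2)
    (hq : η ∈ parityPart (vPar n m) q) (k : VIdx n m) :
    bracket n m η (coord (vPar n m) k) = ∑ j, adCoeff q η k j • coord (vPar n m) j := by
  rw [bracket_eq_vectorField hq, vectorField_coord]
  conv_lhs => rw [degreePart_one_eq (lderiv_mem_degreePart (conj k) hη)]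
  simp only [Finset.smul_sum, smul_smul, adCoeff]

theorem adCoeff_eq_zero {q : ZMod 2} {η : Ham n m} (hq : η ∈ parityPart (vPar n m) q)
    {k j : VIdx n m} (h : vPar n m j ≠ vPar n m k + q) : adCoeff q η k j = 0 := by
  have h1 := lderiv_mem_parityPart j (lderiv_mem_parityPart (conj k) hq)
  have hs : ∀ j k q : ZMod 2, j ≠ k + q → j + (k + q) = 1 := by decide
  rw [vPar_conj, hs _ _ _ h] at h1
  rw [adCoeff, evalZero_eq_zero_of_odd h1, mul_zero]

/-- Quadratic Hamiltonians act by infinitesimal symmetries of the symplectic form. -/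
theorem adCoeff_symm {q : ZMod 2} {η : Ham n m} (hq : η ∈ parityPart (vPar n m) q)
    (i k : VIdx n m) : conjSign i * adCoeff q η k (conj i) +
      conjSign (conj k) * sgn (q + vPar n m i * q) * adCoeff q η i (conj k) = 0 := by
  by_cases h : vPar n m k = vPar n m i + q
  · have hs : ∀ i q : ZMod 2, q + i * q + i * q + i * (i + q) = i + (i + q) * q := by decide
    rw [adCoeff, adCoeff, lderiv_lderiv (vPar n m) (conj k) (conj i), map_smul,
      smul_eq_mul, conjSign_conj i,
      vPar_conj, vPar_conj]
    generalize evalZero _ _ = x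
    have h1 : sgn (q + vPar n m i * q) * sgn (vPar n m i * q) * sgn (vPar n m k * vPar n m i) =
        sgn (vPar n m i) * sgn (vPar n m k * q) := by
      rw [← sgn_add, ← sgn_add, ← sgn_add, h, _root_.mul_comm _ (vPar n m i), hs]
    linear_combination (-(conjSign (conj k)) * conjSign i * sgn (vPar n m i) * x) * h1 -
      conjSign (conj k) * conjSign i * sgn (vPar n m k * q) * x * sgn_mul_self (vPar n m i)
  · have h' : vPar n m i ≠ vPar n m k + q := fun h2 => h (by
      rw [h2, add_assoc]; simp [CharTwo.add_self_eq_zero])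
    rw [adCoeff_eq_zero hq (by rwa [vPar_conj]), adCoeff_eq_zero hq (by rw [vPar_conj]; exact h)]
    simp

end Quadratic

namespace ContractibleDGFrobenius

variable {A : Type*} [NonUnitalRing A] [Module ℝ A] [IsScalarTower ℝ A A] [SMulCommClass ℝ A A]

namespace BasisFrame

variable {F : ContractibleDGFrobenius A} (Θ : F.BasisFrame) {n m : ℕ}

/-- The components of the vector field on `A ⊗ V` induced by a quadratic Hamiltonian. -/
def hamComponent (q : ZMod 2) (η : Ham n m) (k : Fin Θ.r × VIdx n m) : Θ.Fun n m :=
  ∑ j, (sgn (q * Θ.par k.1) * adCoeff q η k.2 j) • coord (tensorPar Θ.par n m) (k.1, j)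

/-- The vector field on `A ⊗ V` induced by a quadratic Hamiltonian of parity `q`. -/
def hamField (q : ZMod 2) (η : Ham n m) : Θ.Fun n m →ₗ[ℝ] Θ.Fun n m :=
  vectorField (tensorPar Θ.par n m) (Θ.hamComponent q η)

theorem hamComponent_mem {q : ZMod 2} {η : Ham n m} (hq : η ∈ parityPart (vPar n m) q)
    (k : Fin Θ.r × VIdx n m) : Θ.hamComponent q η k ∈
      parityPart (tensorPar Θ.par n m) (tensorPar Θ.par n m k + q) := by
  refine Submodule.sum_mem _ fun j _ => ?_
  by_cases h : vPar n m j = vPar n m k.2 + q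
  · refine Submodule.smul_mem _ _ ?_
    have h1 := coord_mem_parityPart (tensorPar Θ.par n m) (k.1, j)
    simp only [tensorPar] at h1 ⊢
    rwa [h, ← add_assoc] at h1
  · rw [adCoeff_eq_zero hq h, mul_zero, zero_smul]
    exact Submodule.zero_mem _

theorem isSuperDerivation_hamField {q : ZMod 2} {η : Ham n m}
    (hq : η ∈ parityPart (vPar n m) q) : IsSuperDerivation q (Θ.hamField q η) :=
  isSuperDerivation_vectorField (Θ.hamComponent_mem hq)

theorem hamField_coord (q : ZMod 2) (η : Ham n m) (k : Fin Θ.r × VIdx n m) :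
    Θ.hamField q η (coord (tensorPar Θ.par n m) k) = Θ.hamComponent q η k :=
  vectorField_coord _ _

theorem evalZero_hamField (q : ZMod 2) (η : Ham n m) (f : Θ.Fun n m) :
    evalZero (tensorPar Θ.par n m) (Θ.hamField q η f) = 0 := by
  refine evalZero_vectorField (fun k => ?_) f
  simp only [hamComponent, map_sum, map_smul]
  refine Finset.sum_eq_zero fun α _ => ?_
  rw [← mul_one (coord _ _), evalZero_coord_mul, smul_zero]

theorem hamField_evalTrace_monomial {q : ZMod 2} {η : Ham n m}
    (hη : η ∈ degreePart (vPar n m) 2) (hq : η ∈ parityPart (vPar n m) q)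
    (w : List (VIdx n m)) {t : ZMod 2} {c : ℝ × A × ℝ} (hc : F.ExtHom t c) :
    Θ.hamField q η (Θ.evalTrace n m (monomial (vPar n m) w) c) =
      sgn (q * (1 + t)) • Θ.evalTrace n m (bracket n m η (monomial (vPar n m) w)) c := by
  induction w generalizing t c with
  | nil =>
    rw [bracket_eq_vectorField hq]
    simp [(Θ.isSuperDerivation_hamField hq).map_one, (isSuperDerivation_bracket hq).map_one]
  | cons i w ih =>
    have hs1 : ∀ q i t a : ZMod 2, (a + i) * (1 + a + t) + (q * (a + i) + q * (1 + (t + a))) =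
        q * (1 + t) + (q * i + (a + i) * (1 + a + t)) := by decide
    have hs2 : ∀ q i t a : ZMod 2, (a + i) * (1 + a + t) + q * a =
        q * (1 + t) + (a + (i + q)) * (1 + a + t) := by decide
    rw [monomial_cons, Frame.evalTrace_coord_mul, Θ.zeta_apply _ _ hc, bracket_eq_vectorField hq,
      (isSuperDerivation_bracket hq).leibniz _ (coord_mem_parityPart _ i),
      ← bracket_eq_vectorField hq, ← bracket_eq_vectorField hq, bracket_coord hη hq, map_add,
      map_smul, LinearMap.add_apply, LinearMap.smul_apply, Frame.evalTrace_coord_mul,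
      Θ.zeta_apply _ _ hc]
    simp only [Finset.sum_mul, LinearMap.sum_apply, smul_mul_assoc, map_smul,
      LinearMap.smul_apply, Frame.evalTrace_coord_mul,
      Θ.zeta_apply _ _ hc, map_sum, (Θ.isSuperDerivation_hamField hq).leibniz _
        (coord_mem_parityPart (tensorPar Θ.par n m) _), ih (hc.rmul (Θ.mem _)), hamField_coord,
      hamComponent, Finset.sum_mul, smul_add, Finset.smul_sum, Finset.sum_add_distrib,
      mul_smul_comm, smul_smul, ← sgn_add, ← mul_assoc]
    congr 1
    · rw [Finset.sum_comm]
      refine Finset.sum_congr rfl fun j _ => Finset.sum_congr rfl fun α _ => ?_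
      by_cases h : vPar n m j = vPar n m i + q
      · congr 1
        rw [h, mul_right_comm, ← sgn_add, ← hs2, sgn_add]
      · rw [adCoeff_eq_zero hq h]
        simp
    · refine Finset.sum_congr rfl fun α _ => ?_
      simp only [tensorPar, add_assoc] at hs1 ⊢
      rw [hs1]

/-- `Ψ` intertwines the action of quadratic Hamiltonians. -/
theorem hamField_psiLinear {q : ZMod 2} {η : Ham n m} (hη : η ∈ degreePart (vPar n m) 2)
    (hq : η ∈ parityPart (vPar n m) q) (h : Ham n m) :
    Θ.hamField q η (Θ.psiLinear n m h) = sgn q • Θ.psiLinear n m (bracket n m η h) := by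
  simp only [bracket_eq_vectorField hq]
  induction h using superPoly_induction with
  | zero => simp
  | add f g hf hg => simp only [map_add, hf, hg, smul_add]
  | smul a f hf => simp only [map_smul, hf]; rw [smul_comm]
  | word w =>
    rw [Frame.psiLinear_apply, Θ.hamField_evalTrace_monomial hη hq w extHom_one,
      bracket_eq_vectorField hq, add_zero, mul_one]
    rfl

theorem pd_hamField (j : VIdx n m) {p q : ZMod 2} {η : Ham n m}
    (hq : η ∈ parityPart (vPar n m) q) {a : A} (ha : a ∈ F.gr p) (f : Θ.Fun n m) :
    Θ.pd j a (Θ.hamField q η f) = sgn (q * (p + vPar n m j)) • Θ.hamField q η (Θ.pd j a f) +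
      ∑ k, (sgn (q * p) * adCoeff q η k j) • Θ.pd k a f := by
  induction ha using Θ.gr_induction with
  | zero => simp
  | add a b _ _ ha hb =>
    simp only [map_add, LinearMap.add_apply, ha, hb, smul_add, Finset.sum_add_distrib]; abel
  | smul r a _ ha =>
    simp only [map_smul, LinearMap.smul_apply, ha, smul_add, Finset.smul_sum]
    rw [smul_comm r]
    congr 1
    exact Finset.sum_congr rfl fun k _ => smul_comm _ _ _
  | e α h =>
    subst h
    have h2 := lderiv_vectorField (Θ.hamComponent_mem hq) (α, j) f
    simp only [pd_e]
    refine h2.trans ?_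
    congr 1
    rw [Fintype.sum_prod_type, Finset.sum_eq_single α]
    · refine Finset.sum_congr rfl fun k _ => ?_
      simp only [hamComponent, map_sum, map_smul, lderiv_coord, Prod.mk.injEq, true_and]
      rw [Finset.sum_eq_single j]
      · simp only [if_true, smul_mul_assoc, one_mul]
      · intro i _ h; simp [Ne.symm h]
      · simp
    · intro β _ h
      refine Finset.sum_eq_zero fun k _ => ?_
      simp only [hamComponent, map_sum, map_smul, lderiv_coord, Prod.mk.injEq]
      simp [Ne.symm h]
    · simp

/-- Linear vector fields preserving the symplectic form of `V` commute with the operators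
`laplace τ T`, which depend on `V` only through that form. -/
theorem hamField_laplace {q τ : ZMod 2} {η : Ham n m} (hq : η ∈ parityPart (vPar n m) q)
    {T : A →ₗ[ℝ] A} (hT : F.HasParity τ T) (f : Θ.Fun n m) :
    Θ.laplace n m τ T (Θ.hamField q η f) =
      sgn (q * (τ + 1)) • Θ.hamField q η (Θ.laplace n m τ T f) := by
  have hs1 : ∀ a i t q : ZMod 2, q * (a + 1 + i) + q * (a + t + i) = q * (t + 1) := by decide
  have hs2 : ∀ a i t q : ZMod 2, q * (a + 1 + i) + q * (a + t) = q * (1 + i + t) := by decide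
  have hterm : ∀ (i : VIdx n m) (α : Fin Θ.r),
      Θ.pd i (T (Θ.e α)) (Θ.pd (conj i) (Θ.dual α) (Θ.hamField q η f)) =
      sgn (q * (τ + 1)) • Θ.hamField q η (Θ.pd i (T (Θ.e α)) (Θ.pd (conj i) (Θ.dual α) f)) +
      (∑ k, (sgn (q * (1 + vPar n m i + τ)) * adCoeff q η k i) •
          Θ.pd k (T (Θ.e α)) (Θ.pd (conj i) (Θ.dual α) f) +
        ∑ k, (sgn (q * (Θ.par α + 1)) * adCoeff q η k (conj i)) •
          Θ.pd i (T (Θ.e α)) (Θ.pd k (Θ.dual α) f)) := by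
    intro i α
    simp only [Θ.pd_hamField _ hq (Θ.dual_mem _), map_add, map_smul, map_sum,
      Θ.pd_hamField _ hq (hT (Θ.mem _)), smul_add, Finset.smul_sum, smul_smul, ← sgn_add,
      vPar_conj, ← mul_assoc, hs1, hs2]
    exact add_assoc _ _ _
  have hzero : ∀ α, ∑ i : VIdx n m,
      (conjSign i * sgn (vPar n m i * τ + (1 + vPar n m i) * Θ.par α)) •
      (∑ k, (sgn (q * (1 + vPar n m i + τ)) * adCoeff q η k i) •
          Θ.pd k (T (Θ.e α)) (Θ.pd (conj i) (Θ.dual α) f) +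
        ∑ k, (sgn (q * (Θ.par α + 1)) * adCoeff q η k (conj i)) •
          Θ.pd i (T (Θ.e α)) (Θ.pd k (Θ.dual α) f)) = 0 := by
    intro α
    simp only [smul_add, Finset.sum_add_distrib, Finset.smul_sum, smul_smul]
    rw [Finset.sum_comm, ← Finset.sum_add_distrib]
    refine Finset.sum_eq_zero fun i _ => ?_
    rw [← sum_conj, ← Finset.sum_add_distrib]
    refine Finset.sum_eq_zero fun k _ => ?_
    rw [conj_conj, vPar_conj, ← add_smul]
    convert zero_smul ℝ _
    by_cases h : vPar n m k = vPar n m i + q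
    · have hs3 : ∀ i q t a : ZMod 2, (i + q) * t + (1 + (i + q)) * a + q * (1 + (i + q) + t) =
          i * t + (1 + i) * a + q * (a + 1) + (q + i * q) := by decide
      have h1 : sgn (vPar n m k * τ + (1 + vPar n m k) * Θ.par α) *
          sgn (q * (1 + vPar n m k + τ)) =
          sgn (vPar n m i * τ + (1 + vPar n m i) * Θ.par α) * sgn (q * (Θ.par α + 1)) *
            sgn (q + vPar n m i * q) := by
        rw [← sgn_add, ← sgn_add, ← sgn_add, h, hs3]
      linear_combination (conjSign (conj k) * adCoeff q η i (conj k)) * h1 +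
        (sgn (vPar n m i * τ + (1 + vPar n m i) * Θ.par α) * sgn (q * (Θ.par α + 1))) *
          adCoeff_symm hq i k
    · have h' : vPar n m i ≠ vPar n m k + q := fun h2 => h (by
        rw [h2, add_assoc]; simp [CharTwo.add_self_eq_zero])
      rw [adCoeff_eq_zero hq (by rwa [vPar_conj]), adCoeff_eq_zero hq (by rwa [vPar_conj])]
      simp
  rw [laplace_apply', laplace_apply', map_smul, smul_comm (sgn _)]
  congr 1
  simp only [hterm, smul_add _ (sgn _ • _), Finset.sum_add_distrib, map_sum, map_smul,
    Finset.smul_sum, smul_smul]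
  rw [Finset.sum_comm (f := fun i α => (conjSign i *
    sgn (vPar n m i * τ + (1 + vPar n m i) * Θ.par α)) • (_ + _))]
  rw [Finset.sum_eq_zero fun α _ => hzero α, add_zero]
  refine Finset.sum_congr rfl fun i _ => Finset.sum_congr rfl fun α _ => ?_
  congr 1
  ring

end BasisFrame

end ContractibleDGFrobenius


/-! ### Exponentials of locally nilpotent operators -/

section Nilpotent

variable {M : Type*} [AddCommMonoid M] [Module ℝ M]

/-- The sum of a sequence of linear functionals, only finitely many of which are nonzero on any
given vector. -/
def sumFunctional (φ : ℕ → M →ₗ[ℝ] ℝ) (h : ∀ f, ∃ N, ∀ j, N ≤ j → φ j f = 0) : M →ₗ[ℝ] ℝ :=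
  have hfin : ∀ f, (Function.support fun j => φ j f).Finite := fun f => by
    obtain ⟨N, hN⟩ := h f
    refine (Set.finite_lt_nat N).subset fun j hj => ?_
    by_contra hlt
    exact hj (hN j (not_lt.1 hlt))
  { toFun := fun f => ∑ᶠ j, φ j f
    map_add' := fun f g => by
      rw [← finsum_add_distrib (hfin f) (hfin g)]
      simp only [map_add]
    map_smul' := fun a f => by
      simp only [map_smul, smul_finsum, RingHom.id_apply] }

theorem sumFunctional_eq (φ : ℕ → M →ₗ[ℝ] ℝ) (h : ∀ f, ∃ N, ∀ j, N ≤ j → φ j f = 0) {f : M}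
    {N : ℕ} (hN : ∀ j, N ≤ j → φ j f = 0) :
    sumFunctional φ h f = ∑ j ∈ Finset.range N, φ j f := by
  refine finsum_eq_sum_of_support_subset _ fun j hj => ?_
  simp only [Finset.coe_range, Set.mem_Iio]
  by_contra hlt
  exact hj (hN j (not_lt.1 hlt))

/-- `P` lowers an exhaustive increasing filtration starting with `0`. -/
structure Lowers (Fil : ℕ → Submodule ℝ M) (P : M →ₗ[ℝ] M) : Prop where
  zero : Fil 0 = ⊥
  mono : Monotone Fil
  exhaustive : ∀ f, ∃ N, f ∈ Fil N
  lower : ∀ N, ∀ f ∈ Fil (N + 1), P f ∈ Fil N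

namespace Lowers

variable {Fil : ℕ → Submodule ℝ M} {P P' R D Δ : M →ₗ[ℝ] M} (hP : Lowers Fil P)
  (hP' : Lowers Fil P') (ev : M →ₗ[ℝ] ℝ)

include hP

theorem pow_mem (N j : ℕ) {f : M} (hf : f ∈ Fil (N + j)) : (P ^ j) f ∈ Fil N := by
  induction j generalizing N with
  | zero => simpa using hf
  | succ j ih =>
    rw [pow_succ', Module.End.mul_apply]
    exact hP.lower _ _ (ih (N + 1) (by rwa [add_assoc, add_comm 1 j]))

theorem pow_eq_zero {N j : ℕ} (h : N ≤ j) {f : M} (hf : f ∈ Fil N) : (P ^ j) f = 0 := by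
  have h1 := hP.pow_mem 0 j (f := f) (by rw [zero_add]; exact hP.mono h hf)
  rwa [hP.zero, Submodule.mem_bot] at h1

/-- The functional `ev ∘ exp P`. -/
def expFunctional : M →ₗ[ℝ] ℝ :=
  sumFunctional (fun j => (j.factorial : ℝ)⁻¹ • (ev ∘ₗ (P ^ j))) fun f => by
    obtain ⟨N, hN⟩ := hP.exhaustive f
    exact ⟨N, fun j hj => by simp [hP.pow_eq_zero hj hN]⟩

theorem expFunctional_eq {N : ℕ} {f : M} (hf : f ∈ Fil N) : hP.expFunctional ev f =
    ∑ j ∈ Finset.range N, (j.factorial : ℝ)⁻¹ * ev ((P ^ j) f) :=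
  sumFunctional_eq _ _ fun j hj => by simp [hP.pow_eq_zero hj hf]

theorem expFunctional_of_eq_zero {f : M} (hf : P f = 0) : hP.expFunctional ev f = ev f := by
  obtain ⟨N, hN⟩ := hP.exhaustive f
  rw [hP.expFunctional_eq ev (hP.mono N.le_succ hN), Finset.sum_range_succ',
    Finset.sum_eq_zero fun j _ => ?_]
  · simp
  · rw [pow_succ, Module.End.mul_apply, hf, map_zero, map_zero, mul_zero]

omit hP in
theorem pow_comp {Z Y : M →ₗ[ℝ] M} (hZ : ∀ f, P (Z f) = Z (P f) + Y f)
    (hY : ∀ f, P (Y f) = Y (P f)) (j : ℕ) (f : M) :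
    (P ^ (j + 1)) (Z f) = Z ((P ^ (j + 1)) f) + ((j + 1 : ℕ) : ℝ) • Y ((P ^ j) f) := by
  induction j with
  | zero => simp [hZ]
  | succ j ih =>
    have e : ∀ j g, (P ^ (j + 1)) g = P ((P ^ j) g) := fun j g => by rw [pow_succ']; rfl
    rw [e (j + 1), ih, map_add, hZ, map_smul, hY, ← e, ← e, add_assoc]
    congr 1
    rw [Nat.cast_succ (j + 1), add_smul, one_smul, add_comm]

/-- If `[P, Z] = Y` commutes with `P` and `ev ∘ Z = 0`, then `Z` may be replaced by `Y` under
`ev ∘ exp P`. -/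
theorem expFunctional_comp {Z Y : M →ₗ[ℝ] M} (hZ : ∀ f, P (Z f) = Z (P f) + Y f)
    (hY : ∀ f, P (Y f) = Y (P f)) (hev : ∀ f, ev (Z f) = 0) (f : M) :
    hP.expFunctional ev (Z f) = hP.expFunctional ev (Y f) := by
  obtain ⟨N, hN⟩ := hP.exhaustive (Z f)
  obtain ⟨N', hN'⟩ := hP.exhaustive (Y f)
  have hYj : ∀ j, (P ^ j) (Y f) = Y ((P ^ j) f) := fun j => by
    induction j with
    | zero => rfl
    | succ j ih => rw [pow_succ', Module.End.mul_apply, ih, hY]; rfl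
  rw [hP.expFunctional_eq ev (hP.mono (Nat.le_succ_of_le (le_max_left N N')) hN),
    hP.expFunctional_eq ev (hP.mono (le_max_right N N') hN'), Finset.sum_range_succ']
  rw [pow_zero, Module.End.one_apply, hev, mul_zero, add_zero]
  refine Finset.sum_congr rfl fun j _ => ?_
  rw [pow_comp hZ hY, map_add, hev, zero_add, map_smul, hYj, Nat.factorial_succ, smul_eq_mul]
  push_cast
  field_simp

omit hP in
variable (P P') in
/-- The sums `∑_{i < j} P^i P'^{j - 1 - i}`. -/
def geomSum : ℕ → M →ₗ[ℝ] M
  | 0 => 0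
  | j + 1 => P ∘ₗ geomSum j + P' ^ j

omit hP in
theorem geomSum_succ_apply (j : ℕ) (f : M) :
    geomSum P P' (j + 1) f = P (geomSum P P' j f) + (P' ^ j) f := rfl

include hP' in
theorem geomSum_mem (N j : ℕ) {f : M} (hf : f ∈ Fil (N + j)) :
    geomSum P P' (j + 1) f ∈ Fil N := by
  induction j generalizing N with
  | zero => simpa [geomSum] using hf
  | succ j ih =>
    rw [geomSum_succ_apply]
    refine Submodule.add_mem _ (hP.lower _ _ (ih (N + 1) ?_)) (hP'.pow_mem _ _ hf)
    rwa [add_assoc, add_comm 1 j]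

include hP' in
theorem geomSum_eq_zero {N j : ℕ} (h : N + 1 ≤ j) {f : M} (hf : f ∈ Fil N) :
    geomSum P P' j f = 0 := by
  obtain ⟨j, rfl⟩ := Nat.exists_eq_add_one_of_ne_zero
    (Nat.ne_of_gt (Nat.lt_of_lt_of_le N.succ_pos h))
  have h1 := hP.geomSum_mem hP' 0 j (f := f)
    (by rw [zero_add]; exact hP.mono (Nat.le_of_succ_le_succ h) hf)
  rwa [hP.zero, Submodule.mem_bot] at h1

variable (R) in
/-- The functional `ev ∘ ((exp P' - exp P) / (P' - P)) ∘ R`. -/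
def homotopyFunctional : M →ₗ[ℝ] ℝ :=
  sumFunctional (fun j => (j.factorial : ℝ)⁻¹ • (ev ∘ₗ geomSum P P' j ∘ₗ R)) fun f => by
    obtain ⟨N, hN⟩ := hP.exhaustive (R f)
    exact ⟨N + 1, fun j hj => by simp [hP.geomSum_eq_zero hP' hj hN]⟩

theorem homotopyFunctional_eq {N : ℕ} {f : M} (hf : R f ∈ Fil N) :
    homotopyFunctional R hP hP' ev f =
      ∑ j ∈ Finset.range (N + 1), (j.factorial : ℝ)⁻¹ * ev (geomSum P P' j (R f)) :=
  sumFunctional_eq _ _ fun j hj => by simp [hP.geomSum_eq_zero hP' hj hf]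

omit hP in
theorem geomSum_comm {X : M →ₗ[ℝ] M} (hX : ∀ f, P (X f) = X (P f))
    (hX' : ∀ f, P' (X f) = X (P' f)) (j : ℕ) (f : M) :
    geomSum P P' j (X f) = X (geomSum P P' j f) := by
  have hpow : ∀ j, (P' ^ j) (X f) = X ((P' ^ j) f) := fun j => by
    induction j with
    | zero => rfl
    | succ j ih => rw [pow_succ', Module.End.mul_apply, ih, hX']; rfl
  induction j with
  | zero => simp [geomSum]
  | succ j ih => rw [geomSum_succ_apply, geomSum_succ_apply, ih, hX, hpow, map_add]

theorem homotopyFunctional_comp {X : M →ₗ[ℝ] M} (hX : ∀ f, P (X f) = X (P f))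
    (hX' : ∀ f, P' (X f) = X (P' f)) {a : ℝ} (hR : ∀ f, R (X f) = a • X (R f))
    (hev : ∀ f, ev (X f) = 0) (f : M) : homotopyFunctional R hP hP' ev (X f) = 0 := by
  obtain ⟨N, hN⟩ := hP.exhaustive (R (X f))
  rw [hP.homotopyFunctional_eq hP' ev hN]
  refine Finset.sum_eq_zero fun j _ => ?_
  rw [hR, map_smul, geomSum_comm hX hX', map_smul, hev, smul_zero, mul_zero]

omit hP in
theorem geomSum_sub (hPP' : ∀ f, P (P' f) = P' (P f)) (j : ℕ) (f : M) :
    geomSum P P' j (P' f) + (P ^ j) f = geomSum P P' j (P f) + (P' ^ j) f := by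
  have hpow : ∀ j, (P' ^ j) (P f) = P ((P' ^ j) f) := fun j => by
    induction j with
    | zero => rfl
    | succ j ih => rw [pow_succ', Module.End.mul_apply, ih, ← hPP']; rfl
  induction j with
  | zero => simp [geomSum]
  | succ j ih =>
    have e1 : (P' ^ j) (P' f) = (P' ^ (j + 1)) f := by rw [pow_succ]; rfl
    rw [geomSum_succ_apply, geomSum_succ_apply, e1, hpow, pow_succ' P, Module.End.mul_apply,
      add_right_comm, ← map_add, ih, map_add]

omit hP in
theorem geomSum_comp (hD : ∀ f, P (D f) = D (P f) + (-1 : ℝ) • Δ f)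
    (hD' : ∀ f, P' (D f) = D (P' f) + (-1 : ℝ) • Δ f) (hΔ : ∀ f, P (Δ f) = Δ (P f))
    (hΔ' : ∀ f, P' (Δ f) = Δ (P' f)) (j : ℕ) (f : M) : geomSum P P' (j + 1) (D f) =
      D (geomSum P P' (j + 1) f) + (-((j + 1 : ℕ) : ℝ)) • Δ (geomSum P P' j f) := by
  induction j with
  | zero => simp [geomSum]
  | succ j ih =>
    have h1 := pow_comp (Y := (-1 : ℝ) • Δ) hD' (fun f => by simp [hΔ']) j f
    have h2 : Δ (geomSum P P' (j + 1) f) = Δ (P (geomSum P P' j f)) + Δ ((P' ^ j) f) := by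
      rw [geomSum_succ_apply, map_add]
    rw [geomSum_succ_apply, ih, h1, geomSum_succ_apply (j + 1), map_add, map_add, hD, map_smul,
      hΔ, LinearMap.smul_apply, smul_smul, h2]
    push_cast
    module

/-- If `P' - P` is the supercommutator of `D` and `R`, then `ev ∘ exp P'` and `ev ∘ exp P` are
homotopic with respect to the deformed differential `D + Δ`. -/
theorem expFunctional_sub (hPP' : ∀ f, P (P' f) = P' (P f))
    (hD : ∀ f, P (D f) = D (P f) + (-1 : ℝ) • Δ f)
    (hD' : ∀ f, P' (D f) = D (P' f) + (-1 : ℝ) • Δ f) (hΔ : ∀ f, P (Δ f) = Δ (P f))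
    (hΔ' : ∀ f, P' (Δ f) = Δ (P' f)) (hR : ∀ f, D (R f) + R (D f) + P f = P' f)
    (hRΔ : ∀ f, R (Δ f) = (-1 : ℝ) • Δ (R f)) (hev : ∀ f, ev (D f) = 0) (f : M) :
    hP'.expFunctional ev f - hP.expFunctional ev f =
      homotopyFunctional R hP hP' ev (D f + Δ f) := by
  have hbound : ∃ N, f ∈ Fil N ∧ D (R f) ∈ Fil N ∧ R (D f) ∈ Fil N ∧ R f ∈ Fil N ∧
      R (Δ f) ∈ Fil N := by
    obtain ⟨N1, h1⟩ := hP.exhaustive f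
    obtain ⟨N2, h2⟩ := hP.exhaustive (D (R f))
    obtain ⟨N3, h3⟩ := hP.exhaustive (R (D f))
    obtain ⟨N4, h4⟩ := hP.exhaustive (R f)
    obtain ⟨N5, h5⟩ := hP.exhaustive (R (Δ f))
    exact ⟨N1 + N2 + N3 + N4 + N5, hP.mono (by omega) h1, hP.mono (by omega) h2,
      hP.mono (by omega) h3, hP.mono (by omega) h4, hP.mono (by omega) h5⟩
  obtain ⟨N, h1, h2, h3, h4, h5⟩ := hbound
  have hkey : ∀ j, ev ((P' ^ j) f) - ev ((P ^ j) f) =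
      ev (geomSum P P' j (D (R f))) + ev (geomSum P P' j (R (D f))) := by
    intro j
    have h := congrArg ev (geomSum_sub hPP' j f)
    rw [← hR f] at h
    simp only [map_add] at h
    linarith
  have hN : ∀ j : ℕ, (((j + 1).factorial : ℝ))⁻¹ * ev (geomSum P P' (j + 1) (D (R f))) =
      (j.factorial : ℝ)⁻¹ * ev (geomSum P P' j (R (Δ f))) := by
    intro j
    rw [geomSum_comp hD hD' hΔ hΔ', map_add, hev, zero_add, map_smul, hRΔ, map_smul, map_smul,
      geomSum_comm hΔ hΔ', Nat.factorial_succ, smul_eq_mul, smul_eq_mul]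
    push_cast
    field_simp
  have hDR : ∑ j ∈ Finset.range (N + 1 + 1), (j.factorial : ℝ)⁻¹ *
      ev (geomSum P P' j (D (R f))) = ∑ j ∈ Finset.range (N + 1),
        (j.factorial : ℝ)⁻¹ * ev (geomSum P P' j (R (Δ f))) := by
    rw [Finset.sum_range_succ']
    simp only [hN]
    simp [geomSum]
  rw [hP'.expFunctional_eq ev (hP.mono (show N ≤ N + 1 + 1 by omega) h1),
    hP.expFunctional_eq ev (hP.mono (show N ≤ N + 1 + 1 by omega) h1), ← Finset.sum_sub_distrib,
    map_add, hP.homotopyFunctional_eq hP' ev h5, ← hDR,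
    hP.homotopyFunctional_eq hP' ev (hP.mono (show N ≤ N + 1 by omega) h3),
    ← Finset.sum_add_distrib]
  refine Finset.sum_congr rfl fun j _ => ?_
  rw [← mul_sub, hkey]
  ring

end Lowers

end Nilpotent


/-! ### The propagator and the expectation functional -/

section Filtration

variable {K : Type} (par : K → ZMod 2)

/-- The superfunctions all of whose derivatives of order at least `N` vanish. -/
def lowPart (N : ℕ) : Submodule ℝ (SuperPoly par) :=
  ⨅ w : {w : List K // N ≤ w.length}, LinearMap.ker (wordDeriv par w)

theorem mem_lowPart {N : ℕ} {f : SuperPoly par} :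
    f ∈ lowPart par N ↔ ∀ w : List K, N ≤ w.length → wordDeriv par w f = 0 := by
  simp [lowPart]

theorem lowPart_zero : lowPart par 0 = ⊥ := by
  refine (Submodule.eq_bot_iff _).2 fun f hf => ?_
  exact (mem_lowPart par).1 hf [] (Nat.zero_le _)

theorem lowPart_mono : Monotone (lowPart par) := fun _ _ h _ hf =>
  (mem_lowPart par).2 fun w hw => (mem_lowPart par).1 hf w (h.trans hw)

theorem exists_mem_lowPart (f : SuperPoly par) : ∃ N, f ∈ lowPart par N := by
  obtain ⟨M, hM⟩ := exists_wordDeriv_eq_zero f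
  exact ⟨M, (mem_lowPart par).2 fun w hw => hM w hw⟩

theorem lderiv_mem_lowPart (k : K) {N : ℕ} {f : SuperPoly par} (hf : f ∈ lowPart par (N + 1)) :
    lderiv par k f ∈ lowPart par N :=
  (mem_lowPart par).2 fun w hw => (mem_lowPart par).1 hf (k :: w) (by simpa using hw)

end Filtration

variable {n m : ℕ}

theorem sum_ite_conj {M ι : Type*} [AddCommMonoid M] [Module ℝ M] [Fintype ι] (j : VIdx n m)
    (c : VIdx n m → ι → ℝ) (X : VIdx n m → ι → M) :
    ∑ i : VIdx n m, ∑ α, c i α • (if conj i = j then X i α else 0) =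
      ∑ α, c (conj j) α • X (conj j) α := by
  rw [← sum_conj, Finset.sum_eq_single j]
  · simp
  · intro i _ h; simp [h]
  · simp

theorem sum_ite_smul {M ι : Type*} [AddCommMonoid M] [Module ℝ M] [Fintype ι] (j : VIdx n m)
    (c c' : VIdx n m → ι → ℝ) (X : VIdx n m → ι → M) :
    ∑ i : VIdx n m, ∑ α, c i α • c' i α • (if i = j then X i α else 0) =
      ∑ α, c j α • c' j α • X j α := by
  rw [Finset.sum_eq_single j]
  · simp
  · intro i _ h; simp [h]
  · simp

namespace ContractibleDGFrobenius

variable {A : Type*} [NonUnitalRing A] [Module ℝ A] [IsScalarTower ℝ A A] [SMulCommClass ℝ A A]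

variable {F : ContractibleDGFrobenius A}

theorem IsHomotopy.hasParity {L : Submodule ℝ A} {s : A →ₗ[ℝ] A} (hs : F.IsHomotopy L s) :
    F.HasParity 1 s := fun _ _ ha => hs.odd ha

namespace BasisFrame

variable (Θ : F.BasisFrame) {n m : ℕ}

theorem pd_mem_lowPart (i : VIdx n m) (a : A) {N : ℕ} {f : Θ.Fun n m}
    (hf : f ∈ lowPart (tensorPar Θ.par n m) (N + 1)) :
    Θ.pd i a f ∈ lowPart (tensorPar Θ.par n m) N := by
  rw [pd_apply]
  exact Submodule.sum_mem _ fun γ _ => Submodule.smul_mem _ _ (lderiv_mem_lowPart _ _ hf)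

theorem laplace_mem_lowPart (τ : ZMod 2) (T : A →ₗ[ℝ] A) {N : ℕ} {f : Θ.Fun n m}
    (hf : f ∈ lowPart (tensorPar Θ.par n m) (N + 1)) :
    Θ.laplace n m τ T f ∈ lowPart (tensorPar Θ.par n m) N := by
  have h : ∀ (i : VIdx n m) (α : Fin Θ.r), Θ.pd i (T (Θ.e α)) (Θ.pd (conj i) (Θ.dual α) f) ∈
      lowPart (tensorPar Θ.par n m) N := fun i α =>
    Θ.pd_mem_lowPart i _ (lowPart_mono _ N.le_succ (Θ.pd_mem_lowPart (conj i) _ hf))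
  rw [laplace_apply']
  exact Submodule.smul_mem _ _ (Submodule.sum_mem _ fun i _ => Submodule.sum_mem _ fun α _ =>
      Submodule.smul_mem _ _ (h i α))

variable (n m) in
theorem lowers_laplace (τ : ZMod 2) (T : A →ₗ[ℝ] A) :
    Lowers (lowPart (tensorPar Θ.par n m)) (Θ.laplace n m τ T) :=
  ⟨lowPart_zero _, lowPart_mono _, exists_mem_lowPart _,
    fun _ _ hf => Θ.laplace_mem_lowPart τ T hf⟩

theorem pd_pd_coord_mul {s : A →ₗ[ℝ] A} (hs : F.HasParity 1 s) (κ : Fin Θ.r) (j : VIdx n m)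
    (f : Θ.Fun n m) (i : VIdx n m) (α : Fin Θ.r) :
    Θ.pd i (s (Θ.e α)) (Θ.pd (conj i) (Θ.dual α) (coord (tensorPar Θ.par n m) (κ, j) * f)) =
    coord (tensorPar Θ.par n m) (κ, j) * Θ.pd i (s (Θ.e α)) (Θ.pd (conj i) (Θ.dual α) f) +
    ((if conj i = j then Θ.basis.repr (Θ.dual α) κ • Θ.pd i (s (Θ.e α)) f else 0) +
     sgn ((Θ.par α + 1 + vPar n m i) * (Θ.par κ + vPar n m j)) •
      (if i = j then Θ.basis.repr (s (Θ.e α)) κ • Θ.pd (conj i) (Θ.dual α) f else 0)) := by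
  have hs1 : ∀ a i k : ZMod 2, (a + 1 + i) * k + (a + 1 + i) * k = 0 := by decide
  have hd := Θ.isSuperDerivation_pd (conj i) (Θ.dual_mem α)
  have he := Θ.isSuperDerivation_pd i (hs (Θ.mem α))
  have hc := coord_mem_parityPart (tensorPar Θ.par n m) (κ, j)
  rw [hd.leibniz _ hc, map_add, map_smul, he.leibniz _ hc, pd_coord, pd_coord, smul_add,
    smul_smul, ← sgn_add, vPar_conj, hs1, sgn_zero, one_smul]
  have h1 : Θ.pd i (s (Θ.e α)) ((if conj i = j then Θ.basis.repr (Θ.dual α) κ •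
      (1 : Θ.Fun n m) else 0) * f) =
      if conj i = j then Θ.basis.repr (Θ.dual α) κ • Θ.pd i (s (Θ.e α)) f else 0 := by
    split_ifs <;> simp
  have h2 : (if i = j then Θ.basis.repr (s (Θ.e α)) κ • (1 : Θ.Fun n m) else 0) *
      Θ.pd (conj i) (Θ.dual α) f =
      if i = j then Θ.basis.repr (s (Θ.e α)) κ • Θ.pd (conj i) (Θ.dual α) f else 0 := by
    split_ifs <;> simp
  rw [h1, h2]
  simp only [tensorPar]
  abel

/-- The first cross term of the propagator and the multiplication by a coordinate. -/
theorem sum_crossTerm_left (κ : Fin Θ.r) (j : VIdx n m) (s : A →ₗ[ℝ] A) (f : Θ.Fun n m) :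
    ∑ α, (conjSign (conj j) * sgn (vPar n m j * 1 + (1 + vPar n m j) * Θ.par α)) •
    (Θ.basis.repr (Θ.dual α) κ • Θ.pd (conj j) (s (Θ.e α)) f) =
    (-(sgn (Θ.par κ * (1 + vPar n m j)) * conjSign (conj j))) •
      Θ.pd (conj j) (s (Θ.dual κ)) f := by
  have h1 : ∑ α, Θ.basis.repr (Θ.dual α) κ • Θ.e α = Θ.dual κ := by
    simp only [← Θ.form_dual]
    conv_rhs => rw [← Θ.sum_form_dual (Θ.dual κ)]
    exact Finset.sum_congr rfl fun α _ => by rw [F.form_comm]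
  conv_rhs => rw [← h1]
  simp only [map_sum, map_smul, LinearMap.sum_apply, LinearMap.smul_apply, Finset.smul_sum,
    smul_smul]
  refine Finset.sum_congr rfl fun α _ => ?_
  by_cases h : Θ.par κ = Θ.par α + 1
  · have hs2 : ∀ a j : ZMod 2, j * 1 + (1 + j) * a = 1 + (a + 1) * (1 + j) := by decide
    rw [h, hs2, sgn_add, sgn_one]
    congr 1
    ring
  · rw [Θ.repr_eq_zero (Θ.dual_mem α) h]; simp

/-- The second cross term of the propagator and the multiplication by a coordinate. -/
theorem sum_crossTerm_right {s : A →ₗ[ℝ] A} (hs : F.HasParity 1 s)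
    (hadj : ∀ {p : ZMod 2} {a : A}, a ∈ F.gr p → ∀ b, F.form (s a) b = sgn p * F.form a (s b))
    (κ : Fin Θ.r) (j : VIdx n m) (f : Θ.Fun n m) :
    ∑ α, (conjSign j * sgn (vPar n m j * 1 + (1 + vPar n m j) * Θ.par α)) •
    sgn ((Θ.par α + 1 + vPar n m j) * (Θ.par κ + vPar n m j)) •
    (Θ.basis.repr (s (Θ.e α)) κ • Θ.pd (conj j) (Θ.dual α) f) =
    (-(sgn (Θ.par κ * (1 + vPar n m j)) * conjSign (conj j))) •
      Θ.pd (conj j) (s (Θ.dual κ)) f := by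
  have h1 : ∑ α, (sgn (Θ.par κ + 1) * Θ.basis.repr (s (Θ.e α)) κ) • Θ.dual α =
      s (Θ.dual κ) := by
    conv_rhs => rw [← Θ.sum_form (s (Θ.dual κ))]
    refine Finset.sum_congr rfl fun α _ => ?_
    rw [← Θ.form_dual, F.form_comm (Θ.e α), hadj (Θ.dual_mem κ)]
  conv_rhs => rw [← h1]
  simp only [map_sum, map_smul, LinearMap.sum_apply, LinearMap.smul_apply, Finset.smul_sum,
    smul_smul]
  refine Finset.sum_congr rfl fun α _ => ?_
  by_cases h : Θ.par κ = Θ.par α + 1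
  · have hs2 : ∀ a j : ZMod 2, j * 1 + (1 + j) * a + (a + 1 + j) * (a + 1 + j) =
        j + ((a + 1) * (1 + j) + (a + 1 + 1)) := by decide
    have h3 : conjSign j = -sgn (vPar n m j) * conjSign (conj j) := by
      rw [conjSign_conj]
      linear_combination (-conjSign j) * sgn_mul_self (vPar n m j)
    have h4 : sgn (vPar n m j * 1 + (1 + vPar n m j) * Θ.par α) *
        sgn ((Θ.par α + 1 + vPar n m j) * (Θ.par α + 1 + vPar n m j)) =
        sgn (vPar n m j) * (sgn ((Θ.par α + 1) * (1 + vPar n m j)) * sgn (Θ.par α + 1 + 1)) := by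
      rw [← sgn_add, ← sgn_add, ← sgn_add, hs2]
    rw [h, h3]
    congr 1
    linear_combination (-sgn (vPar n m j) * conjSign (conj j) *
      Θ.basis.repr (s (Θ.e α)) κ) * h4 - (conjSign (conj j) * Θ.basis.repr (s (Θ.e α)) κ *
      (sgn ((Θ.par α + 1) * (1 + vPar n m j)) * sgn (Θ.par α + 1 + 1))) *
        sgn_mul_self (vPar n m j)
  · rw [Θ.repr_eq_zero (hs (Θ.mem α)) h]; simp

/-- Multiplication by a coordinate and the propagator commute up to a derivative. -/
theorem laplace_coord_mul {s : A →ₗ[ℝ] A} (hs : F.HasParity 1 s)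
    (hadj : ∀ {p : ZMod 2} {a : A}, a ∈ F.gr p → ∀ b, F.form (s a) b = sgn p * F.form a (s b))
    (k : Fin Θ.r × VIdx n m) (f : Θ.Fun n m) :
    Θ.laplace n m 1 s (coord (tensorPar Θ.par n m) k * f) =
      coord (tensorPar Θ.par n m) k * Θ.laplace n m 1 s f +
        (sgn (Θ.par k.1 * (1 + vPar n m k.2)) * conjSign (conj k.2)) •
          Θ.pd (conj k.2) (s (Θ.dual k.1)) f := by
  obtain ⟨κ, j⟩ := k
  rw [laplace_apply', laplace_apply']
  simp only [Θ.pd_pd_coord_mul hs κ j f, smul_add, Finset.sum_add_distrib]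
  rw [sum_ite_conj, sum_ite_smul]
  simp only [vPar_conj]
  rw [Θ.sum_crossTerm_left κ j s f, Θ.sum_crossTerm_right hs hadj κ j f]
  congr 1
  · simp only [Finset.mul_sum, mul_smul_comm]
  · rw [smul_smul, ← add_smul]
    congr 1
    ring

end BasisFrame

end ContractibleDGFrobenius


namespace ContractibleDGFrobenius

variable {A : Type*} [NonUnitalRing A] [Module ℝ A] [IsScalarTower ℝ A A] [SMulCommClass ℝ A A]

variable {F : ContractibleDGFrobenius A}

namespace BasisFrame

/-! ### Restriction to subspaces -/

variable (Θ : F.BasisFrame) (Θ' : F.Frame) {n m : ℕ}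

variable (n m) in
/-- The restriction of the coordinate functions of `A ⊗ V` to the span of a frame. -/
def restrictCoord (k : Fin Θ.r × VIdx n m) : Θ'.Fun n m :=
  ∑ β, Θ.basis.repr (Θ'.e β) k.1 • coord (tensorPar Θ'.par n m) (β, k.2)

theorem restrictCoord_mem (k : Fin Θ.r × VIdx n m) :
    Θ.restrictCoord Θ' n m k ∈ parityPart (tensorPar Θ'.par n m) (tensorPar Θ.par n m k) := by
  refine Submodule.sum_mem _ fun β _ => ?_
  by_cases h : Θ.par k.1 = Θ'.par β
  · refine Submodule.smul_mem _ _ ?_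
    have h1 := coord_mem_parityPart (tensorPar Θ'.par n m) (β, k.2)
    simp only [tensorPar] at h1 ⊢
    rwa [h]
  · rw [Θ.repr_eq_zero (Θ'.mem β) h, zero_smul]
    exact Submodule.zero_mem _

variable (n m) in
/-- The restriction of functions on `A ⊗ V` to the span of a frame. -/
def restrict : Θ.Fun n m →ₐ[ℝ] Θ'.Fun n m :=
  lift (tensorPar Θ.par n m) (Θ.restrictCoord Θ' n m) fun j k =>
    mul_comm_of_mem (Θ.restrictCoord_mem Θ' j) (Θ.restrictCoord_mem Θ' k)

theorem restrict_coord (k : Fin Θ.r × VIdx n m) :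
    Θ.restrict Θ' n m (coord (tensorPar Θ.par n m) k) = Θ.restrictCoord Θ' n m k :=
  lift_coord _ _ _ _

theorem restrict_evalTrace_monomial (w : List (VIdx n m)) {q : ZMod 2} {c : ℝ × A × ℝ}
    (hc : F.ExtHom q c) : Θ.restrict Θ' n m (Θ.evalTrace n m (monomial (vPar n m) w) c) =
      Θ'.evalTrace n m (monomial (vPar n m) w) c := by
  induction w generalizing q c with
  | nil => simp
  | cons i w ih =>
    have he : ∀ β, F.rmul (Θ'.e β) c = ∑ α, Θ.basis.repr (Θ'.e β) α • F.rmul (Θ.e α) c := by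
      intro β
      conv_lhs => rw [← Θ.sum_form_dual (Θ'.e β)]
      simp only [map_sum, map_smul, LinearMap.sum_apply, LinearMap.smul_apply, Θ.form_dual]
    rw [monomial_cons, Frame.evalTrace_coord_mul, Frame.evalTrace_coord_mul, Θ.zeta_apply _ _ hc,
      Θ'.zeta_apply _ _ hc]
    simp only [map_sum, map_smul, map_mul, ih (hc.rmul (Θ.mem _)), he, restrict_coord,
      restrictCoord, Finset.sum_mul, Finset.mul_sum, Finset.smul_sum, smul_mul_assoc,
      mul_smul_comm, smul_smul]
    rw [Finset.sum_comm]
    refine Finset.sum_congr rfl fun β _ => Finset.sum_congr rfl fun α _ => ?_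
    by_cases h : Θ.par α = Θ'.par β
    · rw [h]
    · simp [Θ.repr_eq_zero (Θ'.mem β) h]

theorem restrict_psiLinear (h : Ham n m) :
    Θ.restrict Θ' n m (Θ.psiLinear n m h) = Θ'.psiLinear n m h := by
  induction h using superPoly_induction with
  | zero => simp
  | add f g hf hg => rw [map_add, map_add, map_add, hf, hg]
  | smul a f hf => rw [map_smul, map_smul, map_smul, hf]
  | word w => exact Θ.restrict_evalTrace_monomial Θ' w extHom_one

theorem lderiv_restrict (β : Fin Θ'.r) (i : VIdx n m) (f : Θ.Fun n m) :
    lderiv (tensorPar Θ'.par n m) (β, i) (Θ.restrict Θ' n m f) =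
      Θ.restrict Θ' n m (Θ.pd i (Θ'.e β) f) := by
  have hd := Θ.isSuperDerivation_pd i (Θ'.mem β)
  induction f using superPoly_induction with
  | zero => simp
  | add f g hf hg => simp only [map_add, hf, hg]
  | smul a f hf => simp only [map_smul, hf]
  | word w =>
    induction w with
    | nil => simp [lderiv_one, hd.map_one]
    | cons k w ih =>
      rw [monomial_cons, map_mul, restrict_coord, lderiv_mul _ (Θ.restrictCoord_mem Θ' k), ih,
        hd.leibniz _ (coord_mem_parityPart _ k), map_add, map_smul, map_mul, map_mul,
        restrict_coord, pd_coord]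
      congr 1
      congr 1
      simp only [restrictCoord, map_sum, map_smul, lderiv_coord, Prod.mk.injEq]
      rw [Finset.sum_eq_single β]
      · split_ifs <;> simp_all
      · intro γ _ h
        simp [Ne.symm h]
      · simp

end BasisFrame

/-! ### The quadratic Hamiltonian of the differential -/

namespace Frame

variable (Θ : F.Frame) {n m : ℕ}

theorem form_d_eq_zero_of_par {α β : Fin Θ.r} (h : Θ.par α ≠ Θ.par β) :
    F.form (Θ.e α) (F.d (Θ.e β)) = 0 := by
  refine F.form_odd (Θ.mem α) (F.d_mem (Θ.mem β)) ?_
  have hs : ∀ a b : ZMod 2, a ≠ b → a + (b + 1) = 0 := by decide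
  exact hs _ _ h

theorem sigma_eq : F.sigma Θ.par Θ.e n m = (1 / 2 : ℝ) • ∑ α, ∑ β, ∑ i : VIdx n m,
    (sgn (vPar n m i * (1 + Θ.par α)) * conjSign (conj i) * F.form (Θ.e α) (F.d (Θ.e β))) •
      (coord (tensorPar Θ.par n m) (α, i) * coord (tensorPar Θ.par n m) (β, conj i)) := by
  rw [sigma]
  congr 1
  refine Finset.sum_congr rfl fun α _ => Finset.sum_congr rfl fun β _ =>
    Finset.sum_congr rfl fun i _ => ?_
  rw [Finset.sum_eq_single (conj i)]
  · rw [symplecticForm_eq, if_pos rfl, vPar_conj]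
    by_cases h : Θ.par α = Θ.par β
    · have hs : ∀ a i : ZMod 2, a * a + i * i + i * a + a = i * (1 + a) := by decide
      rw [← h]
      congr 1
      rw [← hs (Θ.par α), sgn_add _ (Θ.par α)]
      ring
    · rw [Θ.form_d_eq_zero_of_par h]; simp
  · intro j _ h
    rw [symplecticForm_eq, if_neg h]; simp
  · simp

theorem sigma_mem : F.sigma Θ.par Θ.e n m ∈ parityPart (tensorPar Θ.par n m) 0 := by
  rw [sigma_eq]
  refine Submodule.smul_mem _ _ (Submodule.sum_mem _ fun α _ => Submodule.sum_mem _ fun β _ =>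
    Submodule.sum_mem _ fun i _ => ?_)
  by_cases h : Θ.par α = Θ.par β
  · have h1 := mul_mem_parityPart (coord_mem_parityPart (tensorPar Θ.par n m) (α, i))
      (coord_mem_parityPart (tensorPar Θ.par n m) (β, conj i))
    have hs : ∀ a i : ZMod 2, a + i + (a + i) = 0 := by decide
    simp only [tensorPar, vPar_conj] at h1 ⊢
    rw [h, hs] at h1
    exact Submodule.smul_mem _ _ h1
  · rw [Θ.form_d_eq_zero_of_par h, mul_zero, zero_smul]
    exact Submodule.zero_mem _

theorem lderiv_sigma (γ : Fin Θ.r) (i : VIdx n m) :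
    lderiv (tensorPar Θ.par n m) (γ, i) (F.sigma Θ.par Θ.e n m) =
      ∑ β, (sgn (vPar n m i * (1 + Θ.par γ)) * conjSign (conj i) *
        F.form (Θ.e γ) (F.d (Θ.e β))) • coord (tensorPar Θ.par n m) (β, conj i) := by
  have hterm : ∀ (α β : Fin Θ.r) (j : VIdx n m), lderiv (tensorPar Θ.par n m) (γ, i)
      (coord (tensorPar Θ.par n m) (α, j) * coord (tensorPar Θ.par n m) (β, conj j)) =
      (if γ = α then if i = j then coord (tensorPar Θ.par n m) (β, conj j) else 0 else 0) +
      (if γ = β then if conj i = j then sgn ((Θ.par γ + vPar n m i) * (Θ.par α + vPar n m j)) •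
        coord (tensorPar Θ.par n m) (α, j) else 0 else 0) := by
    intro α β j
    have h1 : i = conj j ↔ conj i = j := ⟨fun h => by rw [h, conj_conj],
      fun h => by rw [← h, conj_conj]⟩
    rw [lderiv_coord_mul_eq, lderiv_coord]
    simp only [Prod.mk.injEq, h1, ite_and]
    congr 1
    split_ifs <;> simp [tensorPar]
  have h1 : ∀ X : Fin Θ.r → VIdx n m → Fin Θ.r → Θ.Fun n m,
      ∑ α, ∑ β, ∑ j, (sgn (vPar n m j * (1 + Θ.par α)) * conjSign (conj j) *
        F.form (Θ.e α) (F.d (Θ.e β))) • (if γ = α then if i = j then X β j α else 0 else 0) =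
      ∑ β, (sgn (vPar n m i * (1 + Θ.par γ)) * conjSign (conj i) *
        F.form (Θ.e γ) (F.d (Θ.e β))) • X β i γ := by
    intro X
    rw [Finset.sum_eq_single γ]
    · refine Finset.sum_congr rfl fun β _ => ?_
      rw [Finset.sum_eq_single i]
      · simp
      · intro j _ h; simp [Ne.symm h]
      · simp
    · intro α _ h; simp [Ne.symm h]
    · simp
  have h2 : ∑ α, ∑ β, ∑ j, (sgn (vPar n m j * (1 + Θ.par α)) * conjSign (conj j) *
        F.form (Θ.e α) (F.d (Θ.e β))) • (if γ = β then if conj i = j then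
          sgn ((Θ.par γ + vPar n m i) * (Θ.par α + vPar n m j)) •
            coord (tensorPar Θ.par n m) (α, j) else 0 else 0) =
      ∑ β, (sgn (vPar n m i * (1 + Θ.par γ)) * conjSign (conj i) *
        F.form (Θ.e γ) (F.d (Θ.e β))) • coord (tensorPar Θ.par n m) (β, conj i) := by
    refine Finset.sum_congr rfl fun α _ => ?_
    rw [Finset.sum_eq_single γ, Finset.sum_eq_single (conj i)]
    · rw [if_pos rfl, if_pos rfl, smul_smul, vPar_conj, conj_conj]
      by_cases h : Θ.par α = Θ.par γ
      · have hs : ∀ a i : ZMod 2, (a + i) * (a + i) = a + i := by decide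
        have h3 : F.form (Θ.e α) (F.d (Θ.e γ)) = -sgn (Θ.par γ) * F.form (Θ.e γ) (F.d (Θ.e α)) := by
          have h4 := F.form_d (Θ.e α) (Θ.mem γ)
          rw [F.form_comm]
          linarith
        rw [h, hs, h3, sgn_add (Θ.par γ), conjSign_conj]
        congr 1
        linear_combination (-(sgn (vPar n m i * (1 + Θ.par γ)) * conjSign i * sgn (vPar n m i) *
          F.form (Θ.e γ) (F.d (Θ.e α)))) * sgn_mul_self (Θ.par γ)
      · rw [Θ.form_d_eq_zero_of_par h, Θ.form_d_eq_zero_of_par (Ne.symm h)]; simp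
    · intro j _ h; simp [Ne.symm h]
    · simp
    · intro β _ h; simp [Ne.symm h]
    · simp
  rw [sigma_eq]
  simp only [map_smul, map_sum, hterm, smul_add, Finset.sum_add_distrib]
  rw [h1 (fun β j _ => coord (tensorPar Θ.par n m) (β, conj j)), h2, ← add_smul]
  norm_num

end Frame

end ContractibleDGFrobenius


namespace ContractibleDGFrobenius

variable {A : Type*} [NonUnitalRing A] [Module ℝ A] [IsScalarTower ℝ A A] [SMulCommClass ℝ A A]

variable {F : ContractibleDGFrobenius A}

/-! ### Wick's theorem for the Gaussian superintegral -/

namespace BasisFrame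

variable (Θ : F.BasisFrame) {n m : ℕ} {L : Submodule ℝ A} {s : A →ₗ[ℝ] A}

variable (n m) in
/-- The functional `f ↦ (exp P) f (0)`, where `P` is the propagator of a homotopy `s`. -/
def wickExpectation (s : A →ₗ[ℝ] A) : Θ.Fun n m →ₗ[ℝ] ℝ :=
  (Θ.lowers_laplace n m 1 s).expFunctional (evalZero (tensorPar Θ.par n m))

/-- The coefficient of the derivative that a coordinate is paired with by the propagator. -/
def pairSign (k : Fin Θ.r × VIdx n m) : ℝ :=
  sgn (Θ.par k.1 * (1 + vPar n m k.2)) * conjSign (conj k.2)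

theorem pairSign_apply (k : Fin Θ.r × VIdx n m) :
    Θ.pairSign k = sgn (Θ.par k.1 * (1 + vPar n m k.2)) * conjSign (conj k.2) := rfl

/-- The Wick recursion on the algebraic side. -/
theorem wickExpectation_coord_mul (hL : F.IsIsotropic L) (hs : F.IsHomotopy L s)
    (k : Fin Θ.r × VIdx n m) (f : Θ.Fun n m) :
    Θ.wickExpectation n m s (coord (tensorPar Θ.par n m) k * f) =
      Θ.pairSign k * Θ.wickExpectation n m s (Θ.pd (conj k.2) (s (Θ.dual k.1)) f) := by
  have h := (Θ.lowers_laplace n m 1 s).expFunctional_comp (evalZero (tensorPar Θ.par n m))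
    (Z := LinearMap.mulLeft ℝ (coord (tensorPar Θ.par n m) k))
    (Y := Θ.pairSign k • Θ.pd (conj k.2) (s (Θ.dual k.1)))
    (fun f => Θ.laplace_coord_mul hs.hasParity (hs.form_comm hL) k f)
    (fun f => by
      have h1 := Θ.pd_laplace (conj k.2) (hs.hasParity (Θ.dual_mem k.1)) hs.hasParity f
      have h2 : (1 : ZMod 2) + 1 = 0 := by decide
      rw [h2, mul_zero, sgn_zero, one_smul] at h1
      rw [LinearMap.smul_apply, LinearMap.smul_apply, map_smul, h1])
    (fun f => evalZero_coord_mul (tensorPar Θ.par n m) k f) f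
  rw [LinearMap.mulLeft_apply, LinearMap.smul_apply, map_smul, smul_eq_mul] at h
  exact h

theorem wickExpectation_one (s : A →ₗ[ℝ] A) : Θ.wickExpectation n m s 1 = 1 := by
  rw [wickExpectation, Lowers.expFunctional_of_eq_zero, evalZero_one]
  rw [laplace_apply']
  simp only [(Θ.isSuperDerivation_pd _ (Θ.dual_mem _)).map_one, map_zero, smul_zero,
    Finset.sum_const_zero]

end BasisFrame

/-- A homogeneous basis of a subspace `L` of `A`. -/
structure SubspaceBasis (F : ContractibleDGFrobenius A) (L : Submodule ℝ A) where
  /-- the dimension of `L` -/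
  r : ℕ
  /-- the parities -/
  par : Fin r → ZMod 2
  /-- the basis -/
  basis : Module.Basis (Fin r) ℝ L
  basis_mem : ∀ α, (basis α : A) ∈ F.gr (par α)

namespace SubspaceBasis

variable {L : Submodule ℝ A} {n m : ℕ} (Ξ : F.SubspaceBasis L)

/-- A basis of `L` as a family of elements of `A`. -/
abbrev frame : F.Frame := ⟨Ξ.r, Ξ.par, fun α => Ξ.basis α, Ξ.basis_mem⟩

variable (Θ : F.BasisFrame) {s : A →ₗ[ℝ] A}

variable {Ξ} in
theorem sum_repr {a : A} (ha : a ∈ L) : ∑ β, Ξ.basis.repr ⟨a, ha⟩ β • (Ξ.basis β : A) = a := by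
  have h := congrArg L.subtype (Ξ.basis.sum_repr ⟨a, ha⟩)
  rw [map_sum] at h
  simpa only [map_smul, Submodule.subtype_apply] using h

theorem restrict_pd {a : A} (ha : a ∈ L) (i : VIdx n m) (f : Θ.Fun n m) :
    Θ.restrict Ξ.frame n m (Θ.pd i a f) = ∑ β, Ξ.basis.repr ⟨a, ha⟩ β •
      lderiv (tensorPar Ξ.par n m) (β, i) (Θ.restrict Ξ.frame n m f) := by
  have h : ∀ β : Fin Ξ.r, lderiv (tensorPar Ξ.par n m) (β, i) (Θ.restrict Ξ.frame n m f) =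
      Θ.restrict Ξ.frame n m (Θ.pd i (Ξ.basis β : A) f) :=
    fun β => Θ.lderiv_restrict Ξ.frame β i f
  conv_lhs => rw [← Ξ.sum_repr ha]
  simp only [h, map_sum, map_smul, LinearMap.sum_apply, LinearMap.smul_apply]

/-- The coordinate functions of `A ⊗ V`, restricted to `L ⊗ V`, are derivatives of the quadratic
Hamiltonian in the directions prescribed by the propagator. -/
theorem restrictCoord_eq (hL : F.IsIsotropic L) (hs : F.IsHomotopy L s)
    (k : Fin Θ.r × VIdx n m) : Θ.restrictCoord Ξ.frame n m k = Θ.pairSign k •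
      ∑ β, Ξ.basis.repr ⟨s (Θ.dual k.1), hs.mem _⟩ β •
        lderiv (tensorPar Ξ.par n m) (β, conj k.2)
          (F.sigma Ξ.par (fun α => (Ξ.basis α : A)) n m) := by
  obtain ⟨κ, j⟩ := k
  have hsig : ∀ β : Fin Ξ.r, lderiv (tensorPar Ξ.par n m) (β, conj j)
      (F.sigma Ξ.par (fun α => (Ξ.basis α : A)) n m) =
      ∑ γ, (sgn (vPar n m (conj j) * (1 + Ξ.par β)) * conjSign (conj (conj j)) *
        F.form (Ξ.basis β) (F.d (Ξ.basis γ))) •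
          coord (tensorPar Ξ.par n m) (γ, conj (conj j)) :=
    fun β => Ξ.frame.lderiv_sigma β (conj j)
  have hpar : s (Θ.dual κ) ∈ F.gr (Θ.par κ) := by
    have h := hs.odd (Θ.dual_mem κ)
    have hz : ∀ a : ZMod 2, a + 1 + 1 = a := by decide
    rwa [hz] at h
  -- the sign depending on the basis vector is the parity involution
  have hform : ∀ γ : Fin Ξ.r, ∑ β, Ξ.basis.repr ⟨s (Θ.dual κ), hs.mem _⟩ β *
      (sgn (vPar n m j * Ξ.par β) * F.form (Ξ.basis β) (F.d (Ξ.basis γ))) =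
      -(sgn (vPar n m j * Θ.par κ + Θ.par κ)) * Θ.basis.repr (Ξ.basis γ) κ := by
    intro γ
    have h1 : ∑ β, (Ξ.basis.repr ⟨s (Θ.dual κ), hs.mem _⟩ β * sgn (vPar n m j * Ξ.par β)) •
        (Ξ.basis β : A) = sgn (vPar n m j * Θ.par κ) • s (Θ.dual κ) := by
      rw [← F.invPow_of_mem _ hpar]
      conv_rhs => rw [← Ξ.sum_repr (hs.mem (Θ.dual κ))]
      simp only [map_sum, map_smul, F.invPow_of_mem _ (Ξ.basis_mem _), smul_smul]
    have h2 := F.form_d (Ξ.basis γ : A) hpar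
    have h3 : F.form (F.d (s (Θ.dual κ))) (Ξ.basis γ) = Θ.basis.repr (Ξ.basis γ) κ := by
      have h4 := hs.d_add (Θ.dual κ)
      rw [← eq_sub_iff_add_eq] at h4
      rw [h4, map_sub, LinearMap.sub_apply, hL.2 _ (hs.mem _) _ (Ξ.basis γ).2, sub_zero,
        Θ.form_dual]
    have h5 : ∑ β, Ξ.basis.repr ⟨s (Θ.dual κ), hs.mem _⟩ β *
        (sgn (vPar n m j * Ξ.par β) * F.form (Ξ.basis β) (F.d (Ξ.basis γ))) =
        F.form (sgn (vPar n m j * Θ.par κ) • s (Θ.dual κ)) (F.d (Ξ.basis γ)) := by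
      rw [← h1]
      simp only [map_sum, map_smul, LinearMap.sum_apply, LinearMap.smul_apply, smul_eq_mul,
        mul_assoc]
    rw [h5, map_smul, LinearMap.smul_apply, smul_eq_mul, sgn_add]
    rw [h3] at h2
    linear_combination (sgn (vPar n m j * Θ.par κ) * sgn (Θ.par κ)) * h2 -
      (sgn (vPar n m j * Θ.par κ) * F.form (s (Θ.dual κ)) (F.d (Ξ.basis γ))) *
        sgn_mul_self (Θ.par κ)
  simp only [hsig, conj_conj, vPar_conj, Finset.smul_sum, smul_smul]
  rw [Finset.sum_comm]
  refine Finset.sum_congr rfl fun γ _ => ?_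
  rw [← Finset.sum_smul]
  congr 1
  have h6 : ∑ β, Θ.pairSign (κ, j) * (Ξ.basis.repr ⟨s (Θ.dual κ), hs.mem _⟩ β *
      (sgn (vPar n m j * (1 + Ξ.par β)) * conjSign j *
        F.form (Ξ.basis β) (F.d (Ξ.basis γ)))) =
      Θ.pairSign (κ, j) * conjSign j * sgn (vPar n m j) *
        ∑ β, Ξ.basis.repr ⟨s (Θ.dual κ), hs.mem _⟩ β *
          (sgn (vPar n m j * Ξ.par β) * F.form (Ξ.basis β) (F.d (Ξ.basis γ))) := by
    rw [Finset.mul_sum]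
    refine Finset.sum_congr rfl fun β _ => ?_
    rw [mul_add, mul_one, sgn_add]
    ring
  refine Eq.trans ?_ h6.symm
  have hz : ∀ k j : ZMod 2, k * (1 + j) = j * k + k := by decide
  rw [hform, BasisFrame.pairSign_apply, conjSign_conj, hz]
  have h7 := sgn_mul_self (vPar n m j)
  have h8 := sgn_mul_self (vPar n m j * Θ.par κ + Θ.par κ)
  have h9 := conjSign_mul_self j
  change Θ.basis.repr (Ξ.basis γ) κ = _
  linear_combination (-(Θ.basis.repr (Ξ.basis γ) κ)) * h8 -
    (Θ.basis.repr (Ξ.basis γ) κ * sgn (vPar n m j * Θ.par κ + Θ.par κ) *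
      sgn (vPar n m j * Θ.par κ + Θ.par κ)) * h9 -
    (Θ.basis.repr (Ξ.basis γ) κ * sgn (vPar n m j * Θ.par κ + Θ.par κ) *
      sgn (vPar n m j * Θ.par κ + Θ.par κ) * (conjSign j * conjSign j)) * h7

/-- The derivatives of `σ̃` span the coordinate functions: the quadratic form is nondegenerate on
`L ⊗ V` when `L` is a gauge. -/
theorem exists_coord_eq_sum_lderiv_sigma [Module.Finite ℝ A] (hL : F.IsGauge L) :
    ∃ g : Fin Ξ.r × VIdx n m → Fin Ξ.r × VIdx n m → ℝ, ∀ k, coord (tensorPar Ξ.par n m) k =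
      ∑ l, g k l • lderiv (tensorPar Ξ.par n m) l
        (F.sigma Ξ.par (fun α => (Ξ.basis α : A)) n m) := by
  obtain ⟨s, hs⟩ := hL.exists_homotopy
  obtain ⟨Θ⟩ := F.exists_basisFrame
  -- the restricted coordinates span all coordinates of `L ⊗ V`
  choose φ hφ using fun β => (Ξ.basis.coord β).exists_extend
  have hcoord : ∀ (β : Fin Ξ.r) (j : VIdx n m), coord (tensorPar Ξ.par n m) (β, j) =
      ∑ κ, φ β (Θ.e κ) • Θ.restrictCoord Ξ.frame n m (κ, j) := by
    intro β j
    have h1 : ∀ γ, ∑ κ, φ β (Θ.e κ) * Θ.basis.repr (Ξ.basis γ) κ = if γ = β then 1 else 0 := by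
      intro γ
      have h2 := LinearMap.congr_fun (hφ β) (Ξ.basis γ)
      rw [LinearMap.comp_apply, Submodule.subtype_apply, Module.Basis.coord_apply,
        Module.Basis.repr_self, Finsupp.single_apply] at h2
      rw [← h2]
      conv_rhs => rw [← Θ.sum_form_dual (Ξ.basis γ : A)]
      simp only [map_sum, map_smul, Θ.form_dual, smul_eq_mul]
      exact Finset.sum_congr rfl fun _ _ => _root_.mul_comm _ _
    simp only [BasisFrame.restrictCoord, Finset.smul_sum, smul_smul]
    rw [Finset.sum_comm]
    simp only [← Finset.sum_smul]
    change _ = ∑ γ : Fin Ξ.r, (∑ κ, φ β (Θ.e κ) * Θ.basis.repr (Ξ.basis γ) κ) •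
      coord (tensorPar Ξ.par n m) (γ, j)
    simp only [h1]
    simp
  refine ⟨fun k l => if l.2 = conj k.2 then ∑ κ, φ k.1 (Θ.e κ) * (Θ.pairSign (κ, k.2) *
    Ξ.basis.repr ⟨s (Θ.dual κ), hs.mem _⟩ l.1) else 0, fun ⟨β, j⟩ => ?_⟩
  rw [hcoord, Fintype.sum_prod_type]
  simp only [Ξ.restrictCoord_eq Θ hL.1.1 hs, Finset.smul_sum, smul_smul]
  rw [Finset.sum_comm]
  refine Finset.sum_congr rfl fun γ _ => ?_
  rw [Finset.sum_eq_single (conj j)]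
  · simp only [if_true, Finset.sum_smul]
  · intro i _ h; simp [h]
  · simp

end SubspaceBasis

namespace Coordinates

variable {L : Submodule ℝ A} {n m : ℕ} (Ξ : F.Coordinates L n m)

/-- The basis of `L` underlying a choice of coordinates. -/
abbrev subspaceBasis : F.SubspaceBasis L := ⟨Ξ.r, Ξ.par, Ξ.basis, Ξ.basis_mem⟩

/-- The frame underlying a choice of coordinates. -/
abbrev frame : F.Frame := Ξ.subspaceBasis.frame

/-- The superintegral in given coordinates as a linear functional. -/
def gauss : Ξ.frame.Fun n m →ₗ[ℝ] ℂ :=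
  gaussFunctional (F.sigma Ξ.par (fun α => (Ξ.basis α : A)) n m) Ξ.T Ξ.ε

theorem integral_eq (f : Ξ.frame.Fun n m) :
    Ξ.integral f = ((|Ξ.T.det| : ℝ) : ℂ) * Ξ.gauss f :=
  gaussianIntegral_eq _

theorem gauss_lderiv (k : Fin Ξ.r × VIdx n m) (f : Ξ.frame.Fun n m) :
    Ξ.gauss (lderiv (tensorPar Ξ.par n m) k f) =
      Ξ.gauss (lderiv (tensorPar Ξ.par n m) k
        (F.sigma Ξ.par (fun α => (Ξ.basis α : A)) n m) * f) :=
  gaussFunctional_lderiv Ξ.diagonalises Ξ.frame.sigma_mem k f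

theorem gauss_one_ne_zero [Module.Finite ℝ A] (hL : F.IsGauge L) : Ξ.gauss 1 ≠ 0 :=
  gaussFunctional_one_ne_zero Ξ.diagonalises Ξ.frame.sigma_mem
    (Ξ.subspaceBasis.exists_coord_eq_sum_lderiv_sigma hL)

variable (Θ : F.BasisFrame) {s : A →ₗ[ℝ] A}

theorem integral_one_ne_zero [Module.Finite ℝ A] (hL : F.IsGauge L) : Ξ.integral 1 ≠ 0 := by
  refine (Ξ.integral_eq 1).trans_ne (mul_ne_zero ?_ (Ξ.gauss_one_ne_zero hL))
  exact_mod_cast abs_ne_zero.2 Ξ.diagonalises.1.ne_zero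

/-- The Wick recursion on the side of the integral, by integration by parts. -/
theorem gauss_restrict_coord_mul (hL : F.IsIsotropic L) (hs : F.IsHomotopy L s)
    (k : Fin Θ.r × VIdx n m) (f : Θ.Fun n m) :
    Ξ.gauss (Θ.restrict Ξ.frame n m (coord (tensorPar Θ.par n m) k * f)) =
      Θ.pairSign k • Ξ.gauss (Θ.restrict Ξ.frame n m (Θ.pd (conj k.2) (s (Θ.dual k.1)) f)) := by
  have h1 : Θ.restrict Ξ.frame n m (coord (tensorPar Θ.par n m) k * f) =
      Θ.pairSign k • ∑ β, Ξ.basis.repr ⟨s (Θ.dual k.1), hs.mem _⟩ β •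
        (lderiv (tensorPar Ξ.par n m) (β, conj k.2)
          (F.sigma Ξ.par (fun α => (Ξ.basis α : A)) n m) * Θ.restrict Ξ.frame n m f) := by
    refine (map_mul (Θ.restrict Ξ.frame n m) _ _).trans ?_
    rw [BasisFrame.restrict_coord, Ξ.subspaceBasis.restrictCoord_eq Θ hL hs]
    simp only [smul_mul_assoc, Finset.sum_mul]
  have h2 := Ξ.subspaceBasis.restrict_pd Θ (hs.mem (Θ.dual k.1)) (conj k.2) f
  refine (congrArg Ξ.gauss h1).trans ((map_smul Ξ.gauss _ _).trans (congrArg _ ?_))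
  refine (map_sum Ξ.gauss _ _).trans
    (Eq.trans ?_ ((congrArg Ξ.gauss h2).trans (map_sum Ξ.gauss _ _)).symm)
  refine Finset.sum_congr rfl fun β _ => ?_
  refine (map_smul Ξ.gauss _ _).trans (Eq.trans ?_ (map_smul Ξ.gauss _ _).symm)
  exact congrArg _ (Ξ.gauss_lderiv _ _).symm

/-- Both functionals satisfy the recursion that moves a coordinate through the Gaussian. -/
theorem gauss_restrict (hL : F.IsIsotropic L) (hs : F.IsHomotopy L s) (f : Θ.Fun n m) :
    Ξ.gauss (Θ.restrict Ξ.frame n m f) = Θ.wickExpectation n m s f • Ξ.gauss 1 := by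
  have key : Ξ.gauss ∘ₗ (Θ.restrict Ξ.frame n m).toLinearMap -
      (Θ.wickExpectation n m s).smulRight (Ξ.gauss 1) = 0 := by
    generalize hJ : Ξ.gauss ∘ₗ (Θ.restrict Ξ.frame n m).toLinearMap -
      (Θ.wickExpectation n m s).smulRight (Ξ.gauss 1) = I
    have hI : ∀ f, I f = Ξ.gauss (Θ.restrict Ξ.frame n m f) -
        Θ.wickExpectation n m s f • Ξ.gauss 1 := fun f => by rw [← hJ]; rfl
    have hrec : ∀ k f, I (coord (tensorPar Θ.par n m) k * f) =
        Θ.pairSign k • I (Θ.pd (conj k.2) (s (Θ.dual k.1)) f) := by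
      intro k f
      rw [hI, hI, Θ.wickExpectation_coord_mul hL hs, Ξ.gauss_restrict_coord_mul Θ hL hs,
        smul_sub, mul_smul]
    refine eq_zero_of_wick_recursion (fun k l => if l.2 = conj k.2 then
      Θ.pairSign k * Θ.basis.repr (s (Θ.dual k.1)) l.1 else 0) (fun k f => ?_) ?_
    · rw [hrec, BasisFrame.pd_apply, Fintype.sum_prod_type, map_sum, Finset.smul_sum]
      refine Finset.sum_congr rfl fun γ _ => ?_
      rw [Finset.sum_eq_single (conj k.2)]
      · rw [if_pos rfl, map_smul, smul_smul]
      · intro i _ h; simp [h]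
      · simp
    · rw [hI, map_one, Θ.wickExpectation_one, one_smul, sub_self]
  have h := LinearMap.congr_fun key f
  exact sub_eq_zero.1 h

/-- Wick's theorem: the normalised integral over `L ⊗ V` is computed by the propagator of a homotopy
with image in `L`. -/
theorem expectation_restrict [Module.Finite ℝ A] (hL : F.IsGauge L) (hs : F.IsHomotopy L s)
    (f : Θ.Fun n m) :
    Ξ.expectation (Θ.restrict Ξ.frame n m f) = (Θ.wickExpectation n m s f : ℂ) := by
  have h1 : ((|Ξ.T.det| : ℝ) : ℂ) ≠ 0 := by
    exact_mod_cast abs_ne_zero.2 Ξ.diagonalises.1.ne_zero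
  have h2 := Ξ.integral_eq (Θ.restrict Ξ.frame n m f)
  rw [Ξ.gauss_restrict Θ hL.1.1 hs] at h2
  have h3 := Ξ.integral_eq 1
  unfold expectation
  refine (div_eq_iff (Ξ.integral_one_ne_zero hL)).2 (h2.trans ?_)
  rw [Complex.real_smul]
  refine Eq.trans ?_ (congrArg _ h3.symm)
  ring

end Coordinates

end ContractibleDGFrobenius


/-! ### Existence of linear coordinates for the superintegrals -/

/-- Sylvester's law of inertia for the quadratic form with the (not necessarily symmetric)
coefficients `c`. -/
theorem exists_diagonalising_matrix {ι : Type*} [Fintype ι] [DecidableEq ι] (c : ι → ι → ℝ)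
    (hnd : ∀ y : ι → ℝ, (∀ l, ∑ j, (c l j + c j l) * y j = 0) → y = 0) :
    ∃ (T : Matrix ι ι ℝ) (ε : ι → ℝ), IsUnit T.det ∧ (∀ k, ε k = 1 ∨ ε k = -1) ∧
      ∀ y : ι → ℝ, ∑ k, ∑ l, c k l * (T.mulVec y k * T.mulVec y l) = ∑ k, ε k * y k ^ 2 := by
  have hB : ∀ x y : ι → ℝ, Matrix.toBilin' (Matrix.of c) x y = ∑ k, ∑ l, c k l * (x k * y l) := by
    intro x y
    rw [Matrix.toBilin'_apply]
    exact Finset.sum_congr rfl fun k _ => Finset.sum_congr rfl fun l _ => by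
      rw [Matrix.of_apply]; ring
  let Q : QuadraticForm ℝ (ι → ℝ) := (Matrix.toBilin' (Matrix.of c)).toQuadraticMap
  have hQ : (QuadraticMap.associated (R := ℝ) Q).SeparatingLeft := by
    intro y hy
    refine hnd y fun l => ?_
    have h2 : QuadraticMap.polar Q y (Pi.single l 1) = 0 := by
      rw [← QuadraticMap.polarBilin_apply_apply, ← QuadraticMap.two_nsmul_associated ℝ,
        LinearMap.smul_apply, LinearMap.smul_apply, hy, smul_zero]
    rw [LinearMap.BilinMap.polar_toQuadraticMap] at h2
    rw [hB, hB] at h2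
    simp only [Pi.single_apply, mul_ite, mul_one, mul_zero, ite_mul, one_mul, zero_mul,
      Finset.sum_ite_eq', Finset.mem_univ, if_true] at h2
    rw [Finset.sum_comm] at h2
    simp only [Finset.sum_ite_eq', Finset.mem_univ, if_true] at h2
    rw [← h2, ← Finset.sum_add_distrib]
    exact Finset.sum_congr rfl fun j _ => by ring
  obtain ⟨w, hw, ⟨e⟩⟩ := Q.equivalent_one_neg_one_weighted_sum_squared hQ
  let σ : ι ≃ Fin (Module.finrank ℝ (ι → ℝ)) :=
    Fintype.equivOfCardEq (by simp)
  let f : (ι → ℝ) ≃ₗ[ℝ] (ι → ℝ) :=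
    (LinearEquiv.funCongrLeft ℝ ℝ σ.symm).trans e.symm.toLinearEquiv
  refine ⟨LinearMap.toMatrix' f.toLinearMap, fun k => w (σ k), ?_, fun k => (hw _).symm,
    fun y => ?_⟩
  · rw [LinearMap.det_toMatrix']
    exact LinearEquiv.isUnit_det' f
  · have h1 : (LinearMap.toMatrix' f.toLinearMap).mulVec y = f y := by
      rw [← Matrix.toLin'_apply, Matrix.toLin'_toMatrix']; rfl
    rw [h1, ← hB]
    have h2 := e.symm.map_app (LinearEquiv.funCongrLeft ℝ ℝ σ.symm y)
    refine Eq.trans h2 ?_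
    rw [QuadraticMap.weightedSumSquares_apply, ← Equiv.sum_comp σ]
    refine Finset.sum_congr rfl fun k _ => ?_
    simp [LinearEquiv.funCongrLeft_apply, LinearMap.funLeft_apply, pow_two]

/-- Odd functions vanish on the body. -/
theorem body_eq_zero_of_odd {K : Type} {par : K → ZMod 2} {f : SuperPoly par}
    (hf : f ∈ parityPart par 1) : body par f = 0 := by
  induction hf using parityPart_induction with
  | zero => simp
  | add f g _ _ hf hg => rw [map_add, hf, hg, add_zero]
  | smul r f _ hf => rw [map_smul, hf, smul_zero]
  | word w hw =>
    induction w with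
    | nil => simp at hw
    | cons k w ih =>
      rw [monomial_cons, body_mul]
      by_cases hk : par k = 0
      · rw [ih (by simpa [hk] using hw), mul_zero]
      · rw [body_coord_odd par hk, zero_mul]

/-- A quadratic superfunction whose derivatives span the coordinates can be diagonalised. -/
theorem exists_diagonalises {K : Type} [Fintype K] [DecidableEq K] {par : K → ZMod 2}
    {σ : SuperPoly par} (hσ : σ ∈ parityPart par 0) (c : K → K → ℝ)
    (hc : σ = (1 / 2 : ℝ) • ∑ k, ∑ l, c k l • (coord par k * coord par l))
    (hnd : ∃ g : K → K → ℝ, ∀ k, coord par k = ∑ l, g k l • lderiv par l σ) :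
    ∃ T ε, Diagonalises par σ T ε := by
  have hsum : ∀ F : K → MvPolynomial (Ev par) ℝ, (∀ k, par k ≠ 0 → F k = 0) →
      ∑ k, F k = ∑ k : Ev par, F k := by
    intro F hF
    rw [← Finset.sum_filter_of_ne (p := fun k => par k = 0) fun k _ h => by_contra fun h' =>
      h (hF k h')]
    exact Finset.sum_subtype _ (by simp) F
  have hbody : body par σ = MvPolynomial.C (1 / 2) * ∑ k : Ev par, ∑ l : Ev par,
      MvPolynomial.C (c k l) * (MvPolynomial.X k * MvPolynomial.X l) := by
    rw [hc, map_smul, MvPolynomial.smul_eq_C_mul, map_sum, hsum]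
    · congr 1
      refine Finset.sum_congr rfl fun k _ => ?_
      rw [map_sum, hsum]
      · refine Finset.sum_congr rfl fun l _ => ?_
        rw [map_smul, body_mul, body_coord_even par k.2, body_coord_even par l.2,
          MvPolynomial.smul_eq_C_mul]
      · intro l hl
        rw [map_smul, body_mul, body_coord_odd par hl, mul_zero, smul_zero]
    · intro k hk
      simp only [map_sum, map_smul, body_mul, body_coord_odd par hk, zero_mul, smul_zero,
        Finset.sum_const_zero]
  obtain ⟨g, hg⟩ := hnd
  have hX : ∀ k : Ev par, (MvPolynomial.X k : MvPolynomial (Ev par) ℝ) =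
      ∑ l : Ev par, MvPolynomial.C (g k l) * MvPolynomial.pderiv l (body par σ) := by
    intro k
    rw [← body_coord_even par k.2, hg, map_sum, hsum]
    · refine Finset.sum_congr rfl fun l _ => ?_
      rw [map_smul, body_lderiv_even l.2, MvPolynomial.smul_eq_C_mul]
    · intro l hl
      rw [map_smul, body_eq_zero_of_odd, smul_zero]
      have h1 := lderiv_mem_parityPart l hσ
      rwa [add_zero, eq_one_of_ne_zero hl] at h1
  obtain ⟨T, ε, hT, hε, h⟩ := exists_diagonalising_matrix (fun k l : Ev par => c k l) (by
    intro y hy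
    funext k
    have h1 := congrArg (MvPolynomial.eval y) (hX k)
    have h2 : ∀ l : Ev par, MvPolynomial.eval y (MvPolynomial.pderiv l (body par σ)) =
        (1 / 2) * ∑ j : Ev par, (c l j + c j l) * y j := by
      intro l
      have h3 : ∀ i j : Ev par, MvPolynomial.eval y (MvPolynomial.pderiv l (MvPolynomial.C (c i j) *
          (MvPolynomial.X i * MvPolynomial.X j))) =
          c i j * ((if i = l then 1 else 0) * y j + y i * (if j = l then 1 else 0)) := by
        intro i j
        rw [MvPolynomial.pderiv_C_mul, MvPolynomial.pderiv_mul, MvPolynomial.pderiv_X,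
          MvPolynomial.pderiv_X]
        simp only [map_mul, map_add, MvPolynomial.eval_C, MvPolynomial.eval_X, Pi.single_apply,
          apply_ite (MvPolynomial.eval y), map_one, map_zero]
      rw [hbody, MvPolynomial.pderiv_C_mul, map_mul, MvPolynomial.eval_C]
      simp only [map_sum, h3, mul_add, Finset.sum_add_distrib, ite_mul, mul_ite, one_mul, mul_one,
        zero_mul, mul_zero, add_mul, Finset.sum_ite_eq', Finset.mem_univ, if_true]
      rw [Finset.sum_comm]
      simp only [Finset.sum_ite_eq', Finset.mem_univ, if_true]
    simpa [h2, hy] using h1)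
  refine ⟨T, ε, hT, hε, MvPolynomial.funext fun y => ?_⟩
  have hev : ∀ p : MvPolynomial (Ev par) ℝ, MvPolynomial.eval y (evenSubst par T p) =
      MvPolynomial.eval (T.mulVec y) p := by
    intro p
    induction p using MvPolynomial.induction_on with
    | C a => simp [evenSubst]
    | add p q hp hq => simp only [map_add, hp, hq]
    | mul_X p i hp => rw [map_mul, map_mul, hp]; simp [evenSubst, Matrix.mulVec, dotProduct]
  rw [hev, hbody]
  simpa using h y

namespace ContractibleDGFrobenius

variable {A : Type*} [NonUnitalRing A] [Module ℝ A] [IsScalarTower ℝ A A] [SMulCommClass ℝ A A]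
  [Module.Finite ℝ A] {F : ContractibleDGFrobenius A}

theorem IsGauge.nonempty_coordinates {L : Submodule ℝ A} (hL : F.IsGauge L) (n m : ℕ) :
    Nonempty (F.Coordinates L n m) := by
  obtain ⟨r, par, b, hb⟩ := F.exists_homogeneous_basis hL.1.1.1
  let Ξ : F.SubspaceBasis L := ⟨r, par, b, hb⟩
  have hσ : F.sigma par (fun α => (b α : A)) n m ∈ parityPart (tensorPar par n m) 0 :=
    Ξ.frame.sigma_mem
  obtain ⟨T, ε, h⟩ := exists_diagonalises hσ (fun k l =>
    sgn (par k.1 * par l.1 + vPar n m k.2 * vPar n m l.2 + vPar n m k.2 * par l.1) *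
      (sgn (par k.1) * F.form (b k.1) (F.d (b l.1))) * symplecticForm n m k.2 l.2) (by
      rw [sigma, Fintype.sum_prod_type]
      congr 1
      refine Finset.sum_congr rfl fun α _ => ?_
      rw [Finset.sum_comm]
      refine Finset.sum_congr rfl fun i _ => ?_
      rw [Fintype.sum_prod_type])
    (Ξ.exists_coord_eq_sum_lderiv_sigma hL)
  exact ⟨⟨r, par, b, hb, T, ε, h⟩⟩

end ContractibleDGFrobenius


/-! ### Chevalley-Eilenberg chains -/

section Chains

variable {n m : ℕ}

theorem wedge_cons (x : GTilde n m) (G : List (GTilde n m)) :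
    wedge (x :: G) = generator x * wedge G := by
  simp [wedge]

theorem generator_mul_generator {p q : ZMod 2} {g h : GTilde n m} (hg : g ∈ gTildeParity n m p)
    (hh : h ∈ gTildeParity n m q) :
    generator g * generator h = (-sgn (p * q)) • (generator h * generator g) := by
  have h1 := RingQuot.mkAlgHom_rel ℝ (ExteriorRel.swap hg hh)
  rw [map_mul, map_smul, map_mul] at h1
  exact h1

theorem ofFn_update_zero {α : Type*} {l : ℕ} (G : Fin (l + 1) → α) (x : α) :
    List.ofFn (Function.update G 0 x) = x :: List.ofFn fun i => G i.succ := by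
  rw [List.ofFn_succ]; simp

theorem ofFn_update_succ {α : Type*} {l : ℕ} (G : Fin (l + 1) → α) (i : Fin l) (x : α) :
    List.ofFn (Function.update G i.succ x) =
      G 0 :: List.ofFn (Function.update (fun i => G i.succ) i x) := by
  rw [List.ofFn_succ, Function.update_of_ne (Fin.succ_ne_zero i).symm]
  congr 2
  funext k
  by_cases hk : k = i
  · subst hk; simp
  · rw [Function.update_of_ne hk, Function.update_of_ne (by simpa using hk)]

/-- An element may be moved past the first `j` factors of a product. -/
theorem wedge_cons_erase {l : ℕ} (G : Fin l → GTilde n m) (p : Fin l → ZMod 2)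
    (hG : ∀ i, G i ∈ gTildeParity n m (p i)) (j : Fin l) {q : ZMod 2} {x : GTilde n m}
    (hx : x ∈ gTildeParity n m q) :
    wedge (x :: ((List.finRange l).filter fun k => k ≠ j).map G) =
      sgn (q * ∑ k ∈ Finset.Iio j, p k + ((j.val : ℕ) : ZMod 2)) •
        wedge (List.ofFn (Function.update G j x)) := by
  induction l with
  | zero => exact j.elim0
  | succ l ih =>
    rw [List.finRange_succ]
    refine Fin.cases ?_ (fun j => ?_) j
    · have h1 : ((0 : Fin (l + 1)) :: (List.finRange l).map Fin.succ).filter (fun k => k ≠ 0) =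
          (List.finRange l).map Fin.succ := by
        simp [List.filter_map, Function.comp_def]
      rw [h1, ofFn_update_zero, sum_Iio_zero, List.map_map, List.ofFn_eq_map]
      simp [Function.comp_def]
    · have h1 : ((0 : Fin (l + 1)) :: (List.finRange l).map Fin.succ).filter
          (fun k => k ≠ j.succ) =
          0 :: ((List.finRange l).filter fun k => k ≠ j).map Fin.succ := by
        simp [List.filter_map, Function.comp_def, (Fin.succ_ne_zero j).symm]
      have ih' := ih (fun i => G i.succ) (fun i => p i.succ) (fun i => hG i.succ) j
      rw [h1, ofFn_update_succ, sum_Iio_succ, List.map_cons, wedge_cons, wedge_cons, ← mul_assoc,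
        generator_mul_generator hx (hG 0), smul_mul_assoc, mul_assoc, ← wedge_cons, List.map_map]
      rw [wedge_cons] at ih' ⊢
      rw [wedge_cons, Function.comp_def, ih', mul_smul_comm, smul_smul, neg_sgn, ← sgn_add,
        Fin.val_succ]
      congr 2
      push_cast
      ring

variable (n m) in
/-- The span of the products of `d` elements, `d` being given modulo `2`. -/
def lengthPart (d : ZMod 2) : Submodule ℝ (Chains n m) :=
  Submodule.span ℝ {c | ∃ G : List (GTilde n m), (G.length : ZMod 2) = d ∧ c = wedge G}

theorem wedge_mem_lengthPart (G : List (GTilde n m)) : wedge G ∈ lengthPart n m G.length :=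
  Submodule.subset_span ⟨G, rfl, rfl⟩

theorem generator_mul_mem {d : ZMod 2} (x : GTilde n m) {c : Chains n m}
    (hc : c ∈ lengthPart n m d) : generator x * c ∈ lengthPart n m (d + 1) := by
  induction hc using Submodule.span_induction with
  | mem c hc =>
    obtain ⟨G, rfl, rfl⟩ := hc
    rw [← wedge_cons]
    simpa using wedge_mem_lengthPart (x :: G)
  | zero => simp
  | add a b _ _ ha hb => rw [mul_add]; exact Submodule.add_mem _ ha hb
  | smul r a _ ha => rw [mul_smul_comm]; exact Submodule.smul_mem _ r ha

theorem gTildeBracket_mem {p q : ZMod 2} {g h : GTilde n m} (hg : g ∈ gTildeParity n m p)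
    (hh : h ∈ gTildeParity n m q) : gTildeBracket n m g h ∈ gTildeParity n m (p + q) :=
  bracket_mem_parityPart hg hh

theorem ospBracket_mem {p q : ZMod 2} {η : Osp n m} {h : GTilde n m}
    (hη : (η : Ham n m) ∈ parityPart (vPar n m) p)
    (hh : h ∈ gTildeParity n m q) : ospBracket n m η h ∈ gTildeParity n m (p + q) :=
  bracket_mem_parityPart hη hh

/-- The boundary of a product in terms of the boundary of its last factors. -/
theorem ceBoundary_succ {l : ℕ} (g : Fin (l + 1) → GTilde n m) (p : Fin (l + 1) → ZMod 2)
    (hg : ∀ i, g i ∈ gTildeParity n m (p i)) :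
    ceBoundary g p = ∑ j : Fin l, sgn (p 0 * ∑ k ∈ Finset.Iio j, p k.succ) •
        wedge (List.ofFn (Function.update (fun i => g i.succ) j
          (gTildeBracket n m (g 0) (g j.succ)))) -
      generator (g 0) * ceBoundary (fun i => g i.succ) (fun i => p i.succ) := by
  have hfirst : ∀ j : Fin l, ((List.finRange (l + 1)).filter fun k => k ≠ 0 ∧ k ≠ j.succ).map g =
      ((List.finRange l).filter fun k => k ≠ j).map fun i => g i.succ := by
    intro j
    rw [List.finRange_succ]
    simp [List.filter_map, Function.comp_def]
  have hlater : ∀ i j : Fin l,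
      ((List.finRange (l + 1)).filter fun k => k ≠ i.succ ∧ k ≠ j.succ).map g =
      g 0 :: ((List.finRange l).filter fun k => k ≠ i ∧ k ≠ j).map fun i => g i.succ := by
    intro i j
    rw [List.finRange_succ]
    simp [List.filter_map, Function.comp_def, (Fin.succ_ne_zero _).symm]
  rw [ceBoundary, Fin.sum_univ_succ, sub_eq_add_neg]
  congr 1
  -- the brackets with the first factor are moved to the position of the second one
  · rw [Fin.sum_univ_succ, if_neg (lt_irrefl _), zero_add]
    refine Finset.sum_congr rfl fun j _ => ?_
    rw [if_pos (Fin.succ_pos j), hfirst, wedge_cons_erase _ (fun i => p i.succ)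
      (fun i => hg i.succ) j (gTildeBracket_mem (hg 0) (hg j.succ)), smul_smul, ← sgn_add,
      sum_Iio_zero, sum_Iio_succ]
    congr 2
    generalize ∑ k ∈ Finset.Iio j, p k.succ = s
    push_cast [Fin.val_succ, Fin.val_zero]
    generalize ((j : ℕ) : ZMod 2) = x
    have hs : ∀ a b s x : ZMod 2,
      a * 0 + b * (a + s) + a * b + (0 + (x + 1) + 1) + ((a + b) * s + x) = a * s := by decide
    rw [hs]
  -- in the remaining brackets the first factor is moved to the front
  · rw [ceBoundary, Finset.mul_sum _ _ (generator (g 0)), ← Finset.sum_neg_distrib]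
    refine Finset.sum_congr rfl fun i _ => ?_
    rw [Fin.sum_univ_succ, if_neg (Fin.not_lt_zero _), zero_add,
      Finset.mul_sum _ _ (generator (g 0)),
      ← Finset.sum_neg_distrib]
    refine Finset.sum_congr rfl fun j _ => ?_
    by_cases hij : i < j
    · rw [if_pos hij, if_pos (Fin.succ_lt_succ_iff.2 hij), hlater, wedge_cons, wedge_cons,
        ← mul_assoc, generator_mul_generator (gTildeBracket_mem (hg i.succ) (hg j.succ)) (hg 0),
        smul_mul_assoc, mul_assoc, ← wedge_cons, smul_smul, mul_smul_comm, ← neg_smul, neg_sgn,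
        neg_sgn, ← sgn_add, sum_Iio_succ, sum_Iio_succ]
      congr 2
      generalize ∑ k ∈ Finset.Iio i, p k.succ = s
      generalize ∑ k ∈ Finset.Iio j, p k.succ = s'
      push_cast [Fin.val_succ]
      generalize ((j : ℕ) : ZMod 2) = x
      generalize ((i : ℕ) : ZMod 2) = y
      have hs : ∀ o a b s s' z : ZMod 2, a * (o + s) + b * (o + s') + a * b + z +
        ((a + b) * o + 1) = a * s + b * s' + a * b + z + 1 := by decide
      have hz : y + 1 + (x + 1) + 1 = y + x + 1 := by
        revert x y; decide
      rw [hz, hs]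
    · rw [if_neg hij, if_neg (fun h => hij (Fin.succ_lt_succ_iff.1 h)), mul_zero, neg_zero]

theorem ceBoundary_mem {l : ℕ} (g : Fin l → GTilde n m) (p : Fin l → ZMod 2)
    (hg : ∀ i, g i ∈ gTildeParity n m (p i)) : ceBoundary g p ∈ lengthPart n m (l + 1) := by
  induction l with
  | zero => simp [ceBoundary]
  | succ l ih =>
    rw [ceBoundary_succ g p hg]
    have hz : ((l + 1 : ℕ) : ZMod 2) + 1 = l := by
      push_cast
      generalize (l : ZMod 2) = x
      revert x; decide
    refine Submodule.sub_mem _ (Submodule.sum_mem _ fun j _ => Submodule.smul_mem _ _ ?_) ?_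
    · rw [hz]
      simpa using wedge_mem_lengthPart (List.ofFn (Function.update (fun i => g i.succ) j
          (gTildeBracket n m (g 0) (g j.succ))))
    · have h := generator_mul_mem (g 0) (ih _ (fun i => p i.succ) fun i => hg i.succ)
      simpa using h

end Chains

/-! ### Chains as functions on `A ⊗ V` -/

namespace ContractibleDGFrobenius

variable {A : Type*} [NonUnitalRing A] [Module ℝ A] [IsScalarTower ℝ A A] [SMulCommClass ℝ A A]

variable {F : ContractibleDGFrobenius A}

namespace Frame

variable (Θ : F.Frame) {n m : ℕ}

variable (n m) in
/-- Multiplication by `Ψ(h)` with the sign rule for the odd map `Ψ`: the two summands keep track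
of the parity of the number of factors. -/
def chainFactor : GTilde n m →ₗ[ℝ] Module.End ℝ (Θ.Fun n m × Θ.Fun n m) :=
  LinearMap.mk₂ ℝ (fun h f => (Θ.psiLinear n m (parityInvolution (vPar n m) h) * f.2,
      Θ.psiLinear n m h * f.1))
    (fun g h f => by simp [add_mul]) (fun r h f => by simp [smul_mul_assoc])
    (fun h f g => by simp [mul_add]) (fun r h f => by simp [mul_smul_comm])

theorem chainFactor_apply (h : GTilde n m) (f : Θ.Fun n m × Θ.Fun n m) :
    Θ.chainFactor n m h f = (Θ.psiLinear n m (parityInvolution (vPar n m) h) * f.2,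
      Θ.psiLinear n m h * f.1) := rfl

theorem chainFactor_apply_of_mem {p : ZMod 2} {h : GTilde n m} (hp : h ∈ gTildeParity n m p)
    (f : Θ.Fun n m × Θ.Fun n m) : Θ.chainFactor n m h f =
      (sgn p • (Θ.psiLinear n m h * f.2), Θ.psiLinear n m h * f.1) := by
  have h1 : parityInvolution (vPar n m) h = sgn p • (h : Ham n m) := parityInvolution_of_mem hp
  rw [chainFactor_apply, h1, map_smul, smul_mul_assoc]

theorem psiLinear_mem_of_gTilde {p : ZMod 2} {h : GTilde n m} (hh : h ∈ gTildeParity n m p) :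
    Θ.psiLinear n m h ∈ parityPart (tensorPar Θ.par n m) (p + 1) :=
  Θ.psiLinear_mem hh

theorem psiLinear_mul_comm {p q : ZMod 2} {g h : GTilde n m} (hg : g ∈ gTildeParity n m p)
    (hh : h ∈ gTildeParity n m q) : Θ.psiLinear n m g * Θ.psiLinear n m h =
      sgn ((p + 1) * (q + 1)) • (Θ.psiLinear n m h * Θ.psiLinear n m g) :=
  mul_comm_of_mem (Θ.psiLinear_mem hg) (Θ.psiLinear_mem hh)

variable (n m) in
/-- The action of chains on pairs of functions. The matrices attached to `g` and `h` satisfy the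
relation of the exterior algebra because `Ψ` is odd. -/
def chainHom : Chains n m →ₐ[ℝ] Module.End ℝ (Θ.Fun n m × Θ.Fun n m) :=
  RingQuot.liftAlgHom ℝ ⟨TensorAlgebra.lift ℝ (Θ.chainFactor n m), by
    rintro _ _ ⟨hg, hh⟩
    rename_i p q g h
    rw [map_mul, map_smul, map_mul, TensorAlgebra.lift_ι_apply, TensorAlgebra.lift_ι_apply]
    refine LinearMap.ext fun f => ?_
    have hs : ∀ p q : ZMod 2, p + (p + 1) * (q + 1) = p * q + 1 + q := by decide
    have hc := Θ.psiLinear_mul_comm hg hh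
    rw [LinearMap.smul_apply, Module.End.mul_apply, Module.End.mul_apply,
      Θ.chainFactor_apply_of_mem hg, Θ.chainFactor_apply_of_mem hh,
      Θ.chainFactor_apply_of_mem hh, Θ.chainFactor_apply_of_mem hg]
    have hs' : sgn p * sgn ((p + 1) * (q + 1)) = -sgn (p * q) * sgn q := by
      rw [← sgn_add, hs, sgn_add, neg_sgn]
    have hs'' : sgn q * sgn ((p + 1) * (q + 1)) = -sgn (p * q) * sgn p := by
      rw [_root_.mul_comm p q, ← sgn_add, _root_.mul_comm (p + 1), hs, sgn_add, neg_sgn]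
    rw [Prod.smul_mk]
    refine Prod.ext ?_ ?_
    · simp only []
      rw [← mul_assoc, ← mul_assoc, hc, smul_mul_assoc, smul_smul, smul_smul, hs']
    · simp only [mul_smul_comm]
      rw [← mul_assoc, ← mul_assoc, hc, smul_mul_assoc, smul_smul, smul_smul, hs'']⟩

theorem chainHom_generator (h : GTilde n m) : Θ.chainHom n m (generator h) =
    Θ.chainFactor n m h := by
  refine (RingQuot.liftAlgHom_mkAlgHom_apply ℝ _ _ _).trans ?_
  exact TensorAlgebra.lift_ι_apply _ _

variable (n m) in
/-- The linear map that sends `h_1 ∧ ⋯ ∧ h_l` to `± Ψ(h_1) ⋯ Ψ(h_l)`, obtained by acting on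
`(1, 0)`; the result has only one nonzero component, which one depending on the parity of `l`. -/
def chainMap : Chains n m →ₗ[ℝ] Θ.Fun n m :=
  (LinearMap.fst ℝ _ _ + LinearMap.snd ℝ _ _) ∘ₗ
    LinearMap.applyₗ ((1, 0) : Θ.Fun n m × Θ.Fun n m) ∘ₗ
    (Θ.chainHom n m).toLinearMap

theorem chainMap_apply (c : Chains n m) : Θ.chainMap n m c =
    (Θ.chainHom n m c (1, 0)).1 + (Θ.chainHom n m c (1, 0)).2 := rfl

theorem chainMap_one : Θ.chainMap n m (wedge []) = 1 := by
  simp [chainMap_apply, wedge]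

/-- Chains with an even (odd) number of factors act by even (odd) matrices. -/
theorem chainHom_eq_zero (G : List (GTilde n m)) :
    ((G.length : ZMod 2) = 0 → (Θ.chainHom n m (wedge G) (1, 0)).2 = 0) ∧
      ((G.length : ZMod 2) = 1 → (Θ.chainHom n m (wedge G) (1, 0)).1 = 0) := by
  induction G with
  | nil => simp [wedge]
  | cons g G ih =>
    have hz : ∀ x : ZMod 2, (x + 1 = 0 → x = 1) ∧ (x + 1 = 1 → x = 0) := by decide
    rw [wedge_cons, map_mul, Module.End.mul_apply, chainHom_generator, chainFactor_apply]
    simp only [List.length_cons, Nat.cast_add, Nat.cast_one]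
    exact ⟨fun h => by rw [ih.2 ((hz _).1 h), mul_zero], fun h => by
      rw [ih.1 ((hz _).2 h), mul_zero]⟩

theorem chainMap_generator_mul {p d : ZMod 2} {g : GTilde n m} (hg : g ∈ gTildeParity n m p)
    {c : Chains n m} (hc : c ∈ lengthPart n m d) : Θ.chainMap n m (generator g * c) =
      sgn (p * d) • (Θ.psiLinear n m g * Θ.chainMap n m c) := by
  induction hc using Submodule.span_induction with
  | mem c hc =>
    obtain ⟨G, rfl, rfl⟩ := hc
    rw [chainMap_apply, chainMap_apply, map_mul, Module.End.mul_apply, chainHom_generator,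
      Θ.chainFactor_apply_of_mem hg]
    rcases zmod_two_cases (G.length : ZMod 2) with h | h
    · rw [(Θ.chainHom_eq_zero G).1 h, h]; simp
    · rw [(Θ.chainHom_eq_zero G).2 h, h]; simp
  | zero => simp
  | add a b _ _ ha hb => rw [mul_add, map_add, ha, hb, map_add, mul_add, smul_add]
  | smul r a _ ha => rw [mul_smul_comm, map_smul, ha, map_smul, mul_smul_comm, smul_comm]

theorem chainMap_wedge {l : ℕ} (h : Fin l → GTilde n m) (p : Fin l → ZMod 2)
    (hp : ∀ i, h i ∈ gTildeParity n m (p i)) : Θ.chainMap n m (wedge (List.ofFn h)) =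
      sgn (∑ j : Fin l, ∑ i ∈ Finset.Iio j, p i) •
        (List.ofFn fun i => Θ.psiLinear n m (h i)).prod := by
  induction l with
  | zero => simp [chainMap_one]
  | succ l ih =>
    rw [List.ofFn_succ, wedge_cons, Θ.chainMap_generator_mul (hp 0) (wedge_mem_lengthPart _),
      ih _ (fun i => p i.succ) fun i => hp i.succ, List.ofFn_succ, List.prod_cons,
      Fin.sum_univ_succ, sum_Iio_zero, zero_add]
    simp only [sum_Iio_succ, Finset.sum_add_distrib, Finset.sum_const, Finset.card_univ,
      Fintype.card_fin, nsmul_eq_mul, sgn_add, List.length_ofFn, mul_smul_comm, smul_smul]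
    rw [_root_.mul_comm (p 0)]

/-- A superderivation that acts on the functions `Ψ(g_i)` acts on products of them. -/
theorem superDerivation_chainMap {q : ZMod 2} {X : Θ.Fun n m →ₗ[ℝ] Θ.Fun n m}
    (hX : IsSuperDerivation q X) {l : ℕ} (g g' : Fin l → GTilde n m) (p : Fin l → ZMod 2)
    (hg : ∀ i, g i ∈ gTildeParity n m (p i)) (hg' : ∀ i, g' i ∈ gTildeParity n m (q + p i))
    (h : ∀ i, X (Θ.psiLinear n m (g i)) = sgn q • Θ.psiLinear n m (g' i)) :
    X (Θ.chainMap n m (wedge (List.ofFn g))) = sgn (q * l) • ∑ i : Fin l,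
      sgn (q * ∑ k ∈ Finset.Iio i, p k) •
        Θ.chainMap n m (wedge (List.ofFn (Function.update g i (g' i)))) := by
  induction l with
  | zero => simp [chainMap_one, hX.map_one]
  | succ l ih =>
    have ih' := ih (fun i => g i.succ) (fun i => g' i.succ) (fun i => p i.succ)
      (fun i => hg i.succ) (fun i => hg' i.succ) (fun i => h i.succ)
    have hlen : ∀ f : Fin l → GTilde n m, wedge (List.ofFn f) ∈ lengthPart n m l := fun f => by
      simpa using wedge_mem_lengthPart (List.ofFn f)
    rw [List.ofFn_succ, wedge_cons, Θ.chainMap_generator_mul (hg 0) (hlen _), map_smul,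
      hX.leibniz _ (Θ.psiLinear_mem_of_gTilde (hg 0)), ih', h, Fin.sum_univ_succ,
      sum_Iio_zero, mul_zero,
      sgn_zero, one_smul, ofFn_update_zero, wedge_cons, Θ.chainMap_generator_mul (hg' 0) (hlen _)]
    simp only [ofFn_update_succ, wedge_cons, Θ.chainMap_generator_mul (hg 0) (hlen _), sum_Iio_succ]
    simp only [smul_add, Finset.smul_sum, Finset.mul_sum _ _ (Θ.psiLinear n m (g 0)),
      mul_smul_comm, smul_mul_assoc,
      smul_smul, Nat.cast_add, Nat.cast_one]
    generalize (l : ZMod 2) = d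
    congr 1
    · congr 1
      have hs : ∀ p q d : ZMod 2, p * d + q = q * (d + 1) + (q + p) * d := by decide
      rw [← sgn_add, ← sgn_add, hs]
    · refine Finset.sum_congr rfl fun i _ => ?_
      congr 1
      have hs : ∀ p q d s : ZMod 2, p * d + (q * (p + 1) + (q * d + q * s)) =
        q * (d + 1) + (q * (p + s) + p * d) := by decide
      simp only [← sgn_add]
      rw [hs]

end Frame

end ContractibleDGFrobenius


namespace ContractibleDGFrobenius

variable {A : Type*} [NonUnitalRing A] [Module ℝ A] [IsScalarTower ℝ A A] [SMulCommClass ℝ A A]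

variable {F : ContractibleDGFrobenius A}

/-! ### The cocycles and their independence of the gauge -/

namespace BasisFrame

variable (Θ : F.BasisFrame) {n m : ℕ}

/-- `D` is a derivation that kills every `Ψ(h)`. -/
theorem differential_chainMap {l : ℕ} (g : Fin l → GTilde n m) (p : Fin l → ZMod 2)
    (hg : ∀ i, g i ∈ gTildeParity n m (p i)) :
    Θ.differential n m (Θ.chainMap n m (wedge (List.ofFn g))) = 0 := by
  induction l with
  | zero => simp [Θ.chainMap_one, Θ.isSuperDerivation_differential.map_one]
  | succ l ih =>
    rw [List.ofFn_succ, wedge_cons, Θ.chainMap_generator_mul (hg 0) (wedge_mem_lengthPart _),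
      map_smul, Θ.isSuperDerivation_differential.leibniz _ (Θ.psiLinear_mem_of_gTilde (hg 0)),
      ih _ (fun i => p i.succ) fun i => hg i.succ, Θ.differential_psiLinear, zero_mul, mul_zero,
      smul_zero, add_zero, smul_zero]

theorem mem_orderPart_two (g : GTilde n m) : (g : Ham n m) ∈ orderPart (vPar n m) 2 :=
  orderPart_anti _ (by omega) g.2

/-- The odd Laplacian on functions corresponds to the Chevalley-Eilenberg boundary on chains. -/
theorem oddLaplace_chainMap {l : ℕ} (g : Fin l → GTilde n m) (p : Fin l → ZMod 2)
    (hg : ∀ i, g i ∈ gTildeParity n m (p i)) :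
    Θ.oddLaplace n m (Θ.chainMap n m (wedge (List.ofFn g))) =
      Θ.chainMap n m (ceBoundary g p) := by
  induction l with
  | zero =>
    rw [List.ofFn_zero, Θ.chainMap_one, oddLaplace, laplace_apply']
    simp [(Θ.isSuperDerivation_pd _ (Θ.dual_mem _)).map_one, ceBoundary]
  | succ l ih =>
    have hG : wedge (List.ofFn fun i => g i.succ) ∈ lengthPart n m l := by
      simpa using wedge_mem_lengthPart (List.ofFn fun i => g i.succ)
    have hz : p 0 + 1 + 1 = p 0 := by
      have : ∀ x : ZMod 2, x + 1 + 1 = x := by decide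
      exact this _
    -- the bracket with `Ψ(g_0)` yields the brackets of `g_0` with the other factors
    have hbr := Θ.superDerivation_chainMap
      (Θ.isSuperDerivation_antibracket (Θ.psiLinear_mem_of_gTilde (hg 0)))
      (fun i => g i.succ) (fun i => gTildeBracket n m (g 0) (g i.succ)) (fun i => p i.succ)
      (fun i => hg i.succ) (fun i => by rw [hz]; exact gTildeBracket_mem (hg 0) (hg i.succ))
      (fun i => by
        rw [hz]
        exact Θ.antibracket_psiLinear (mem_orderPart_two _) (hg 0) (mem_orderPart_two _))
    rw [hz] at hbr
    rw [List.ofFn_succ, wedge_cons, Θ.chainMap_generator_mul (hg 0) hG, map_smul,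
      Θ.oddLaplace_mul (Θ.psiLinear_mem_of_gTilde (hg 0)), Θ.oddLaplace_psiLinear,
      ih _ (fun i => p i.succ) fun i => hg i.succ, hbr, ceBoundary_succ g p hg, map_sub, map_sum,
      Θ.chainMap_generator_mul (hg 0) (ceBoundary_mem _ _ fun i => hg i.succ), zero_mul, zero_add,
      smul_add, smul_smul, smul_smul, sgn_mul_self, one_smul, add_comm, sub_eq_add_neg,
      ← superPoly_neg_smul, ← sgn_add, neg_sgn]
    congr 1
    · exact Finset.sum_congr rfl fun i _ => (map_smul _ _ _).symm
    · have hs : ∀ a d : ZMod 2, a * d + (a + 1) = a * (d + 1) + 1 := by decide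
      rw [hs]

theorem hamField_chainMap {q : ZMod 2} {η : Osp n m} (hq : (η : Ham n m) ∈ parityPart (vPar n m) q)
    {l : ℕ} (g : Fin l → GTilde n m) (p : Fin l → ZMod 2)
    (hg : ∀ i, g i ∈ gTildeParity n m (p i)) :
    Θ.hamField q η (Θ.chainMap n m (wedge (List.ofFn g))) =
      sgn (q * l) • Θ.chainMap n m (ospAction η q g p) := by
  rw [Θ.superDerivation_chainMap (Θ.isSuperDerivation_hamField hq) g
    (fun i => ospBracket n m η (g i)) p hg (fun i => ospBracket_mem hq (hg i))
    (fun i => Θ.hamField_psiLinear η.2 hq _), ospAction, map_sum]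
  congr 1
  exact Finset.sum_congr rfl fun i _ => (map_smul _ _ _).symm

theorem chainMap_ospAction {q : ZMod 2} {η : Osp n m}
    (hq : (η : Ham n m) ∈ parityPart (vPar n m) q) {l : ℕ} (g : Fin l → GTilde n m)
    (p : Fin l → ZMod 2) (hg : ∀ i, g i ∈ gTildeParity n m (p i)) :
    Θ.chainMap n m (ospAction η q g p) = Θ.hamField q η
      (sgn (q * l) • Θ.chainMap n m (wedge (List.ofFn g))) := by
  rw [map_smul, Θ.hamField_chainMap hq g p hg, smul_smul, sgn_mul_self, one_smul]

section Homotopies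

variable {L L' : Submodule ℝ A} {s s' : A →ₗ[ℝ] A}

theorem laplace_hamField {q : ZMod 2} {η : Ham n m} (hq : η ∈ parityPart (vPar n m) q)
    (hs : F.IsHomotopy L s) (f : Θ.Fun n m) :
    Θ.laplace n m 1 s (Θ.hamField q η f) = Θ.hamField q η (Θ.laplace n m 1 s f) := by
  have h := Θ.hamField_laplace hq hs.hasParity f
  have hz : (1 : ZMod 2) + 1 = 0 := by decide
  rwa [hz, mul_zero, sgn_zero, one_smul] at h

theorem laplace_commute (hs : F.IsHomotopy L s) (hs' : F.IsHomotopy L' s') (f : Θ.Fun n m) :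
    Θ.laplace n m 1 s (Θ.laplace n m 1 s' f) = Θ.laplace n m 1 s' (Θ.laplace n m 1 s f) := by
  have h := Θ.laplace_laplace hs.hasParity hs'.hasParity f
  have hz : (1 : ZMod 2) + 1 = 0 := by decide
  rwa [hz, mul_zero, sgn_zero, one_smul] at h

theorem laplace_oddLaplace (hs : F.IsHomotopy L s) (f : Θ.Fun n m) :
    Θ.laplace n m 1 s (Θ.oddLaplace n m f) = Θ.oddLaplace n m (Θ.laplace n m 1 s f) := by
  have h := Θ.laplace_laplace (n := n) (m := m) hs.hasParity (hasParity_id (F := F)) f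
  have hz : (1 : ZMod 2) + 1 = 0 := by decide
  rwa [hz, zero_mul, sgn_zero, one_smul] at h

theorem hasParity_comp_homotopies (hs : F.IsHomotopy L s) (hs' : F.IsHomotopy L' s') :
    F.HasParity 0 (s ∘ₗ s') := by
  have h := hs.hasParity.comp hs'.hasParity
  have hz : (1 : ZMod 2) + 1 = 0 := by decide
  rwa [hz] at h

theorem laplace_add_smul (τ : ZMod 2) (T T' : A →ₗ[ℝ] A) (r : ℝ) (f : Θ.Fun n m) :
    Θ.laplace n m τ (T + r • T') f = Θ.laplace n m τ T f + r • Θ.laplace n m τ T' f := by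
  simp only [laplace_apply', LinearMap.add_apply, LinearMap.smul_apply, map_add, map_smul,
    smul_add, Finset.sum_add_distrib, Finset.smul_sum, smul_smul]
  congr 1
  refine Finset.sum_congr rfl fun i _ => Finset.sum_congr rfl fun α _ => ?_
  congr 1
  ring

theorem laplace_differential (hs : F.IsHomotopy L s) (f : Θ.Fun n m) :
    Θ.laplace n m 1 s (Θ.differential n m f) =
      Θ.differential n m (Θ.laplace n m 1 s f) + (-1 : ℝ) • Θ.oddLaplace n m f := by
  have h := Θ.differential_laplace (n := n) (m := m) hs.hasParity f
  have hz : (1 : ZMod 2) + 1 = 0 := by decide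
  have hid : F.d ∘ₗ s + (1 : ℝ) • (s ∘ₗ F.d) = LinearMap.id :=
    LinearMap.ext fun a => by simpa using hs.d_add a
  rw [hz, sgn_zero, one_smul, hid] at h
  change _ = _ + Θ.oddLaplace n m f at h
  rw [h, superPoly_neg_one_smul, add_neg_cancel_right]

/-- The composition of two homotopies yields a homotopy between their propagators. -/
theorem differential_laplace_comp (hs : F.IsHomotopy L s) (hs' : F.IsHomotopy L' s')
    (f : Θ.Fun n m) : Θ.differential n m (Θ.laplace n m 0 (s ∘ₗ s') f) +
      Θ.laplace n m 0 (s ∘ₗ s') (Θ.differential n m f) + Θ.laplace n m 1 s f =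
        Θ.laplace n m 1 s' f := by
  have h := Θ.differential_laplace (n := n) (m := m) (hasParity_comp_homotopies hs hs') f
  have hT : F.d ∘ₗ s ∘ₗ s' + (-1 : ℝ) • ((s ∘ₗ s') ∘ₗ F.d) = s' + (-1 : ℝ) • s := by
    refine LinearMap.ext fun a => ?_
    have h1 := hs.d_add (s' a)
    have h2 := congrArg s (hs'.d_add a)
    rw [map_add] at h2
    simp only [LinearMap.add_apply, LinearMap.smul_apply, LinearMap.comp_apply]
    rw [← eq_sub_iff_add_eq] at h1 h2
    rw [h1, eq_sub_iff_add_eq.1 h2 |>.symm]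
    module
  rw [zero_add, sgn_one, hT, Θ.laplace_add_smul] at h
  rw [h]
  simp only [superPoly_neg_one_smul]
  abel

theorem laplace_comp_oddLaplace (hs : F.IsHomotopy L s) (hs' : F.IsHomotopy L' s')
    (f : Θ.Fun n m) : Θ.laplace n m 0 (s ∘ₗ s') (Θ.oddLaplace n m f) =
      (-1 : ℝ) • Θ.oddLaplace n m (Θ.laplace n m 0 (s ∘ₗ s') f) := by
  have h := Θ.laplace_laplace (n := n) (m := m) (hasParity_comp_homotopies hs hs')
    (hasParity_id (F := F)) f
  rwa [zero_add, mul_one, sgn_one] at h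

theorem wickExpectation_hamField (hs : F.IsHomotopy L s) {q : ZMod 2} {η : Ham n m}
    (hq : η ∈ parityPart (vPar n m) q) (f : Θ.Fun n m) :
    Θ.wickExpectation n m s (Θ.hamField q η f) = 0 := by
  have h := (Θ.lowers_laplace n m 1 s).expFunctional_comp (evalZero (tensorPar Θ.par n m))
    (Z := Θ.hamField q η) (Y := 0)
    (fun f => by rw [Θ.laplace_hamField hq hs, LinearMap.zero_apply, add_zero])
    (fun f => by rw [LinearMap.zero_apply, LinearMap.zero_apply, map_zero])
    (Θ.evalZero_hamField q η) f
  rw [LinearMap.zero_apply, map_zero] at h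
  exact h

theorem wickExpectation_differential (hs : F.IsHomotopy L s) (f : Θ.Fun n m) :
    Θ.wickExpectation n m s (Θ.differential n m f) =
      -Θ.wickExpectation n m s (Θ.oddLaplace n m f) := by
  have h := (Θ.lowers_laplace n m 1 s).expFunctional_comp (evalZero (tensorPar Θ.par n m))
    (Z := Θ.differential n m) (Y := (-1 : ℝ) • Θ.oddLaplace n m)
    (Θ.laplace_differential hs)
    (fun f => by
      rw [LinearMap.smul_apply, LinearMap.smul_apply, map_smul, Θ.laplace_oddLaplace hs])
    Θ.evalZero_differential f
  rw [LinearMap.smul_apply, map_smul, smul_eq_mul, neg_one_mul] at h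
  exact h

variable (n m) in
/-- The functional whose composition with `D + Δ` is the difference of two expectations. -/
def transgression (s s' : A →ₗ[ℝ] A) : Θ.Fun n m →ₗ[ℝ] ℝ :=
  (Θ.lowers_laplace n m 1 s).homotopyFunctional (Θ.laplace n m 0 (s ∘ₗ s'))
    (Θ.lowers_laplace n m 1 s') (evalZero (tensorPar Θ.par n m))

theorem wickExpectation_sub (hs : F.IsHomotopy L s) (hs' : F.IsHomotopy L' s') (f : Θ.Fun n m) :
    Θ.wickExpectation n m s' f - Θ.wickExpectation n m s f =
      Θ.transgression n m s s' (Θ.differential n m f + Θ.oddLaplace n m f) :=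
  (Θ.lowers_laplace n m 1 s).expFunctional_sub (Θ.lowers_laplace n m 1 s') _
    (Θ.laplace_commute hs hs') (Θ.laplace_differential hs) (Θ.laplace_differential hs')
    (Θ.laplace_oddLaplace hs) (Θ.laplace_oddLaplace hs') (Θ.differential_laplace_comp hs hs')
    (Θ.laplace_comp_oddLaplace hs hs') Θ.evalZero_differential f

theorem transgression_hamField (hs : F.IsHomotopy L s) (hs' : F.IsHomotopy L' s') {q : ZMod 2}
    {η : Ham n m} (hq : η ∈ parityPart (vPar n m) q) (f : Θ.Fun n m) :
    Θ.transgression n m s s' (Θ.hamField q η f) = 0 :=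
  (Θ.lowers_laplace n m 1 s).homotopyFunctional_comp (Θ.lowers_laplace n m 1 s') _
    (Θ.laplace_hamField hq hs) (Θ.laplace_hamField hq hs')
    (Θ.hamField_laplace hq (hasParity_comp_homotopies hs hs')) (Θ.evalZero_hamField q η) f

variable (n m) in
/-- The functional `S_A^L` on chains, where `s` is a homotopy with image in `L`. -/
def functionalS (s : A →ₗ[ℝ] A) : Cochains n m :=
  (Θ.wickExpectation n m s ∘ₗ Θ.chainMap n m : Chains n m →ₗ[ℝ] ℝ)

theorem functionalS_apply (s : A →ₗ[ℝ] A) (c : Chains n m) :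
    Θ.functionalS n m s c = Θ.wickExpectation n m s (Θ.chainMap n m c) := rfl

theorem functionalS_mem (hs : F.IsHomotopy L s) : Θ.functionalS n m s ∈ relCocycles n m := by
  refine ⟨fun q η hη l g p hg => ?_, fun l g p hg => ?_⟩
  · rw [functionalS_apply, Θ.chainMap_ospAction hη g p hg, Θ.wickExpectation_hamField hs hη]
  · rw [functionalS_apply, ← Θ.oddLaplace_chainMap g p hg, ← neg_eq_zero,
      ← Θ.wickExpectation_differential hs, Θ.differential_chainMap g p hg, map_zero]

/-- The transgression, composed with `chainMap`, is a relative cochain whose coboundary is the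
difference of the two functionals. -/
theorem functionalS_sub_mem (hs : F.IsHomotopy L s) (hs' : F.IsHomotopy L' s') :
    Θ.functionalS n m s' - Θ.functionalS n m s ∈ relCoboundaries n m := by
  let ψ : Cochains n m :=
    (Θ.transgression n m s s' ∘ₗ Θ.chainMap n m : Chains n m →ₗ[ℝ] ℝ)
  have hψ : ∀ c, ψ c = Θ.transgression n m s s' (Θ.chainMap n m c) := fun _ => rfl
  refine ⟨ψ, fun q η hη l g p hg => ?_, fun l g p hg => ?_⟩
  · rw [hψ, Θ.chainMap_ospAction hη g p hg, Θ.transgression_hamField hs hs' hη]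
  · have h : (Θ.functionalS n m s' - Θ.functionalS n m s) (wedge (List.ofFn g)) =
        Θ.functionalS n m s' (wedge (List.ofFn g)) - Θ.functionalS n m s (wedge (List.ofFn g)) :=
      rfl
    rw [h, functionalS_apply, functionalS_apply, Θ.wickExpectation_sub hs hs', hψ,
      Θ.differential_chainMap g p hg, zero_add, Θ.oddLaplace_chainMap g p hg]

theorem isFunctionalS_functionalS [Module.Finite ℝ A] (hL : F.IsGauge L)
    (hs : F.IsHomotopy L s) : F.IsFunctionalS L (Θ.functionalS n m s) := by
  intro Ξ l h p hp
  have hlist :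
      (List.ofFn fun i => F.psi Ξ.par (fun α => (Ξ.basis α : A)) n m (h i : Ham n m)).prod =
      Θ.restrict Ξ.frame n m (List.ofFn fun i => Θ.psiLinear n m (h i)).prod := by
    rw [map_list_prod, List.map_ofFn]
    congr 2
    funext i
    exact (Ξ.frame.psi_eq _).trans (Θ.restrict_psiLinear Ξ.frame _).symm
  rw [functionalS_apply, Θ.chainMap_wedge h p hp, map_smul, Coordinates.sValue, smul_eq_mul,
    Complex.ofReal_mul, ← Ξ.expectation_restrict Θ hL hs]
  exact congrArg _ (congrArg _ hlist.symm)

end Homotopies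

end BasisFrame

/-- Two functionals representing `S_A^L` agree on all products of homogeneous elements, so their
difference is the coboundary of zero. -/
theorem IsFunctionalS.sub_mem_relCoboundaries {L : Submodule ℝ A} {n m : ℕ}
    (Ξ : F.Coordinates L n m) {φ φ' : Cochains n m} (h : F.IsFunctionalS L φ)
    (h' : F.IsFunctionalS L φ') : φ - φ' ∈ relCoboundaries n m := by
  refine ⟨0, Submodule.zero_mem _, fun l g p hg => ?_⟩
  have h1 : (φ (wedge (List.ofFn g)) : ℂ) = φ' (wedge (List.ofFn g)) :=
    (h Ξ l g p hg).trans (h' Ξ l g p hg).symm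
  exact sub_eq_zero.2 (Complex.ofReal_injective h1)

end ContractibleDGFrobenius

end DualConstruction

end

theorem mainTheorem4 {A : Type*} [NonUnitalRing A] [Module ℝ A] [IsScalarTower ℝ A A]
    [SMulCommClass ℝ A A] [Module.Finite ℝ A]
    (F : DualConstruction.ContractibleDGFrobenius A) (n m : ℕ) :
    (∃ L : Submodule ℝ A, F.IsGauge L) ∧
    (∀ L : Submodule ℝ A, F.IsGauge L →
      Nonempty (F.Coordinates L n m) ∧ ∀ Θ : F.Coordinates L n m, Θ.integral 1 ≠ 0) ∧
    ∃! c : DualConstruction.RelCohomology n m,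
      ∀ L : Submodule ℝ A, F.IsGauge L →
        ∃ φ : DualConstruction.relCocycles n m,
          F.IsFunctionalS L (φ : DualConstruction.Cochains n m) ∧
          Submodule.Quotient.mk φ = c := by
  obtain ⟨L, hL⟩ := F.exists_isGauge
  obtain ⟨s, hs⟩ := hL.exists_homotopy
  obtain ⟨Θ⟩ := F.exists_basisFrame
  refine ⟨⟨L, hL⟩, fun L hL => ⟨hL.nonempty_coordinates n m,
    fun Ξ => Ξ.integral_one_ne_zero hL⟩, ?_⟩
  refine ⟨Submodule.Quotient.mk ⟨Θ.functionalS n m s, Θ.functionalS_mem hs⟩,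
    fun L' hL' => ?_, fun c hc => ?_⟩
  · obtain ⟨s', hs'⟩ := hL'.exists_homotopy
    refine ⟨⟨Θ.functionalS n m s', Θ.functionalS_mem hs'⟩, Θ.isFunctionalS_functionalS hL' hs',
      (Submodule.Quotient.eq _).2 ?_⟩
    exact Θ.functionalS_sub_mem hs hs'
  · obtain ⟨φ, hφ, rfl⟩ := hc L hL
    obtain ⟨Ξ⟩ := hL.nonempty_coordinates n m
    exact (Submodule.Quotient.eq _).2
      (hφ.sub_mem_relCoboundaries Ξ (Θ.isFunctionalS_functionalS hL hs))
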